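/- A \emph{digraph} on $n\ge 1$ vertices is a pair $G=(V,E)$ with $|V|=n$, $E\subseteq V\times V$. A spanning subgraph $H=(V,E_H)$, $E_H\subseteq E$, is a \emph{$k$-edge (resp. $k$-vertex) connectivity certificate} of $G$ if for all $x,y\in V$: whenever $G$ has at least $k$ pairwise edge-disjoint (resp. distinct, pairwise internally vertex-disjoint) simple directed paths from $x$ to $y$ and also at least $k$ such paths from $y$ to $x$, the same holds in $H$. Theorem. There is a single randomized algorithm (a random access machine program with fair coin flips, unit-cost addition, truncated subtraction, zero-tests and memory access), a polynomial $p$, and absolute constants $C,c$ such that for all $n\ge 1$, all $k\ge 2$ and every digraph $G$ on $n$ vertices (given by its adjacency matrix, together with $n$ and $k$), the algorithm always halts within $p(n)$ steps, whatever the coin flips, and with probability at least $1-1/n^4$ it outputs a digraph $H$ that is both a $k$-edge and a $k$-vertex connectivity certificate of $G$ and has at most $$C\,(1+\log n)^{c}\; k\,2^k\, n^{2-\frac1{k-1}}$$ edges, i.e. $\widetilde O\big(k\,2^k\,n^{2-1/(k-1)}\big)$ edges. -/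

import Mathlib

open MeasureTheory

namespace ConnCert

section Certificates

variable {V : Type*}

/-- `p` is (the vertex sequence of) a simple directed path from `x` to `y` in `G`. -/
def IsPath (G : Digraph V) (x y : V) (p : List V) : Prop :=
  p.head? = some x ∧ p.getLast? = some y ∧ p.IsChain G.Adj ∧ p.Nodup

/-- The edges traversed by a vertex sequence. -/
def pathEdges (p : List V) : List (V × V) := p.zip p.tail

/-- There are at least `k` pairwise edge-disjoint directed paths from `x` to `y` in `G`. -/
def HasEdgeDisjointPaths (G : Digraph V) (k : ℕ) (x y : V) : Prop :=
  ∃ P : Fin k → List V, (∀ i, IsPath G x y (P i)) ∧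
    ∀ i j, i ≠ j → (pathEdges (P i)).Disjoint (pathEdges (P j))

/-- There are at least `k` distinct, pairwise internally vertex-disjoint directed paths
from `x` to `y` in `G`. -/
def HasVertexDisjointPaths (G : Digraph V) (k : ℕ) (x y : V) : Prop :=
  ∃ P : Fin k → List V, (∀ i, IsPath G x y (P i)) ∧
    ∀ i j, i ≠ j → P i ≠ P j ∧ ∀ v, v ∈ P i → v ∈ P j → v = x ∨ v = y

/-- `H` is a `k`-edge connectivity certificate of `G`. -/
def IsEdgeCertificate (k : ℕ) (G H : Digraph V) : Prop :=
  H ≤ G ∧ ∀ x y : V,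
    HasEdgeDisjointPaths G k x y ∧ HasEdgeDisjointPaths G k y x →
    HasEdgeDisjointPaths H k x y ∧ HasEdgeDisjointPaths H k y x

/-- `H` is a `k`-vertex connectivity certificate of `G`. -/
def IsVertexCertificate (k : ℕ) (G H : Digraph V) : Prop :=
  H ≤ G ∧ ∀ x y : V,
    HasVertexDisjointPaths G k x y ∧ HasVertexDisjointPaths G k y x →
    HasVertexDisjointPaths H k x y ∧ HasVertexDisjointPaths H k y x

/-- The number of (directed) edges of `H`. -/
noncomputable def numEdges (H : Digraph V) : ℕ := {e : V × V | H.Adj e.1 e.2}.ncard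

end Certificates

/-! ### Randomized random access machines

A program works on integer variables and on finitely many named two-dimensional arrays with
indirect addressing. The only arithmetic is addition and truncated subtraction (no multiplication),
so a unit-cost computation of `t` steps handles only numbers of bit length at most `t` plus that of
the input and of the program's constants, and unit-cost polynomial time is polynomial time.
Randomness comes from fair coin flips. -/

/-- Integer expressions; `read a i j` is the entry `(i, j)` of the array named `a`. -/
inductive Expr where
  | const (c : ℕ)
  | var (x : ℕ)
  | add (e₁ e₂ : Expr)
  | sub (e₁ e₂ : Expr)
  | read (a : ℕ) (i j : Expr)

/-- Programs. Conditions hold when the expression is nonzero. -/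
inductive Prog where
  | skip
  | assign (x : ℕ) (e : Expr)
  | write (a : ℕ) (i j e : Expr)
  | flip (x : ℕ)
  | seq (c₁ c₂ : Prog)
  | ite (e : Expr) (c₁ c₂ : Prog)
  | while (e : Expr) (c : Prog)

/-- A machine state: the variables, the arrays, and the number of coins flipped so far. -/
structure State where
  var : ℕ → ℕ
  arr : ℕ → ℕ → ℕ → ℕ
  used : ℕ

/-- The value of an expression. -/
def Expr.eval (s : State) : Expr → ℕ
  | .const c => c
  | .var x => s.var x
  | .add e₁ e₂ => e₁.eval s + e₂.eval s
  | .sub e₁ e₂ => e₁.eval s - e₂.eval s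
  | .read a i j => s.arr a (i.eval s) (j.eval s)

/-- The number of elementary operations in evaluating an expression. -/
def Expr.cost : Expr → ℕ
  | .const _ => 1
  | .var _ => 1
  | .add e₁ e₂ => e₁.cost + e₂.cost + 1
  | .sub e₁ e₂ => e₁.cost + e₂.cost + 1
  | .read _ i j => i.cost + j.cost + 1

/-- Set a variable. -/
def State.setVar (s : State) (x v : ℕ) : State :=
  { s with var := Function.update s.var x v }

/-- Set an array entry. -/
def State.setArr (s : State) (a i j v : ℕ) : State :=
  { s with arr := fun a' i' j' => if a' = a ∧ i' = i ∧ j' = j then v else s.arr a' i' j' }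

/-- Flip the next coin of the sequence `ω` into the variable `x`. -/
def State.flip (ω : ℕ → Bool) (s : State) (x : ℕ) : State :=
  { s.setVar x (if ω s.used = true then 1 else 0) with used := s.used + 1 }

/-- `Exec ω c s t s'`: with the coin outcomes `ω`, the program `c` started in the state `s` halts
after exactly `t` elementary steps in the state `s'`. -/
inductive Exec (ω : ℕ → Bool) : Prog → State → ℕ → State → Prop
  | skip (s : State) : Exec ω .skip s 1 s
  | assign (s : State) (x : ℕ) (e : Expr) :
      Exec ω (.assign x e) s (e.cost + 1) (s.setVar x (e.eval s))
  | write (s : State) (a : ℕ) (i j e : Expr) :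
      Exec ω (.write a i j e) s (i.cost + j.cost + e.cost + 1)
        (s.setArr a (i.eval s) (j.eval s) (e.eval s))
  | flip (s : State) (x : ℕ) : Exec ω (.flip x) s 1 (s.flip ω x)
  | seq {c₁ c₂ : Prog} {s s₁ s₂ : State} {t₁ t₂ : ℕ} :
      Exec ω c₁ s t₁ s₁ → Exec ω c₂ s₁ t₂ s₂ → Exec ω (.seq c₁ c₂) s (t₁ + t₂) s₂
  | ite_true {e : Expr} {c₁ c₂ : Prog} {s s' : State} {t : ℕ} :
      e.eval s ≠ 0 → Exec ω c₁ s t s' → Exec ω (.ite e c₁ c₂) s (e.cost + 1 + t) s'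
  | ite_false {e : Expr} {c₁ c₂ : Prog} {s s' : State} {t : ℕ} :
      e.eval s = 0 → Exec ω c₂ s t s' → Exec ω (.ite e c₁ c₂) s (e.cost + 1 + t) s'
  | while_false {e : Expr} {c : Prog} {s : State} :
      e.eval s = 0 → Exec ω (.while e c) s (e.cost + 1) s
  | while_true {e : Expr} {c : Prog} {s s₁ s₂ : State} {t₁ t₂ : ℕ} :
      e.eval s ≠ 0 → Exec ω c s t₁ s₁ → Exec ω (.while e c) s₁ t₂ s₂ →
      Exec ω (.while e c) s (e.cost + 1 + t₁ + t₂) s₂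

/-- The law of an infinite sequence of independent fair coins. -/
noncomputable def coins : Measure (ℕ → Bool) :=
  Measure.infinitePi fun _ => (PMF.uniformOfFintype Bool).toMeasure

open Classical in
/-- The initial state on the input `(G, k)`: variable `0` holds `n`, variable `1` holds `k`,
array `0` holds the adjacency matrix of `G`, and everything else is `0`. -/
noncomputable def inputState {n : ℕ} (G : Digraph (Fin n)) (k : ℕ) : State where
  var x := if x = 0 then n else if x = 1 then k else 0
  arr a i j := if a = 0 ∧ ∃ u v : Fin n, u.val = i ∧ v.val = j ∧ G.Adj u v then 1 else 0
  used := 0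

/-- The digraph in a final state: its adjacency matrix is in array `1`. -/
def outputGraph (n : ℕ) (s : State) : Digraph (Fin n) where
  Adj u v := s.arr 1 u v ≠ 0

/-- The program `A` always halts within `T` steps on the input `(G, k)`, for all coin outcomes. -/
def HaltsWithin (A : Prog) {n : ℕ} (G : Digraph (Fin n)) (k T : ℕ) : Prop :=
  ∀ ω : ℕ → Bool, ∃ t s, Exec ω A (inputState G k) t s ∧ t ≤ T

/-- The probability, over the coins, that `A` halts on the input `(G, k)` with an output digraph
satisfying `Q`. -/
noncomputable def successProb (A : Prog) {n : ℕ} (G : Digraph (Fin n)) (k : ℕ)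
    (Q : Digraph (Fin n) → Prop) : ENNReal :=
  coins {ω | ∃ t s, Exec ω A (inputState G k) t s ∧ Q (outputGraph n s)}

end ConnCert

/-! Put f = k - 1. Edge faults and vertex faults are treated together in the split graph, in which a
vertex becomes an edge from an entry copy to an exit copy. It has N = 2n + 1 vertices, the last of
them isolated and serving as an auxiliary source. By Menger's theorem, a subgraph H of the split
graph that keeps its strongly connected components under every set F of at most f edge faults
(`FTSS`) yields both certificates (`FTSS.isEdgeCertificate`, `FTSS.isVertexCertificate`). Mutual
reachability is what makes a sparse H possible, so both directions are carried along.

To build H, let q = 2^A be about N^(1/f). After the faults F, the component of a vertex x is large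
or small compared with q.

If it is large (more than q/2 vertices), one of about N/q random roots, up to logarithms, lies in
it. For every sampled root r, H receives a subgraph with in-degrees at most 2^f that preserves
reachability from r under f faults, and the mirror image for reachability to r. The component is
then preserved by connecting everything through r.

If it is small, it is spanned by a strongly connected subgraph S with at most q edges
(`exists_sparse`). A random edge set X that contains each pair with probability 1/q includes all of
F but one edge g and avoids S, with probability at least q^(-(f-1))/4. In the graph without X only
the single fault g is left to survive. So for about q^(f-1) samples X, up to logarithms, H receives
a single-fault certificate of the graph without X. A union bound over all pairs (F, x) shows that
with high probability all of them are served (`not_served_le`, `not_all_served_le`). Both kinds of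
edges number about 2^f N^(2-1/f), up to logarithms (`edge_bound`).

Two sparsity facts carry the construction.

First, reachability from a root (`Chain.le_cut`, `Chain.reach`). For a target v, take the largest
minimum cut separating the source from v, make it the new source set and double the capacities
leaving it. After f such rounds, keep only the edges into v that a maximum flow uses. The minimum
cut starts at most at 1 and at most doubles in a round, so at most 2^f edges are kept. By
submodularity every round forces one more kept edge to leave any connected set D from which a
dropped edge leads to v. Hence f + 1 kept edges leave D, too many for f faults.

Second, single faults (`card_crit_le`). Deleting noncritical edges one by one leaves a graph in
which each edge e is critical for some fault g. Group these edges by the size, up to a factor 2, of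
the component of e after the fault g. For a fixed root r and size about m, all components of r of
that size lie in a set of O(m) vertices (`card_smallUnion_le`), and each vertex has at most 2 edges
entering it and 2 edges leaving it that are critical with respect to r, by the first fact with one
fault. So a root sees O(m) such edges, each edge is seen from at least m roots, and double counting
leaves O(N) edges per size.

The algorithm is written with counting loops whose lengths are capped by a polynomial, which makes
termination and running time a matter of syntax (`exec_compile`). For fixed coins it is a
deterministic state transformer, so its correctness (`core_spec`, `certify_spec`) is separate from
the probabilistic estimates. If f is at least the logarithm of N, the factor 2^f pays for all edges
and G itself is returned (`trivial_bound`). -/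

namespace ConnCert

/-! ### Bounded-loop programs -/

/-- Programs whose only loops are counting loops: `loop x y c` runs `c` for the values
`0, 1, …, min (var y) (var 2) - 1` of the variable `x`. -/
inductive FP where
  | skip
  | assign (x : ℕ) (e : Expr)
  | write (a : ℕ) (i j e : Expr)
  | flip (x : ℕ)
  | seq (c₁ c₂ : FP)
  | ite (e : Expr) (c₁ c₂ : FP)
  | loop (x y : ℕ) (c : FP)

infixr:60 " ;; " => FP.seq

namespace FP

/-- One-armed conditional. -/
abbrev when (e : Expr) (c : FP) : FP := .ite e c .skip

/-- The state transformer computed by a bounded-loop program. -/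
def sem (ω : ℕ → Bool) : FP → State → State
  | skip, s => s
  | assign x e, s => s.setVar x (e.eval s)
  | write a i j e, s => s.setArr a (i.eval s) (j.eval s) (e.eval s)
  | flip x, s => s.flip ω x
  | seq c₁ c₂, s => sem ω c₂ (sem ω c₁ s)
  | ite e c₁ c₂, s => if e.eval s ≠ 0 then sem ω c₁ s else sem ω c₂ s
  | loop x y c, s =>
      (fun s => (sem ω c s).setVar x ((sem ω c s).var x + 1))^[min (s.var y) (s.var 2)]
        (s.setVar x 0)

/-- The variables a program may modify. -/
def mv : FP → List ℕ
  | skip => []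
  | assign x _ => [x]
  | write _ _ _ _ => []
  | flip x => [x]
  | seq c₁ c₂ => mv c₁ ++ mv c₂
  | ite _ c₁ c₂ => mv c₁ ++ mv c₂
  | loop x _ c => x :: mv c

/-- The arrays a program may modify. -/
def ma : FP → List ℕ
  | skip => []
  | assign _ _ => []
  | write a _ _ _ => [a]
  | flip _ => []
  | seq c₁ c₂ => ma c₁ ++ ma c₂
  | ite _ c₁ c₂ => ma c₁ ++ ma c₂
  | loop _ _ c => ma c

/-- Whether a program may flip coins. -/
def flips : FP → Bool
  | skip => false
  | assign _ _ => false
  | write _ _ _ _ => false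
  | flip _ => true
  | seq c₁ c₂ => flips c₁ || flips c₂
  | ite _ c₁ c₂ => flips c₁ || flips c₂
  | loop _ _ c => flips c

/-- Loop counters and loop bounds are not modified by loop bodies. -/
def wf : FP → Bool
  | skip => true
  | assign _ _ => true
  | write _ _ _ _ => true
  | flip _ => true
  | seq c₁ c₂ => wf c₁ && wf c₂
  | ite _ c₁ c₂ => wf c₁ && wf c₂
  | loop x y c => wf c && decide (x ≠ y) && decide (x ≠ 2) && decide (x ∉ mv c) &&
      decide (y ∉ mv c) && decide (2 ∉ mv c)

/-- Translation into while-programs. -/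
def compile : FP → Prog
  | skip => .skip
  | assign x e => .assign x e
  | write a i j e => .write a i j e
  | flip x => .flip x
  | seq c₁ c₂ => .seq (compile c₁) (compile c₂)
  | ite e c₁ c₂ => .ite e (compile c₁) (compile c₂)
  | loop x y c => .seq (.assign x (.const 0))
      (.while (.sub (.sub (.var y) (.sub (.var y) (.var 2))) (.var x))
        (.seq (compile c) (.assign x (.add (.var x) (.const 1)))))

/-- `s'` agrees with `s` on everything that `c` cannot modify. -/
structure Frame (c : FP) (s s' : State) : Prop where
  var : ∀ z, z ∉ c.mv → s'.var z = s.var z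
  arr : ∀ a, a ∉ c.ma → s'.arr a = s.arr a
  used : c.flips = false → s'.used = s.used

theorem Frame.rfl' {c : FP} {s : State} : Frame c s s :=
  ⟨fun _ _ => rfl, fun _ _ => rfl, fun _ => rfl⟩

theorem Frame.trans {c : FP} {s s' s'' : State} (h : Frame c s s') (h' : Frame c s' s'') :
    Frame c s s'' :=
  ⟨fun z hz => (h'.var z hz).trans (h.var z hz), fun z hz => (h'.arr z hz).trans (h.arr z hz),
    fun hz => (h'.used hz).trans (h.used hz)⟩

theorem Frame.mono {c d : FP} {s s' : State} (h : Frame c s s') (hv : ∀ z, z ∈ c.mv → z ∈ d.mv)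
    (ha : ∀ z, z ∈ c.ma → z ∈ d.ma) (hf : d.flips = false → c.flips = false) : Frame d s s' :=
  ⟨fun z hz => h.var z fun h' => hz (hv z h'), fun z hz => h.arr z fun h' => hz (ha z h'),
    fun hz => h.used (hf hz)⟩

theorem _root_.ConnCert.State.setVar_var (s : State) (x v z : ℕ) :
    (s.setVar x v).var z = if z = x then v else s.var z := by
  simp [State.setVar, Function.update_apply]

theorem _root_.ConnCert.State.setVar_arr (s : State) (x v : ℕ) : (s.setVar x v).arr = s.arr := rfl

theorem _root_.ConnCert.State.setVar_used (s : State) (x v : ℕ) :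
    (s.setVar x v).used = s.used := rfl

theorem _root_.ConnCert.State.setArr_arr (s : State) (a i j v a' i' j' : ℕ) :
    (s.setArr a i j v).arr a' i' j' = if a' = a ∧ i' = i ∧ j' = j then v else s.arr a' i' j' := rfl

theorem _root_.ConnCert.State.setArr_var (s : State) (a i j v : ℕ) :
    (s.setArr a i j v).var = s.var := rfl

theorem _root_.ConnCert.State.setArr_used (s : State) (a i j v : ℕ) :
    (s.setArr a i j v).used = s.used := rfl

/-- What a program leaves alone is read off its syntax, so later specifications carry untouched
variables, arrays and the coin counter across a program by `decide` or `rfl`. -/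
theorem frame_sem (ω : ℕ → Bool) (c : FP) (s : State) : Frame c s (sem ω c s) := by
  induction c generalizing s with
  | skip => exact Frame.rfl'
  | assign x e =>
    refine ⟨fun z hz => ?_, fun a _ => rfl, fun _ => rfl⟩
    simp only [mv, List.mem_singleton] at hz
    simp [sem, State.setVar_var, hz]
  | write a i j e =>
    refine ⟨fun z _ => rfl, fun b hb => ?_, fun _ => rfl⟩
    simp only [ma, List.mem_singleton] at hb
    funext i' j'
    simp [sem, State.setArr_arr, hb]
  | flip x =>
    refine ⟨fun z hz => ?_, fun a _ => rfl, fun h => by simp [flips] at h⟩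
    simp only [mv, List.mem_singleton] at hz
    simp only [sem, State.flip]
    rw [State.setVar_var, if_neg hz]
  | seq c₁ c₂ h₁ h₂ =>
    refine Frame.trans (s' := sem ω c₁ s) ((h₁ s).mono ?_ ?_ ?_) ((h₂ _).mono ?_ ?_ ?_) <;>
      simp +contextual [mv, ma, flips]
  | ite e c₁ c₂ h₁ h₂ =>
    simp only [sem]
    split
    · refine (h₁ s).mono ?_ ?_ ?_ <;> simp +contextual [mv, ma, flips]
    · refine (h₂ s).mono ?_ ?_ ?_ <;> simp +contextual [mv, ma, flips]
  | loop x y c h =>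
    have key : ∀ (v : ℕ) (s : State), Frame (loop x y c) s (s.setVar x v) := fun v s =>
      ⟨fun z hz => by
        simp only [mv, List.mem_cons, not_or] at hz
        rw [State.setVar_var, if_neg hz.1], fun _ _ => rfl, fun _ => rfl⟩
    simp only [sem]
    generalize min (s.var y) (s.var 2) = B
    have : ∀ B s', Frame (loop x y c) s s' → Frame (loop x y c) s
      ((fun s => (sem ω c s).setVar x ((sem ω c s).var x + 1))^[B] s') := by
      intro B
      induction B with
      | zero => exact fun s' h' => h'
      | succ B ih =>
        intro s' h'
        rw [Function.iterate_succ_apply]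
        refine ih _ ((h'.trans ?_).trans (key _ _))
        exact (h s').mono (by simp +contextual [mv]) (by simp [ma]) (by simp [flips])
    exact this B _ (key 0 s)

/-- Invariant rule for loops; everything the loop cannot modify is available in the step. -/
theorem loop_inv {ω : ℕ → Bool} {x y : ℕ} {c : FP} (hx : x ∉ c.mv) (I : ℕ → State → Prop)
    (s : State) (h0 : I 0 (s.setVar x 0))
    (hstep : ∀ i, i < min (s.var y) (s.var 2) → ∀ s₁, I i s₁ → Frame (loop x y c) s s₁ →
      s₁.var x = i → I (i + 1) ((sem ω c s₁).setVar x (i + 1))) :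
    I (min (s.var y) (s.var 2)) (sem ω (loop x y c) s) := by
  simp only [sem]
  have key : ∀ (v : ℕ) (s : State), Frame (loop x y c) s (s.setVar x v) := fun v s =>
    ⟨fun z hz => by
      simp only [mv, List.mem_cons, not_or] at hz
      rw [State.setVar_var, if_neg hz.1], fun _ _ => rfl, fun _ => rfl⟩
  have : ∀ i, i ≤ min (s.var y) (s.var 2) →
      I i ((fun s => (sem ω c s).setVar x ((sem ω c s).var x + 1))^[i] (s.setVar x 0)) ∧
      Frame (loop x y c) s
        ((fun s => (sem ω c s).setVar x ((sem ω c s).var x + 1))^[i] (s.setVar x 0)) ∧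
      ((fun s => (sem ω c s).setVar x ((sem ω c s).var x + 1))^[i] (s.setVar x 0)).var x = i := by
    intro i
    induction i with
    | zero => exact fun _ => ⟨h0, key 0 s, by simp [State.setVar_var]⟩
    | succ i ih =>
      intro hi
      obtain ⟨h1, h2, h3⟩ := ih (by omega)
      rw [Function.iterate_succ_apply']
      have hfr := frame_sem ω c
        ((fun s => (sem ω c s).setVar x ((sem ω c s).var x + 1))^[i] (s.setVar x 0))
      have hxv := (hfr.var x hx).trans h3
      refine ⟨?_, (h2.trans ?_).trans (key _ _), ?_⟩
      · have := hstep i (by omega) _ h1 h2 h3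
        simpa only [hxv] using this
      · exact hfr.mono (by simp +contextual [mv]) (by simp [ma]) (by simp [flips])
      · simp [State.setVar_var, hxv]
  exact (this _ le_rfl).1

/-- Compiled programs halt, compute `sem`, and take polynomial time in the loop cap. -/
theorem exec_compile (c : FP) (hc : c.wf = true) : ∃ q : Polynomial ℕ, ∀ (ω : ℕ → Bool) (N : ℕ)
    (s : State), s.var 2 ≤ N → (∀ s', Frame c s s' → s'.var 2 ≤ N) →
    ∃ t, Exec ω c.compile s t (sem ω c s) ∧ t ≤ q.eval N := by
  induction c with
  | skip => exact ⟨1, fun ω N s _ _ => ⟨1, Exec.skip s, by simp⟩⟩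
  | assign x e => exact ⟨Polynomial.C (e.cost + 1), fun ω N s _ _ => ⟨_, Exec.assign s x e, by simp⟩⟩
  | write a i j e =>
    exact ⟨Polynomial.C (i.cost + j.cost + e.cost + 1),
      fun ω N s _ _ => ⟨_, Exec.write s a i j e, by simp⟩⟩
  | flip x => exact ⟨1, fun ω N s _ _ => ⟨1, Exec.flip s x, by simp⟩⟩
  | seq c₁ c₂ h₁ h₂ =>
    simp only [wf, Bool.and_eq_true] at hc
    obtain ⟨q₁, h₁⟩ := h₁ hc.1
    obtain ⟨q₂, h₂⟩ := h₂ hc.2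
    refine ⟨q₁ + q₂, fun ω N s hs hfr => ?_⟩
    have m1 : ∀ s s', Frame c₁ s s' → Frame (c₁ ;; c₂) s s' := fun s s' h => by
      refine h.mono ?_ ?_ ?_ <;> simp +contextual [mv, ma, flips]
    have m2 : ∀ s s', Frame c₂ s s' → Frame (c₁ ;; c₂) s s' := fun s s' h => by
      refine h.mono ?_ ?_ ?_ <;> simp +contextual [mv, ma, flips]
    obtain ⟨t₁, e₁, l₁⟩ := h₁ ω N s hs fun s' h => hfr s' (m1 _ _ h)
    have f1 := m1 _ _ (frame_sem ω c₁ s)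
    obtain ⟨t₂, e₂, l₂⟩ := h₂ ω N (sem ω c₁ s) (hfr _ f1) fun s' h => hfr s' (f1.trans (m2 _ _ h))
    exact ⟨t₁ + t₂, e₁.seq e₂, by simpa using add_le_add l₁ l₂⟩
  | ite e c₁ c₂ h₁ h₂ =>
    simp only [wf, Bool.and_eq_true] at hc
    obtain ⟨q₁, h₁⟩ := h₁ hc.1
    obtain ⟨q₂, h₂⟩ := h₂ hc.2
    refine ⟨Polynomial.C (e.cost + 1) + q₁ + q₂, fun ω N s hs hfr => ?_⟩
    have m1 : ∀ s s', Frame c₁ s s' → Frame (ite e c₁ c₂) s s' := fun s s' h => by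
      refine h.mono ?_ ?_ ?_ <;> simp +contextual [mv, ma, flips]
    have m2 : ∀ s s', Frame c₂ s s' → Frame (ite e c₁ c₂) s s' := fun s s' h => by
      refine h.mono ?_ ?_ ?_ <;> simp +contextual [mv, ma, flips]
    by_cases he : e.eval s = 0
    · obtain ⟨t₂, e₂, l₂⟩ := h₂ ω N s hs fun s' h => hfr s' (m2 _ _ h)
      refine ⟨e.cost + 1 + t₂, ?_, ?_⟩
      · simp only [sem, he, ne_eq, not_true_eq_false, if_false]
        exact Exec.ite_false he e₂
      · simp only [Polynomial.eval_add, Polynomial.eval_C]; omega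
    · obtain ⟨t₁, e₁, l₁⟩ := h₁ ω N s hs fun s' h => hfr s' (m1 _ _ h)
      refine ⟨e.cost + 1 + t₁, ?_, ?_⟩
      · simp only [sem, he, ne_eq, not_false_eq_true, if_true]
        exact Exec.ite_true he e₁
      · simp only [Polynomial.eval_add, Polynomial.eval_C]; omega
  | loop x y c h =>
    simp only [wf, Bool.and_eq_true, decide_eq_true_eq] at hc
    obtain ⟨⟨⟨⟨⟨hc, hxy⟩, hx2⟩, hx⟩, hy⟩, h2⟩ := hc
    obtain ⟨q, h⟩ := h hc
    -- One round costs 8 for evaluating and testing the condition and 4 for incrementing the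
    -- counter, besides the body. The final failing test costs 8 and the initial assignment 2.
    refine ⟨Polynomial.X * (q + Polynomial.C 12) + Polynomial.C 10, fun ω N s hs hfr => ?_⟩
    set B := min (s.var y) (s.var 2) with hB
    set step := fun s => (sem ω c s).setVar x ((sem ω c s).var x + 1) with hstep
    set e : Expr := .sub (.sub (.var y) (.sub (.var y) (.var 2))) (.var x) with he
    have hcost : e.cost = 7 := rfl
    -- In truncated arithmetic a - (a - b) is min a b, so the condition counts the remaining rounds
    -- of the capped loop.
    have heval : ∀ s : State, e.eval s = min (s.var y) (s.var 2) - s.var x := fun s => by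
      simp only [he, Expr.eval]; omega
    have main : ∀ m (s : State), s.var 2 ≤ N → min (s.var y) (s.var 2) - s.var x = m →
        ∃ t, Exec ω (.while e (.seq (compile c) (.assign x (.add (.var x) (.const 1))))) s t
          (step^[m] s) ∧ t ≤ m * (q.eval N + 12) + 8 := by
      intro m
      induction m with
      | zero =>
        intro s hs hm
        exact ⟨_, Exec.while_false ((heval s).trans hm), by rw [hcost]; omega⟩
      | succ m ih =>
        intro s hs hm
        have f1 := frame_sem ω c s
        have hs2 : ∀ s', Frame c s s' → s'.var 2 ≤ N := fun s' h' => by rw [h'.var 2 h2]; exact hs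
        obtain ⟨t₁, e₁, l₁⟩ := h ω N s hs hs2
        have v2 : (step s).var 2 = s.var 2 := by
          simp only [hstep, State.setVar_var, if_neg hx2.symm, f1.var 2 h2]
        have vy : (step s).var y = s.var y := by
          simp only [hstep, State.setVar_var, if_neg hxy.symm, f1.var y hy]
        have vx : (step s).var x = s.var x + 1 := by
          simp only [hstep, State.setVar_var, if_true, f1.var x hx]
        obtain ⟨t₂, e₂, l₂⟩ := ih (step s) (by rw [v2]; exact hs) (by rw [v2, vy, vx]; omega)
        refine ⟨_, Exec.while_true ?_ (e₁.seq (Exec.assign _ _ _)) e₂, ?_⟩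
        · rw [heval, hm]; omega
        · simp only [Expr.cost, hcost]
          nlinarith
    obtain ⟨t, ht, hl⟩ := main B (s.setVar x 0) (by
      rw [State.setVar_var, if_neg hx2.symm]; exact hs) (by
      simp [State.setVar_var, hx2.symm, hxy.symm, hB])
    refine ⟨_, Exec.seq (Exec.assign s x (.const 0)) ht, ?_⟩
    have hBN : B ≤ N := le_trans (min_le_right _ _) hs
    have := Nat.mul_le_mul_right (q.eval N + 12) hBN
    simp only [Expr.cost, Polynomial.eval_add, Polynomial.eval_mul, Polynomial.eval_X,
      Polynomial.eval_C]
    omega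

end FP
end ConnCert

namespace ConnCert

/-! ### Reachability and edge deletion -/

section Reach

variable {V : Type*}

/-- Reachability in a relation. -/
abbrev Reach (E : V → V → Prop) : V → V → Prop := Relation.ReflTransGen E

/-- Mutual reachability. -/
def SC (E : V → V → Prop) (x y : V) : Prop := Reach E x y ∧ Reach E y x

/-- Deletion of a finite set of edges. -/
def del (E : V → V → Prop) (F : Finset (V × V)) (u w : V) : Prop := E u w ∧ (u, w) ∉ F

/-- Keep only the edges into `v` whose tail is in `K`. -/
def restr (E : V → V → Prop) (v : V) (K : Finset V) (u w : V) : Prop := E u w ∧ (w = v → u ∈ K)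

theorem Reach.mono {E E' : V → V → Prop} (h : ∀ u w, E u w → E' u w) {x y : V}
    (hr : Reach E x y) : Reach E' x y := Relation.ReflTransGen.mono h _ _ hr

theorem SC.symm {E : V → V → Prop} {x y : V} (h : SC E x y) : SC E y x := ⟨h.2, h.1⟩

theorem SC.trans {E : V → V → Prop} {x y z : V} (h : SC E x y) (h' : SC E y z) : SC E x z :=
  ⟨Relation.ReflTransGen.trans h.1 h'.1, Relation.ReflTransGen.trans h'.2 h.2⟩

theorem SC.refl (E : V → V → Prop) (x : V) : SC E x x :=
  ⟨Relation.ReflTransGen.refl, Relation.ReflTransGen.refl⟩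

theorem SC.mono {E E' : V → V → Prop} (h : ∀ u w, E u w → E' u w) {x y : V}
    (hr : SC E x y) : SC E' x y := ⟨Reach.mono h hr.1, Reach.mono h hr.2⟩

theorem reach_flip {E : V → V → Prop} {x y : V} : Reach (flip E) x y ↔ Reach E y x :=
  Relation.reflTransGen_swap

/-- A walk leaving a set crosses its boundary. -/
theorem Reach.exists_crossing {E : V → V → Prop} {x y : V} (h : Reach E x y) (p : V → Prop)
    (hx : p x) (hy : ¬ p y) : ∃ a b, Reach E x a ∧ p a ∧ E a b ∧ ¬ p b := by
  induction h with
  | refl => exact absurd hx hy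
  | @tail b c hab hbc ih =>
    by_cases hb : p b
    · exact ⟨b, c, hab, hb, hbc, hy⟩
    · exact ih hb

theorem Reach.closed {E : V → V → Prop} {x y : V} (h : Reach E x y) (p : V → Prop)
    (hx : p x) (hp : ∀ a b, p a → E a b → p b) : p y := by
  by_contra hy
  obtain ⟨a, b, -, ha, hab, hb⟩ := h.exists_crossing p hx hy
  exact hb (hp a b ha hab)

theorem del_mono {E E' : V → V → Prop} (h : ∀ u w, E u w → E' u w) (F : Finset (V × V)) :
    ∀ u w, del E F u w → del E' F u w := fun u w hu => ⟨h u w hu.1, hu.2⟩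

/-- Only edges into `v` are lost, so a walk is repaired by replacing its part up to a visit of `v`.
Thinning the in-edges of `v` therefore needs to be checked for the target `v` alone, and the
vertices can be treated one after the other. -/
theorem restr_reach {E : V → V → Prop} {v r : V} {K : Finset V} {F : Finset (V × V)}
    (h : Reach (del E F) r v → Reach (del (restr E v K) F) r v) {w : V}
    (hw : Reach (del E F) r w) : Reach (del (restr E v K) F) r w := by
  induction hw with
  | refl => exact Relation.ReflTransGen.refl
  | @tail b c hab hbc ih =>
    by_cases hc : c = v
    · subst hc; exact h (hab.tail hbc)
    · exact ih.tail ⟨⟨hbc.1, fun h => absurd h hc⟩, hbc.2⟩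

end Reach

/-! ### Cuts -/

set_option linter.unusedSectionVars false

section Cuts

variable {V : Type*} [Fintype V] [DecidableEq V]

/-- The capacity of the edges leaving `D`. -/
def cut (c : V → V → ℕ) (D : Finset V) : ℕ := ∑ u, ∑ w, if u ∈ D ∧ w ∉ D then c u w else 0

theorem cut_mono {c c' : V → V → ℕ} {D : Finset V} (h : ∀ u w, u ∈ D → w ∉ D → c u w ≤ c' u w) :
    cut c D ≤ cut c' D := by
  refine Finset.sum_le_sum fun u _ => Finset.sum_le_sum fun w _ => ?_
  split_ifs with hh
  · exact h u w hh.1 hh.2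
  · exact le_rfl

theorem cut_congr {c c' : V → V → ℕ} {D : Finset V} (h : ∀ u w, u ∈ D → w ∉ D → c u w = c' u w) :
    cut c D = cut c' D :=
  le_antisymm (cut_mono fun u w hu hw => (h u w hu hw).le)
    (cut_mono fun u w hu hw => (h u w hu hw).ge)

theorem cut_lt {c c' : V → V → ℕ} {D : Finset V} (h : ∀ u w, u ∈ D → w ∉ D → c u w ≤ c' u w)
    {a b : V} (ha : a ∈ D) (hb : b ∉ D) (hab : c a b < c' a b) : cut c D < cut c' D := by
  have hle : ∀ u w, (if u ∈ D ∧ w ∉ D then c u w else 0) ≤ if u ∈ D ∧ w ∉ D then c' u w else 0 := by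
    intro u w
    split_ifs with hh
    · exact h u w hh.1 hh.2
    · exact le_rfl
  refine Finset.sum_lt_sum (fun u _ => Finset.sum_le_sum fun w _ => hle u w)
    ⟨a, Finset.mem_univ _, Finset.sum_lt_sum (fun w _ => hle a w) ⟨b, Finset.mem_univ _, ?_⟩⟩
  simpa [ha, hb] using hab

theorem cut_pos {c : V → V → ℕ} {D : Finset V} {a b : V} (ha : a ∈ D) (hb : b ∉ D)
    (hab : 0 < c a b) : 0 < cut c D :=
  lt_of_le_of_lt (Nat.zero_le _) (cut_lt (c := fun _ _ => 0) (fun _ _ _ _ => Nat.zero_le _) ha hb hab)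

theorem cut_submod (c : V → V → ℕ) (D A : Finset V) :
    cut c (D ∩ A) + cut c (D ∪ A) ≤ cut c D + cut c A := by
  simp only [cut, ← Finset.sum_add_distrib]
  refine Finset.sum_le_sum fun u _ => Finset.sum_le_sum fun w _ => ?_
  by_cases h1 : u ∈ D <;> by_cases h2 : u ∈ A <;> by_cases h3 : w ∈ D <;> by_cases h4 : w ∈ A <;>
    simp [h1, h2, h3, h4]

/-! ### Iterated largest minimum cuts with doubled capacities -/

/-- Capacities after deleting the edges into `v` whose tail is not in `K`. -/
def keep (c : V → V → ℕ) (v : V) (K : Finset V) (u w : V) : ℕ :=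
  if w = v ∧ u ∉ K then 0 else c u w

theorem keep_le (c : V → V → ℕ) (v : V) (K : Finset V) (u w : V) : keep c v K u w ≤ c u w := by
  unfold keep; split_ifs <;> simp

/-- `A'` is the largest minimum cut separating `A` from `v`. -/
structure IsMaxMinCut (c : V → V → ℕ) (v : V) (A A' : Finset V) : Prop where
  sub : A ⊆ A'
  notMem : v ∉ A'
  le : ∀ D, A ⊆ D → v ∉ D → cut c A' ≤ cut c D
  max : ∀ D, A ⊆ D → v ∉ D → cut c D ≤ cut c A' → D ⊆ A'

/-- By submodularity the union of two minimum cuts is again a minimum cut, so one of maximal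
cardinality contains all the others. -/
theorem exists_isMaxMinCut (c : V → V → ℕ) (v : V) (A : Finset V) (hv : v ∉ A) :
    ∃ A', IsMaxMinCut c v A A' := by
  classical
  obtain ⟨D₀, hD₀, hmin⟩ := Finset.exists_min_image
    (Finset.univ.filter fun D : Finset V => A ⊆ D ∧ v ∉ D) (cut c) ⟨A, by simp [hv]⟩
  simp only [Finset.mem_filter, Finset.mem_univ, true_and, and_imp] at hD₀ hmin
  obtain ⟨D₁, hD₁, hmax⟩ := Finset.exists_max_image
    (Finset.univ.filter fun D : Finset V => A ⊆ D ∧ v ∉ D ∧ cut c D ≤ cut c D₀) Finset.card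
    ⟨D₀, by simp [hD₀]⟩
  simp only [Finset.mem_filter, Finset.mem_univ, true_and, and_imp] at hD₁ hmax
  refine ⟨D₁, hD₁.1, hD₁.2.1, fun D h1 h2 => hD₁.2.2.trans (hmin D h1 h2), fun D h1 h2 h3 => ?_⟩
  have hs := cut_submod c D D₁
  have h4 := hmin (D ∩ D₁) (Finset.subset_inter h1 hD₁.1) (by simp [h2])
  have h5 := hmax (D ∪ D₁) (h1.trans Finset.subset_union_left) (by simp [h2, hD₁.2.1])
    (by have := hD₁.2.2; omega)
  have h6 := Finset.eq_of_subset_of_card_le (Finset.subset_union_right (s₁ := D) (s₂ := D₁)) h5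
  rw [h6]; exact Finset.subset_union_left

/-- Double the capacities of the edges leaving `A`. -/
def dbl (c : V → V → ℕ) (A : Finset V) (u w : V) : ℕ :=
  if u ∈ A ∧ w ∉ A then c u w + c u w else c u w

/-- `K` arises from `j` rounds of contracting the largest minimum cut and doubling its edges,
followed by a maximum flow. -/
inductive Chain (v : V) : ℕ → Finset V → (V → V → ℕ) → Finset V → Prop
  | base {A : Finset V} {c : V → V → ℕ} {K D₀ : Finset V} (hA : A ⊆ D₀) (hv : v ∉ D₀)
      (hK : K.card ≤ cut c D₀)
      (hD : ∀ D, A ⊆ D → v ∉ D → cut c D₀ ≤ cut (keep c v K) D) : Chain v 0 A c K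
  | step {j : ℕ} {A A' : Finset V} {c : V → V → ℕ} {K : Finset V} (hA : IsMaxMinCut c v A A')
      (h : Chain v j A' (dbl c A') K) : Chain v (j + 1) A c K

theorem dbl_pos {c : V → V → ℕ} {A : Finset V} {u w : V} : 0 < dbl c A u w ↔ 0 < c u w := by
  unfold dbl; split_ifs <;> omega

theorem cut_dbl (c : V → V → ℕ) (A : Finset V) : cut (dbl c A) A = 2 * cut c A := by
  simp only [cut, Finset.mul_sum]
  refine Finset.sum_congr rfl fun u _ => Finset.sum_congr rfl fun w _ => ?_
  by_cases h : u ∈ A ∧ w ∉ A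
  · simp [dbl, h]; omega
  · simp [h]

/-- At the end `K` is no larger than the minimum cut. One round at most doubles this value, since
the new source set is itself a minimum cut and its outgoing capacity becomes twice what it was. -/
theorem Chain.card_le {v : V} {j : ℕ} {A : Finset V} {c : V → V → ℕ} {K : Finset V}
    (h : Chain v j A c K) : ∀ D, A ⊆ D → v ∉ D → K.card ≤ 2 ^ j * cut c D := by
  induction h with
  | @base A c K D₀ hA hv hK hD =>
    intro D h1 h2
    have := hD D h1 h2
    have h3 : cut (keep c v K) D ≤ cut c D := cut_mono fun u w _ _ => keep_le c v K u w
    simp; omega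
  | @step j A A' c K hA h ih =>
    intro D h1 h2
    have h3 := ih A' subset_rfl hA.notMem
    have h4 := cut_dbl c A'
    have h5 := Nat.mul_le_mul_left (2 ^ (j + 1)) (hA.le D h1 h2)
    rw [h4] at h3
    rw [pow_succ] at h5 ⊢
    nlinarith

/-- An edge from the source set to `v` leaves every separating set, in particular the minimum cut
`D₀` at the end. Dropping it would lower that cut, which `Chain.base` forbids. -/
theorem Chain.mem {v : V} {j : ℕ} {A : Finset V} {c : V → V → ℕ} {K : Finset V}
    (h : Chain v j A c K) : ∀ u ∈ A, 0 < c u v → u ∈ K := by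
  induction h with
  | @base A c K D₀ hA hv hK hD =>
    intro u hu hc
    by_contra hK'
    have h1 := hD D₀ hA hv
    have h2 : cut (keep c v K) D₀ < cut c D₀ :=
      cut_lt (fun u w _ _ => keep_le c v K u w) (hA hu) hv (by simpa [keep, hK'] using hc)
    omega
  | @step j A A' c K hA h ih =>
    intro u hu hc
    exact ih u (hA.sub hu) (dbl_pos.2 hc)

/-- `(A', c')` is dominated by `(A, c)`. -/
structure Dom (A' : Finset V) (c' : V → V → ℕ) (A : Finset V) (c : V → V → ℕ) : Prop where
  sub : A' ⊆ A
  pos : ∀ u w, 0 < c' u w ↔ 0 < c u w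
  eq : ∀ u w, u ∉ A → c' u w = c u w
  le : ∀ u w, w ∉ A → c' u w ≤ c u w

/-- Enlarging `D₀` to `D ∪ D₀` raises the cut for `c'` by at least as much as for `c`. The edges
gained start outside `A`, where the capacities agree; the edges lost end outside `A`, where `c'` is
at most `c`. -/
theorem Dom.cut_le {A' A : Finset V} {c' c : V → V → ℕ} (h : Dom A' c' A c) (v : V)
    (K D D₀ : Finset V) (hD₀ : A ⊆ D₀) :
    cut (keep c' v K) D₀ + cut (keep c v K) (D ∪ D₀) ≤
      cut (keep c' v K) (D ∪ D₀) + cut (keep c v K) D₀ := by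
  simp only [cut, ← Finset.sum_add_distrib]
  refine Finset.sum_le_sum fun u _ => Finset.sum_le_sum fun w _ => ?_
  have e1 : u ∉ D₀ → keep c' v K u w = keep c v K u w := fun hu => by
    unfold keep; rw [h.eq u w fun h' => hu (hD₀ h')]
  have e2 : w ∉ D₀ → keep c' v K u w ≤ keep c v K u w := fun hw => by
    have := h.le u w fun h' => hw (hD₀ h')
    unfold keep; split_ifs <;> omega
  by_cases h1 : u ∈ D <;> by_cases h2 : u ∈ D₀ <;> by_cases h3 : w ∈ D <;> by_cases h4 : w ∈ D₀ <;>
    simp [h1, h2, h3, h4] <;> first | exact e2 h4 | exact (e1 h2).ge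

/-- Every set containing `A` but not `u` is left by an edge inside `D`. -/
def Conn (c : V → V → ℕ) (A : Finset V) (u : V) (D : Finset V) : Prop :=
  ∀ Y : Finset V, A ⊆ Y → u ∉ Y → ∃ a ∈ Y, a ∈ D ∧ ∃ w ∈ D, w ∉ Y ∧ 0 < c a w

theorem cut_keep_eq {c : V → V → ℕ} {v : V} {K D : Finset V}
    (h : ∀ u ∈ D, 0 < c u v → u ∈ K) : cut (keep c v K) D = cut c D := by
  refine cut_congr fun u w hu _ => ?_
  unfold keep
  split_ifs with hh
  · by_contra h0
    exact hh.2 (h u hu (by rw [← hh.1]; omega))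
  · rfl

/-- This is the heart of the fault tolerance: if an edge from `u` in `D` to `v` was dropped, the
kept capacity leaving `D` exceeds the minimum cut by the number of rounds. The capacities `c'` need
not be the ones that the chain doubles: domination leaves room for an induction that raises `c'` on
a single edge per round, inside `D`, where the raise does not count in the cut. -/
theorem Chain.le_cut {v : V} {j : ℕ} {A : Finset V} {c : V → V → ℕ} {K : Finset V}
    (h : Chain v j A c K) : ∀ (A' : Finset V) (c' : V → V → ℕ), Dom A' c' A c → v ∉ A' →
      ∀ (D : Finset V) (u : V), A' ⊆ D → v ∉ D → u ∈ D → u ∉ K → 0 < c u v → Conn c A' u D →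
      ∀ m, (∀ D', A' ⊆ D' → v ∉ D' → m ≤ cut c' D') → m + j ≤ cut (keep c' v K) D := by
  induction h with
  | @base A c K D₀ hA hv hK hD =>
    intro A' c' hdom _ D u hAD hvD _ _ _ _ m hm
    have hmem := (Chain.base hA hv hK hD).mem
    have hmem' : ∀ u ∈ D₀, 0 < c u v → u ∈ K := by
      have := (Chain.base (A := D₀) subset_rfl hv hK fun D h1 h2 => hD D (hA.trans h1) h2).mem
      exact this
    have h1 := cut_submod (keep c' v K) D D₀
    have h2 := hdom.cut_le v K D D₀ hA
    have h3 := hD (D ∪ D₀) (hA.trans Finset.subset_union_right) (by simp [hvD, hv])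
    have h4 : cut (keep c v K) D₀ ≤ cut c D₀ := cut_mono fun u w _ _ => keep_le c v K u w
    have h5 : cut (keep c' v K) (D ∩ D₀) = cut c' (D ∩ D₀) := cut_keep_eq fun u hu hc =>
      hmem' u (Finset.mem_inter.1 hu).2 ((hdom.pos u v).1 hc)
    have h6 := hm (D ∩ D₀) (Finset.subset_inter hAD (hdom.sub.trans hA)) (by simp [hv])
    omega
  | @step j A As c K hAs h ih =>
    intro A' c' hdom hvA' D u hAD hvD huD huK huc hconn m hm
    obtain ⟨B, hB⟩ := exists_isMaxMinCut c' v A' hvA'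
    -- Domination turns `As` into a minimum cut relative to `B ∪ As` also for `c`, and `As` contains
    -- every minimum cut of `c` around `A`.
    have hBA : B ⊆ As := by
      have h1 := cut_submod c' B As
      have h2 := hB.le (B ∩ As) (Finset.subset_inter hB.sub (hdom.sub.trans hAs.sub))
        (by simp [hB.notMem])
      have h3 := hdom.cut_le v Finset.univ B As hAs.sub
      simp only [cut_keep_eq (K := Finset.univ) (v := v) fun _ _ _ => Finset.mem_univ _] at h3
      exact Finset.subset_union_left.trans (hAs.max (B ∪ As)
        (hAs.sub.trans Finset.subset_union_right) (by simp [hB.notMem, hAs.notMem]) (by omega))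
    have hKmem : ∀ x ∈ As, 0 < c x v → x ∈ K := fun x hx hc => h.mem x hx (dbl_pos.2 hc)
    have huB : u ∉ B := fun hu => huK (hKmem u (hBA hu) huc)
    obtain ⟨a, haB, haD, w, hwD, hwB, haw⟩ := hconn B hB.sub huB
    -- The connectivity of `D` provides an edge from `a` to `w` that leaves `B` but stays in `D`.
    -- One unit is added to it; doubling the capacities out of `As` makes up for this unit, so
    -- domination persists.
    set c'' : V → V → ℕ := fun x y => if x = a ∧ y = w then c' x y + 1 else c' x y with hc''
    have hle'' : ∀ x y, c' x y ≤ c'' x y := fun x y => by simp only [hc'']; split_ifs <;> omega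
    have hdom' : Dom B c'' As (dbl c As) := by
      refine ⟨hBA, fun x y => ?_, fun x y hx => ?_, fun x y hy => ?_⟩
      · rw [dbl_pos, ← hdom.pos]
        simp only [hc'']
        split_ifs with hxy
        · rw [hxy.1, hxy.2, hdom.pos]; simp [haw]
        · rfl
      · have hxa : x ≠ a := fun h => hx (h ▸ hBA haB)
        simp only [hc'', hxa, false_and, if_false, dbl, hx]
        exact hdom.eq x y fun h => hx (hAs.sub h)
      · have h1 := hdom.le x y fun h => hy (hAs.sub h)
        simp only [hc'', dbl, hy, not_false_eq_true, and_true]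
        by_cases hxy : x = a ∧ y = w
        · have : x ∈ As := hxy.1 ▸ hBA haB
          have h2 : 0 < c x y := by rw [hxy.1, hxy.2]; exact haw
          simp only [hxy, and_self, if_true, hxy.1 ▸ this]
          rw [hxy.1, hxy.2] at h1 h2
          omega
        · simp only [hxy, if_false]
          split_ifs <;> omega
    have hconn' : Conn (dbl c As) B u (D ∪ B) := by
      intro Y hY huY
      obtain ⟨a, haY, haD, w, hwD, hwY, haw⟩ := hconn Y (hB.sub.trans hY) huY
      exact ⟨a, haY, Finset.mem_union_left _ haD, w, Finset.mem_union_left _ hwD, hwY,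
        dbl_pos.2 haw⟩
    -- With the raised edge every cut around `B` exceeds the old minimum: `B` is the only minimum
    -- cut of `c'` that contains `B`, and the raised edge leaves it.
    have hstep := ih B c'' hdom' hB.notMem (D ∪ B) u Finset.subset_union_right
      (by simp [hvD, hB.notMem]) (Finset.mem_union_left _ huD) huK (dbl_pos.2 huc) hconn'
      (cut c' B + 1) (by
        intro D' hD' hvD'
        have h1 := hB.le D' (hB.sub.trans hD') hvD'
        rcases h1.lt_or_eq with h1 | h1
        · exact le_trans h1 (cut_mono fun x y _ _ => hle'' x y)
        · have h2 := hB.max D' (hB.sub.trans hD') hvD' h1.ge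
          have h3 : D' = B := Finset.Subset.antisymm h2 hD'
          rw [h3]
          exact cut_lt (fun x y _ _ => hle'' x y) haB hwB (by simp [hc'']))
    -- The head `w` of the raised edge lies in `D`, so the gained unit is invisible here.
    -- Submodularity for `D` and `B` then passes the bound from `D ∪ B` to `D`, with the edges into
    -- `v` from `B` all being kept.
    have h1 : cut (keep c'' v K) (D ∪ B) = cut (keep c' v K) (D ∪ B) := by
      refine cut_congr fun x y _ hy => ?_
      have : y ≠ w := fun h => hy (h ▸ Finset.mem_union_left _ hwD)
      simp [keep, hc'', this]
    have h2 := cut_submod (keep c' v K) D B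
    have h3 : cut (keep c' v K) (D ∩ B) = cut c' (D ∩ B) := cut_keep_eq fun x hx hc =>
      hKmem x (hBA (Finset.mem_inter.1 hx).2) ((hdom.pos x v).1 hc)
    have h4 := hB.le (D ∩ B) (Finset.subset_inter hAD hB.sub) (by simp [hvD])
    have h5 : cut (keep c' v K) B ≤ cut c' B := cut_mono fun u w _ _ => keep_le c' v K u w
    have h6 := hm B hB.sub hB.notMem
    omega

open Classical in
/-- The in-edges of `v` selected by a chain preserve reachability of `v` from `r` under faults. -/
theorem Chain.reach {v r₀ r : V} {f : ℕ} {c : V → V → ℕ} {K : Finset V} {E : V → V → Prop}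
    (hv : v ≠ r₀) (hc : ∀ u w, c u w = if E u w ∨ (u = r₀ ∧ w = r) then 1 else 0)
    (h0 : ∀ w, ¬ E r₀ w) (h : Chain v f {r₀} c K) (F : Finset (V × V)) (hF : F.card ≤ f)
    (hr : Reach (del E F) r v) : Reach (del (restr E v K) F) r v := by
  by_contra hcon
  -- `D` is what survives: the auxiliary source and everything still reached from `r`. A surviving
  -- walk of the full graph leaves it, and it can only do so through a dropped edge into `v`.
  set D : Finset V := Finset.univ.filter fun x => x = r₀ ∨ Reach (del (restr E v K) F) r x with hD
  have memD : ∀ x, x ∈ D ↔ x = r₀ ∨ Reach (del (restr E v K) F) r x := by simp [hD]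
  have hrD : r ∈ D := (memD r).2 (Or.inr Relation.ReflTransGen.refl)
  have hvD : v ∉ D := by rw [memD]; tauto
  obtain ⟨x, y, hrx, hxD, hxy, hyD⟩ := hr.exists_crossing (· ∈ D) hrD hvD
  have hx0 : x ≠ r₀ := fun h => h0 y (h ▸ hxy.1)
  have hrx' : Reach (del (restr E v K) F) r x := ((memD x).1 hxD).resolve_left hx0
  have hyv : y = v := by
    by_contra hyv
    exact hyD ((memD y).2 (Or.inr (hrx'.tail ⟨⟨hxy.1, fun h => absurd h hyv⟩, hxy.2⟩)))
  subst hyv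
  have hxK : x ∉ K := fun hxK =>
    hyD ((memD y).2 (Or.inr (hrx'.tail ⟨⟨hxy.1, fun _ => hxK⟩, hxy.2⟩)))
  have hconn : Conn c {r₀} x D := by
    intro Y hY hxY
    have h0Y : r₀ ∈ Y := hY (Finset.mem_singleton_self _)
    by_cases hrY : r ∈ Y
    · obtain ⟨a, b, hra, haY, hab, hbY⟩ := hrx'.exists_crossing (· ∈ Y) hrY hxY
      exact ⟨a, haY, (memD a).2 (Or.inr hra), b, (memD b).2 (Or.inr (hra.tail hab)), hbY, by
        rw [hc, if_pos (Or.inl hab.1.1)]; exact one_pos⟩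
    · exact ⟨r₀, h0Y, (memD r₀).2 (Or.inl rfl), r, hrD, hrY, by simp [hc]⟩
  have h1 := h.le_cut {r₀} c ⟨subset_rfl, fun _ _ => Iff.rfl, fun _ _ _ => rfl, fun _ _ _ => le_rfl⟩
    (by simpa using hv) D x (by simp [memD]) hvD hxD hxK (by rw [hc, if_pos (Or.inl hxy.1)]; exact one_pos)
    hconn 1 (by
      intro D' h1 h2
      have h0D : r₀ ∈ D' := h1 (Finset.mem_singleton_self _)
      by_cases hrD' : r ∈ D'
      · obtain ⟨a, b, -, ha, hab, hb⟩ := hr.exists_crossing (· ∈ D') hrD' h2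
        exact cut_pos ha hb (by rw [hc, if_pos (Or.inl hab.1)]; exact one_pos)
      · exact cut_pos h0D hrD' (by simp [hc]))
  -- A kept edge that leaves `D` must be faulty, since otherwise its head would be reached, and
  -- capacities are at most 1. This contradicts the lower bound f + 1.
  have h2 : cut (keep c y K) D ≤ F.card := by
    have h3 : cut (keep c y K) D ≤ ∑ u, ∑ w, if (u, w) ∈ F then 1 else 0 := by
      refine Finset.sum_le_sum fun u _ => Finset.sum_le_sum fun w _ => ?_
      by_cases huw : u ∈ D ∧ w ∉ D
      · rw [if_pos huw]
        by_cases hF' : (u, w) ∈ F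
        · rw [if_pos hF']
          refine (keep_le _ _ _ _ _).trans ?_
          rw [hc]; split_ifs <;> omega
        · rw [if_neg hF', Nat.le_zero]
          unfold keep
          split_ifs with hk
          · rfl
          · rw [hc, if_neg]
            rintro (hE | ⟨rfl, rfl⟩)
            · have hu0 : u ≠ r₀ := fun h => h0 w (h ▸ hE)
              have := ((memD u).1 huw.1).resolve_left hu0
              refine huw.2 ((memD w).2 (Or.inr (this.tail ⟨⟨hE, fun h => ?_⟩, hF'⟩)))
              by_contra hK; exact hk ⟨h, hK⟩
            · exact huw.2 hrD
      · rw [if_neg huw]; exact Nat.zero_le _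
    have h4 : (∑ u, ∑ w, if (u, w) ∈ F then 1 else 0) = F.card := by
      rw [← Fintype.sum_prod_type' (f := fun u w => if (u, w) ∈ F then 1 else 0)]
      simp
    omega
  omega

end Cuts
end ConnCert

namespace ConnCert

/-! ### Residual capacities, maximum flows, Menger's theorem -/

set_option linter.unusedSectionVars false

section Flow

/-- The least number of steps to `z` serves. Only the strict descent along some edge is used, both
for building simple paths and for termination. -/
theorem exists_rank {V : Type*} (E : V → V → Prop) (z : V) : ∃ d : V → ℕ, ∀ u, Reach E u z → u ≠ z →
    ∃ w, E u w ∧ Reach E w z ∧ d w < d u := by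
  classical
  let st : ℕ → V → Prop := fun n => Nat.rec (fun u => u = z) (fun _ p u => ∃ w, E u w ∧ p w) n
  have hst : ∀ u, Reach E u z → ∃ n, st n u := by
    intro u hu
    induction hu using Relation.ReflTransGen.head_induction_on with
    | refl => exact ⟨0, rfl⟩
    | head hab _ ih => obtain ⟨n, hn⟩ := ih; exact ⟨n + 1, _, hab, hn⟩
  have hst' : ∀ n u, st n u → Reach E u z := by
    intro n
    induction n with
    | zero => intro u hu; rw [show u = z from hu]
    | succ n ih => rintro u ⟨w, hw, hn⟩; exact (ih w hn).head hw
  refine ⟨fun u => sInf {n | st n u}, fun u hu huz => ?_⟩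
  have h1 : st (sInf {n | st n u}) u := Nat.sInf_mem (hst u hu)
  cases h2 : sInf {n | st n u} with
  | zero => rw [h2] at h1; exact absurd h1 huz
  | succ n =>
    rw [h2] at h1
    obtain ⟨w, hw, hn⟩ := h1
    refine ⟨w, hw, hst' n w hn, ?_⟩
    change sInf {n | st n w} < sInf {n | st n u}
    rw [h2]
    exact Nat.lt_succ_of_le (Nat.sInf_le hn)

variable {V : Type*} [Fintype V] [DecidableEq V]

/-- Send one unit of flow along the edge `(x, y)` in a residual network. -/
def push (r : V → V → ℕ) (x y u w : V) : ℕ :=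
  if u = x ∧ w = y then r u w - 1 else if u = y ∧ w = x then r u w + 1 else r u w

theorem cut_add (c c' : V → V → ℕ) (D : Finset V) :
    cut (fun u w => c u w + c' u w) D = cut c D + cut c' D := by
  simp only [cut, ← Finset.sum_add_distrib]
  refine Finset.sum_congr rfl fun u _ => Finset.sum_congr rfl fun w _ => ?_
  split_ifs <;> simp

theorem cut_single (x y : V) (D : Finset V) :
    cut (fun u w => if u = x ∧ w = y then 1 else 0) D = if x ∈ D ∧ y ∉ D then 1 else 0 := by
  unfold cut
  rw [Finset.sum_eq_single x, Finset.sum_eq_single y]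
  · simp
  · intro w _ hw; simp [hw]
  · simp
  · intro u _ hu; simp [hu]
  · simp

theorem cut_push {r : V → V → ℕ} {x y : V} (hxy : x ≠ y) (hr : 0 < r x y) (D : Finset V) :
    cut (push r x y) D + (if x ∈ D then 1 else 0) = cut r D + (if y ∈ D then 1 else 0) := by
  have h : (fun u w => push r x y u w + (if u = x ∧ w = y then 1 else 0)) =
      fun u w => r u w + (if u = y ∧ w = x then 1 else 0) := by
    funext u w
    unfold push
    by_cases h1 : u = x ∧ w = y
    · have h2 : ¬ (u = y ∧ w = x) := fun h2 => hxy (h1.1.symm.trans h2.1)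
      simp only [h1, and_self, if_true]
      rw [if_neg (by rintro ⟨h, -⟩; exact hxy h)]
      omega
    · by_cases h2 : u = y ∧ w = x
      · obtain ⟨rfl, rfl⟩ := h2
        simp [hxy, hxy.symm]
      · simp only [h1, h2, if_false]
  have h' := congrArg (fun c => cut c D) h
  simp only [cut_add, cut_single] at h'
  by_cases h1 : x ∈ D <;> by_cases h2 : y ∈ D <;> simp [h1, h2] at h' ⊢ <;> omega

/-- `r'` is obtained from `r` by sending a unit of flow from `x₀` to `x`, along vertices whose
label is larger than that of `x`; nothing enters the column of `z` twice. -/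
structure PushInv (r : V → V → ℕ) (B : V → ℕ) (z x₀ : V) (r' : V → V → ℕ) (x : V) : Prop where
  cut_eq : ∀ D, cut r' D + (if x₀ ∈ D then 1 else 0) = cut r D + (if x ∈ D then 1 else 0)
  sum : ∀ u w, r' u w + r' w u = r u w + r w u
  le : ∀ u, r' u z ≤ r u z
  ge : ∀ u w, B u ≤ B x → r u w ≤ r' u w

theorem PushInv.refl (r : V → V → ℕ) (B : V → ℕ) (z x : V) : PushInv r B z x r x :=
  ⟨fun _ => rfl, fun _ _ => rfl, fun _ => le_rfl, fun _ _ _ => le_rfl⟩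

/-- Labels descend along the walk, so no earlier step has lowered a capacity in the row of `x` and
the original capacity of the edge is still available. The reverse edge gains capacity but enters
`x`, not `z`, so the column of `z` never grows. -/
theorem PushInv.step {r r' : V → V → ℕ} {B : V → ℕ} {z x₀ x y : V} (h : PushInv r B z x₀ r' x)
    (hx : x ≠ z) (hr : 0 < r x y) (hB : B y < B x) : PushInv r B z x₀ (push r' x y) y := by
  have hxy : x ≠ y := fun h => by rw [h] at hB; omega
  have hr' : 0 < r' x y := lt_of_lt_of_le hr (h.ge x y le_rfl)
  refine ⟨fun D => ?_, fun u w => ?_, fun u => ?_, fun u w hu => ?_⟩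
  · have h1 := h.cut_eq D
    have h2 := cut_push hxy hr' D
    omega
  · rw [← h.sum u w]
    unfold push
    by_cases h1 : u = x ∧ w = y
    · obtain ⟨rfl, rfl⟩ := h1
      simp [hxy, hxy.symm]; omega
    · by_cases h2 : u = y ∧ w = x
      · obtain ⟨rfl, rfl⟩ := h2
        simp [hxy, hxy.symm]; omega
      · have h3 : ¬ (w = x ∧ u = y) := fun h => h2 ⟨h.2, h.1⟩
        have h4 : ¬ (w = y ∧ u = x) := fun h => h1 ⟨h.2, h.1⟩
        simp only [h1, h2, h3, h4, if_false]
  · refine le_trans ?_ (h.le u)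
    unfold push
    split_ifs with h1 h2
    · omega
    · exact absurd h2.2.symm hx
    · exact le_rfl
  · refine (h.ge u w (by omega)).trans ?_
    unfold push
    split_ifs with h1 h2
    · rw [h1.1] at hu; omega
    · omega
    · exact le_rfl

/-- The edges with positive capacity. -/
abbrev supp (c : V → V → ℕ) (u w : V) : Prop := c u w ≠ 0

/-- `r` is a residual network of `c` for a flow of value `m` from `A` to `v`. -/
structure Resid (c : V → V → ℕ) (A : Finset V) (v : V) (r : V → V → ℕ) (m : ℕ) : Prop where
  cut_eq : ∀ D, A ⊆ D → v ∉ D → cut r D + m = cut c D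
  sum : ∀ u w, r u w + r w u = c u w + c w u
  le : ∀ u, r u v ≤ c u v

/-- No vertex of `A` reaches `v`. -/
def Blocked (r : V → V → ℕ) (A : Finset V) (v : V) : Prop := ∀ a ∈ A, ¬ Reach (supp r) a v

theorem Resid.refl (c : V → V → ℕ) (A : Finset V) (v : V) : Resid c A v c 0 :=
  ⟨fun _ _ _ => rfl, fun _ _ => rfl, fun _ => le_rfl⟩

theorem Resid.push {c r r' : V → V → ℕ} {A : Finset V} {v x₀ : V} {m : ℕ} {B : V → ℕ}
    (h : Resid c A v r m) (hx : x₀ ∈ A) (h' : PushInv r B v x₀ r' v) : Resid c A v r' (m + 1) := by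
  refine ⟨fun D h1 h2 => ?_, fun u w => (h'.sum u w).trans (h.sum u w),
    fun u => (h'.le u).trans (h.le u)⟩
  have h3 := h.cut_eq D h1 h2
  have h4 := h'.cut_eq D
  rw [if_pos (h1 hx), if_neg h2] at h4
  omega

theorem exists_push (r : V → V → ℕ) (v x₀ : V) (hx : Reach (supp r) x₀ v) :
    ∃ (B : V → ℕ) (r' : V → V → ℕ), PushInv r B v x₀ r' v := by
  obtain ⟨B, hB⟩ := exists_rank (supp r) v
  refine ⟨B, ?_⟩
  have : ∀ n x r', Reach (supp r) x v → PushInv r B v x₀ r' x → B x = n →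
      ∃ r', PushInv r B v x₀ r' v := by
    intro n
    induction n using Nat.strong_induction_on with
    | _ n ih =>
      intro x r' hxv h hn
      by_cases hx : x = v
      · subst hx; exact ⟨r', h⟩
      · obtain ⟨y, hxy, hy, hlt⟩ := hB x hxv hx
        exact ih (B y) (hn ▸ hlt) y _ hy (h.step hx (Nat.pos_of_ne_zero hxy) hlt) rfl
  exact this _ x₀ r hx (PushInv.refl r B v x₀) rfl

/-- Each augmentation lowers the residual cut around `A` by one, so the process stops. -/
theorem exists_maxFlow (c : V → V → ℕ) (A : Finset V) (v : V) (hv : v ∉ A) :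
    ∃ r m, Resid c A v r m ∧ Blocked r A v := by
  have : ∀ n r m, Resid c A v r m → cut r A ≤ n → ∃ r m, Resid c A v r m ∧ Blocked r A v := by
    intro n
    induction n with
    | zero =>
      intro r m h hn
      refine ⟨r, m, h, fun a ha har => ?_⟩
      obtain ⟨x, y, -, hx, hxy, hy⟩ := har.exists_crossing (· ∈ A) ha hv
      have := cut_pos hx hy (Nat.pos_of_ne_zero hxy)
      omega
    | succ n ih =>
      intro r m h hn
      by_cases hb : Blocked r A v
      · exact ⟨r, m, h, hb⟩
      · simp only [Blocked, not_forall, not_not] at hb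
        obtain ⟨a, ha, har⟩ := hb
        obtain ⟨B, r', hr'⟩ := exists_push r v a har
        refine ih r' (m + 1) (h.push ha hr') ?_
        have := hr'.cut_eq A
        rw [if_pos ha, if_neg hv] at this
        omega
  exact this _ c 0 (Resid.refl c A v) le_rfl

open Classical in
/-- The vertices which do not reach `v`. -/
noncomputable def nonReach (r : V → V → ℕ) (v : V) : Finset V :=
  Finset.univ.filter fun u => ¬ Reach (supp r) u v

theorem mem_nonReach {r : V → V → ℕ} {v u : V} : u ∈ nonReach r v ↔ ¬ Reach (supp r) u v := by
  simp [nonReach]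

theorem cut_nonReach (r : V → V → ℕ) (v : V) : cut r (nonReach r v) = 0 := by
  by_contra h
  have : ∃ u w, u ∈ nonReach r v ∧ w ∉ nonReach r v ∧ r u w ≠ 0 := by
    by_contra hcon
    push Not at hcon
    refine h (Finset.sum_eq_zero fun u _ => Finset.sum_eq_zero fun w _ => ?_)
    split_ifs with hh
    · exact hcon u w hh.1 hh.2
    · rfl
  obtain ⟨u, w, hu, hw, huw⟩ := this
  rw [mem_nonReach] at hu hw
  exact hu ((not_not.1 hw).head huw)

/-- Residual cuts and capacity cuts differ by the constant flow value. The vertices that do not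
reach `v` have residual cut 0, hence a minimum cut. Any other minimum cut also has residual cut 0,
so nothing in it reaches `v`. -/
theorem Resid.isMaxMinCut {c r : V → V → ℕ} {A : Finset V} {v : V} {m : ℕ}
    (h : Resid c A v r m) (hb : Blocked r A v) : IsMaxMinCut c v A (nonReach r v) := by
  have hsub : A ⊆ nonReach r v := fun a ha => mem_nonReach.2 (hb a ha)
  have hv : v ∉ nonReach r v := fun h => mem_nonReach.1 h Relation.ReflTransGen.refl
  have h0 := h.cut_eq _ hsub hv
  rw [cut_nonReach] at h0
  refine ⟨hsub, hv, fun D h1 h2 => ?_, fun D h1 h2 h3 => ?_⟩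
  · have := h.cut_eq D h1 h2; omega
  · have h4 := h.cut_eq D h1 h2
    intro u hu
    refine mem_nonReach.2 fun hr => ?_
    obtain ⟨x, y, -, hx, hxy, hy⟩ := hr.exists_crossing (· ∈ D) hu h2
    have := cut_pos hx hy (Nat.pos_of_ne_zero hxy)
    omega

theorem Resid.chain_base {c r : V → V → ℕ} {A K : Finset V} {v : V} {m : ℕ}
    (h : Resid c A v r m) (hb : Blocked r A v) (hv : v ∉ A) (hK : ∀ u, u ∈ K ↔ r u v < c u v) :
    Chain v 0 A c K := by
  have hc := h.isMaxMinCut hb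
  have h0 := h.cut_eq _ hc.sub hc.notMem
  rw [cut_nonReach, zero_add] at h0
  refine Chain.base hc.sub hc.notMem ?_ fun D h1 h2 => ?_
  · have h1 := h.cut_eq (Finset.univ.erase v) (fun a ha => by
      simp only [Finset.mem_erase, Finset.mem_univ, and_true]
      rintro rfl; exact hv ha) (by simp)
    have h2 : cut (fun u w => r u w + if w = v ∧ u ∈ K then 1 else 0) (Finset.univ.erase v) ≤
        cut c (Finset.univ.erase v) := cut_mono fun u w _ hw => by
      have hw' : w = v := by simpa using hw
      subst hw'
      by_cases hu : u ∈ K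
      · simpa [hu] using (hK u).1 hu
      · simpa [hu] using h.le u
    rw [cut_add] at h2
    have h3 : K.card ≤ cut (fun u w => if w = v ∧ u ∈ K then 1 else 0) (Finset.univ.erase v) := by
      unfold cut
      rw [Finset.card_eq_sum_ones, ← Finset.sum_filter_add_sum_filter_not Finset.univ (· ∈ K)]
      refine le_trans ?_ (Nat.le_add_right _ _)
      rw [Finset.filter_mem_eq_inter, Finset.univ_inter]
      refine Finset.sum_le_sum fun u hu => ?_
      -- A loop at `v` never changes capacity, by `Resid.sum` on the diagonal.
      have huv : u ≠ v := by
        rintro rfl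
        have h4 := (hK u).1 hu
        have h5 := h.sum u u
        omega
      refine le_trans ?_ (Finset.single_le_sum (fun _ _ => Nat.zero_le _) (Finset.mem_univ v))
      simp [huv, hu]
    omega
  · have h3 := h.cut_eq D h1 h2
    have h4 : cut c D ≤ cut (fun u w => keep c v K u w + r u w) D := cut_mono fun u w _ _ => by
      unfold keep
      split_ifs with hh
      · have := mt (hK u).2 hh.2
        rw [hh.1]; omega
      · omega
    rw [cut_add] at h4
    omega

theorem exists_chain (v : V) (j : ℕ) : ∀ (A : Finset V) (c : V → V → ℕ), v ∉ A →
    ∃ K, Chain v j A c K := by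
  induction j with
  | zero =>
    intro A c hv
    obtain ⟨r, m, h, hb⟩ := exists_maxFlow c A v hv
    exact ⟨Finset.univ.filter fun u => r u v < c u v, h.chain_base hb hv (by simp)⟩
  | succ j ih =>
    intro A c hv
    obtain ⟨r, m, h, hb⟩ := exists_maxFlow c A v hv
    obtain ⟨K, hK⟩ := ih (nonReach r v) (dbl c (nonReach r v)) (h.isMaxMinCut hb).notMem
    exact ⟨K, Chain.step (h.isMaxMinCut hb) hK⟩

/-! #### Menger's theorem -/

/-- The indicator capacities of an edge set. -/
def ind (T : Finset (V × V)) (u w : V) : ℕ := if (u, w) ∈ T then 1 else 0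

theorem cut_ind (T : Finset (V × V)) (D : Finset V) :
    cut (ind T) D = (T.filter fun e => e.1 ∈ D ∧ e.2 ∉ D).card := by
  unfold cut ind
  rw [← Fintype.sum_prod_type'
    (f := fun u w => if u ∈ D ∧ w ∉ D then if (u, w) ∈ T then 1 else 0 else 0), Finset.card_filter,
    ← Finset.sum_filter_add_sum_filter_not Finset.univ (· ∈ T)]
  rw [Finset.filter_mem_eq_inter, Finset.univ_inter]
  conv_rhs => rw [← add_zero (∑ e ∈ T, _)]
  congr 1
  · refine Finset.sum_congr rfl fun e he => ?_
    simp [he]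
  · refine Finset.sum_eq_zero fun e he => ?_
    have : e ∉ T := by simpa using he
    simp [this]

/-- The relation given by an edge set. -/
abbrev rel (T : Finset (V × V)) (u w : V) : Prop := (u, w) ∈ T

/-- The edges of a walk with descending ranks form a unit flow from `x` to `y`: each step adds one
edge, which is new because its tail has larger rank than all earlier tails. Stating conservation
through cuts avoids speaking about paths. -/
theorem exists_flowPath (S : Finset (V × V)) (x y : V) (h : Reach (rel S) x y) :
    ∃ T ⊆ S, Reach (rel T) x y ∧ ∀ D : Finset V,
      cut (ind T) D + (if y ∈ D then 1 else 0) =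
        cut (fun u w => ind T w u) D + (if x ∈ D then 1 else 0) := by
  obtain ⟨d, hd⟩ := exists_rank (rel S) y
  have : ∀ n x, Reach (rel S) x y → d x = n → ∃ T ⊆ S, (∀ e ∈ T, d e.1 ≤ n) ∧ Reach (rel T) x y ∧
      ∀ D : Finset V, cut (ind T) D + (if y ∈ D then 1 else 0) =
        cut (fun u w => ind T w u) D + (if x ∈ D then 1 else 0) := by
    intro n
    induction n using Nat.strong_induction_on with
    | _ n ih =>
      intro x hx hn
      by_cases hxy : x = y
      · subst hxy
        exact ⟨∅, by simp, by simp, Relation.ReflTransGen.refl, fun D => by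
          rw [show ind (∅ : Finset (V × V)) = fun _ _ => 0 from by funext u w; simp [ind]]⟩
      · obtain ⟨w, hw, hwy, hlt⟩ := hd x hx hxy
        obtain ⟨T, hTS, hTd, hTr, hT⟩ := ih (d w) (hn ▸ hlt) w hwy rfl
        have hnew : (x, w) ∉ T := fun h => by have := hTd _ h; simp at this; omega
        have hxw : x ≠ w := fun h => by rw [h] at hlt; omega
        refine ⟨insert (x, w) T, Finset.insert_subset hw hTS, ?_, ?_, fun D => ?_⟩
        · intro e he
          rcases Finset.mem_insert.1 he with rfl | he
          · exact hn.le
          · have := hTd e he; omega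
        · refine Relation.ReflTransGen.head (Finset.mem_insert_self _ _) ?_
          exact hTr.mono fun u v h => Finset.mem_insert_of_mem h
        · have e1 : ind (insert (x, w) T) = fun u v => ind T u v + if u = x ∧ v = w then 1 else 0 := by
            funext u v
            unfold ind
            by_cases h1 : u = x ∧ v = w
            · obtain ⟨rfl, rfl⟩ := h1; simp [hnew]
            · have : ¬ ((u, v) = (x, w)) := by simpa using h1
              simp [this, h1]
          have e2 : (fun u v => ind (insert (x, w) T) v u) =
              fun u v => ind T v u + if u = w ∧ v = x then 1 else 0 := by
            funext u v
            rw [e1]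
            simp only [and_comm]
          rw [e2, e1, cut_add, cut_add, cut_single, cut_single]
          have := hT D
          by_cases h1 : x ∈ D <;> by_cases h2 : w ∈ D <;> simp [h1, h2] at this ⊢ <;> omega
  obtain ⟨T, h1, -, h2⟩ := this _ x h rfl
  exact ⟨T, h1, h2⟩

/-- A positive excess on every separating set forces reachability: the set of vertices reached from
`x` has no outgoing edge. Removing one unit flow lowers all excesses by one. -/
theorem exists_decomposition (x y : V) (m : ℕ) : ∀ S : Finset (V × V),
    (∀ D : Finset V, x ∈ D → y ∉ D → cut (ind S) D = cut (fun u w => ind S w u) D + m) →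
    ∃ T : Fin m → Finset (V × V), (∀ i, T i ⊆ S) ∧ (∀ i, Reach (rel (T i)) x y) ∧
      ∀ i j, i ≠ j → Disjoint (T i) (T j) := by
  induction m with
  | zero => exact fun S _ => ⟨fun i => i.elim0, fun i => i.elim0, fun i => i.elim0, fun i => i.elim0⟩
  | succ m ih =>
    classical
    intro S hS
    have hr : Reach (rel S) x y := by
      by_contra hcon
      have h1 := hS (Finset.univ.filter fun u => Reach (rel S) x u)
        (by simp [Relation.ReflTransGen.refl]) (by simpa using hcon)
      have h2 : cut (ind S) (Finset.univ.filter fun u => Reach (rel S) x u) = 0 := by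
        rw [cut_ind, Finset.card_eq_zero, Finset.filter_eq_empty_iff]
        rintro ⟨u, w⟩ he ⟨h3, h4⟩
        simp only [Finset.mem_filter, Finset.mem_univ, true_and] at h3 h4
        exact h4 (h3.tail he)
      omega
    obtain ⟨T₀, hT₀, hr₀, hc₀⟩ := exists_flowPath S x y hr
    have hsplit : ind S = fun u w => ind (S \ T₀) u w + ind T₀ u w := by
      funext u w
      unfold ind
      by_cases h1 : (u, w) ∈ T₀
      · simp [h1, hT₀ h1]
      · simp [h1]
    obtain ⟨T, hT, hTr, hTd⟩ := ih (S \ T₀) (by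
      intro D hx hy
      have h1 := hS D hx hy
      have h2 := hc₀ D
      have e2 : (fun u w => ind S w u) = fun u w => ind (S \ T₀) w u + ind T₀ w u := by
        rw [hsplit]
      rw [e2, hsplit, cut_add, cut_add] at h1
      rw [if_pos hx, if_neg hy] at h2
      omega)
    refine ⟨Fin.cons T₀ T, ?_, ?_, ?_⟩
    · intro i
      refine Fin.cases ?_ (fun i => ?_) i
      · exact hT₀
      · exact (hT i).trans Finset.sdiff_subset
    · intro i
      refine Fin.cases ?_ (fun i => ?_) i
      · exact hr₀
      · exact hTr i
    · have hdis : ∀ i, Disjoint T₀ (T i) := fun i =>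
        Finset.disjoint_of_subset_right (hT i) Finset.disjoint_sdiff
      intro i j
      refine Fin.cases ?_ (fun i => ?_) i <;> refine Fin.cases ?_ (fun j => ?_) j
      · exact fun h => absurd rfl h
      · exact fun _ => hdis j
      · exact fun _ => (hdis i).symm
      · intro h
        exact hTd i j fun h' => h (by rw [h'])

open Classical in
/-- **Menger's theorem**, edge version. -/
theorem menger (E : V → V → Prop) (k : ℕ) (x y : V)
    (h : ∀ F : Finset (V × V), F.card < k → Reach (del E F) x y) :
    ∃ T : Fin k → Finset (V × V), (∀ i, ∀ e ∈ T i, E e.1 e.2) ∧ (∀ i, Reach (rel (T i)) x y) ∧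
      ∀ i j, i ≠ j → Disjoint (T i) (T j) := by
  by_cases hxy : x = y
  · subst hxy
    exact ⟨fun _ => ∅, by simp, fun _ => Relation.ReflTransGen.refl, by simp⟩
  set S : Finset (V × V) := Finset.univ.filter fun e => E e.1 e.2 with hS
  obtain ⟨r, m, hr, hb⟩ := exists_maxFlow (ind S) {x} y (by simpa using Ne.symm hxy)
  have hcut := hr.isMaxMinCut hb
  have hkm : k ≤ m := by
    have h1 := hr.cut_eq _ hcut.sub hcut.notMem
    rw [cut_nonReach, zero_add, cut_ind] at h1
    by_contra hlt
    obtain ⟨a, b, -, ha, hab, hb⟩ := (h _ (by rw [← h1]; omega)).exists_crossing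
      (· ∈ nonReach r y) (hcut.sub (Finset.mem_singleton_self x)) hcut.notMem
    exact hab.2 (by simp [hS, hab.1, ha, hb])
  set Ef : Finset (V × V) := Finset.univ.filter fun e => r e.1 e.2 < ind S e.1 e.2 with hEf
  have hind : ∀ T : Finset (V × V), ∀ u w, ind T u w ≤ 1 := fun T u w => by
    unfold ind; split_ifs <;> omega
  obtain ⟨T, hT, hTr, hTd⟩ := exists_decomposition x y m Ef (by
    intro D hx hy
    have h1 := hr.cut_eq D (by simpa using hx) hy
    -- For unit capacities an edge carries flow exactly if its residual capacity has dropped from 1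
    -- to 0, and then its reverse has gained one. This makes the net outflow of `Ef` equal to the
    -- flow value.
    have h2 : (fun u w => ind Ef u w + r u w) = fun u w => ind Ef w u + ind S u w := by
      funext u w
      have h3 := hr.sum u w
      have h4 := hind S u w
      have h5 := hind S w u
      have h6 : ind Ef u w = if r u w < ind S u w then 1 else 0 := by
        unfold ind; simp [hEf, ind]
      have h7 : ind Ef w u = if r w u < ind S w u then 1 else 0 := by
        unfold ind; simp [hEf, ind]
      rw [h6, h7]
      split_ifs <;> omega
    have h3 := congrArg (fun c => cut c D) h2
    simp only [cut_add] at h3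
    omega)
  refine ⟨fun i => T (Fin.castLE hkm i), fun i e he => ?_, fun i => hTr _, fun i j hij => ?_⟩
  · have := hT _ he
    simp only [hEf, Finset.mem_filter, Finset.mem_univ, true_and] at this
    by_contra hE
    have h0 : ind S e.1 e.2 = 0 := by simp [ind, hS, hE]
    omega
  · exact hTd _ _ fun h => hij (by simpa [Fin.ext_iff] using h)

end Flow
end ConnCert

namespace ConnCert

/-! ### Minimal certificates for a single fault -/

set_option linter.unusedSectionVars false

section SingleFault

/-- Every vertex on a walk between mutually reachable vertices belongs to their component, so the
walk never leaves it. -/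
theorem SC.restrict {V : Type*} {E : V → V → Prop} {x y : V} (h : SC E x y) :
    Reach (fun a b => E a b ∧ SC E x a ∧ SC E x b) x y := by
  obtain ⟨h1, h2⟩ := h
  induction h1 with
  | refl => exact Relation.ReflTransGen.refl
  | @tail b c hab hbc ih =>
    have hb : Reach E b x := h2.head hbc
    exact (ih hb).tail ⟨hbc, ⟨hab, hb⟩, ⟨hab.tail hbc, h2⟩⟩

variable {V : Type*} [Fintype V] [DecidableEq V]

/-- `Γ'` preserves strong connectivity of `Γ` under every single fault. -/
def FT1 (Γ Γ' : V → V → Prop) : Prop :=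
  ∀ (g : V × V) (x y : V), SC (del Γ {g}) x y → SC (del Γ' {g}) x y

/-- The edge `e` cannot be deleted: some fault `g` makes it necessary. -/
def Crit (Γ : V → V → Prop) (e : V × V) : Prop :=
  ∃ g, g ≠ e ∧ Reach (del Γ {g}) e.2 e.1 ∧ ¬ Reach (del Γ {g, e}) e.1 e.2

theorem FT1.refl (Γ : V → V → Prop) : FT1 Γ Γ := fun _ _ _ h => h

theorem FT1.trans {Γ Γ' Γ'' : V → V → Prop} (h : FT1 Γ Γ') (h' : FT1 Γ' Γ'') : FT1 Γ Γ'' :=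
  fun g x y hxy => h' g x y (h g x y hxy)

/-- A walk inside a component is rerouted whenever it uses `e`. Since the ends of `e` then lie in
one component after the fault, noncriticality supplies a detour that avoids both the fault and `e`.
-/
theorem FT1.del {Γ : V → V → Prop} {e : V × V} (he : ¬ Crit Γ e) : FT1 Γ (del Γ {e}) := by
  intro g x y hxy
  have key : ∀ x y, SC (ConnCert.del Γ {g}) x y →
      Reach (ConnCert.del (ConnCert.del Γ {e}) {g}) x y := by
    intro x y hxy
    have h1 := hxy.restrict
    induction h1 with
    | refl => exact Relation.ReflTransGen.refl
    | @tail b c hab hbc ih =>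
      refine (ih hbc.2.1).trans ?_
      by_cases hbe : (b, c) = e
      · subst hbe
        have hcb : Reach (ConnCert.del Γ {g}) c b := (hbc.2.2.symm.trans hbc.2.1).1
        have hg : g ≠ (b, c) := fun h => hbc.1.2 (by simp [h])
        have h3 : Reach (ConnCert.del Γ {g, (b, c)}) b c := by
          by_contra hcon
          exact he ⟨g, hg, hcb, hcon⟩
        refine h3.mono fun u w h => ⟨⟨h.1, ?_⟩, ?_⟩ <;> have := h.2 <;>
          simp only [Finset.mem_insert, Finset.mem_singleton, not_or] at this ⊢ <;> tauto
      · exact Relation.ReflTransGen.single ⟨⟨hbc.1.1, by simpa using hbe⟩, hbc.1.2⟩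
  exact ⟨key x y hxy, key y x hxy.symm⟩

/-- Criticality survives later deletions: the way back from head to tail is preserved because tail
and head are mutually reachable after the fault, and fewer edges cannot create a detour. Hence
testing each edge once is enough. -/
theorem Crit.of_FT1 {Γ Γ' : V → V → Prop} {e : V × V} (h : Crit Γ e) (hsub : ∀ u w, Γ' u w → Γ u w)
    (hft : FT1 Γ Γ') (he : Γ e.1 e.2) : Crit Γ' e := by
  obtain ⟨g, hg, h1, h2⟩ := h
  refine ⟨g, hg, (hft g e.1 e.2 ⟨?_, h1⟩).2, fun h3 => h2 (h3.mono (del_mono hsub _))⟩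
  exact Relation.ReflTransGen.single ⟨he, by simpa using hg.symm⟩

open Classical in
/-- The strongly connected component of `r`. -/
noncomputable def comp (E : V → V → Prop) (r : V) : Finset V := Finset.univ.filter fun w => SC E r w

theorem mem_comp {E : V → V → Prop} {r w : V} : w ∈ comp E r ↔ SC E r w := by simp [comp]

theorem comp_eq {E : V → V → Prop} {r w : V} (h : SC E r w) : comp E w = comp E r := by
  ext z
  rw [mem_comp, mem_comp]
  exact ⟨fun h' => h.trans h', fun h' => h.symm.trans h'⟩

/-- If the edge `h` is not inside the component left by `g`, that component does not use `h` and
survives its deletion. -/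
theorem comp_subset_or {H : V → V → Prop} {r : V} {g h : V × V}
    (hgh : ¬ (h.1 ∈ comp (del H {g}) r ∧ h.2 ∈ comp (del H {g}) r)) :
    comp (del H {g}) r ⊆ comp (del H {h}) r := by
  intro w hw
  rw [mem_comp] at hw ⊢
  have hsub : ∀ x, SC (del H {g}) r x → ∀ a b,
      (del H {g} a b ∧ SC (del H {g}) x a ∧ SC (del H {g}) x b) → del H {h} a b := by
    intro x hx a b hab
    refine ⟨hab.1.1, fun hmem => hgh ?_⟩
    have : (a, b) = h := by simpa using hmem
    subst this
    exact ⟨mem_comp.2 (hx.trans hab.2.1), mem_comp.2 (hx.trans hab.2.2)⟩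
  exact ⟨hw.restrict.mono (hsub r (SC.refl _ r)), hw.symm.restrict.mono (hsub w hw)⟩

open Classical in
/-- Vertices sharing a component of size at most `m` with `r` after some single fault. -/
noncomputable def smallUnion (H : V → V → Prop) (r : V) (m : ℕ) : Finset V :=
  Finset.univ.filter fun w => ∃ g : V × V, (comp (del H {g}) r).card ≤ m ∧ w ∈ comp (del H {g}) r

/-- Small components around `r` are covered by a few maximal ones. Two maximal components come from
faults lying inside one another's component, so the sets of vertices which these faults cut off from
`r` are disjoint in each direction. Each fault cuts off nearly all of a big component, which leaves
room for few of them. -/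
theorem card_smallUnion_le (H : V → V → Prop) (r : V) (m : ℕ) :
    (smallUnion H r m).card ≤ 4 * m := by
  classical
  set V₀ := comp H r with hV₀
  have hsub : ∀ g, comp (del H {g}) r ⊆ V₀ := fun g w hw => by
    rw [hV₀, mem_comp]; exact (mem_comp.1 hw).mono fun _ _ h => h.1
  by_cases hbig : V₀.card ≤ 4 * m
  · refine le_trans (Finset.card_le_card fun w hw => ?_) hbig
    simp only [smallUnion, Finset.mem_filter, Finset.mem_univ, true_and] at hw
    obtain ⟨g, -, hw⟩ := hw
    exact hsub g hw
  push Not at hbig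
  set C : Finset (Finset V) :=
    (Finset.univ.image fun g : V × V => comp (del H {g}) r).filter fun M => M.card ≤ m with hC
  have hCmem : ∀ M, M ∈ C ↔ ∃ g : V × V, comp (del H {g}) r = M ∧ M.card ≤ m := by
    intro M; simp [hC]
  set 𝓜 : Finset (Finset V) := C.filter fun M => ∀ M' ∈ C, M ⊆ M' → M' = M with h𝓜
  have hex : ∀ M ∈ 𝓜, ∃ g : V × V, comp (del H {g}) r = M ∧ M.card ≤ m := fun M hM =>
    (hCmem M).1 (Finset.mem_filter.1 hM).1
  have : Nonempty (V × V) := ⟨(r, r)⟩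
  choose! g hg using hex
  have hcover : smallUnion H r m ⊆ 𝓜.biUnion id := by
    intro w hw
    simp only [smallUnion, Finset.mem_filter, Finset.mem_univ, true_and] at hw
    obtain ⟨g₀, hcard, hw⟩ := hw
    obtain ⟨M, hM, hmax⟩ := Finset.exists_max_image
      (C.filter fun M => comp (del H {g₀}) r ⊆ M) Finset.card
      ⟨comp (del H {g₀}) r, by simp only [Finset.mem_filter, subset_rfl, and_true]
                               exact (hCmem _).2 ⟨g₀, rfl, hcard⟩⟩
    simp only [Finset.mem_filter, and_imp] at hM hmax
    simp only [Finset.mem_biUnion, id]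
    refine ⟨M, Finset.mem_filter.2 ⟨hM.1, fun M' hM' hsub => ?_⟩, hM.2 hw⟩
    exact (Finset.eq_of_subset_of_card_le hsub (hmax M' hM' (hM.2.trans hsub))).symm
  -- Otherwise `comp_subset_or` would include one maximal component in another.
  have hin : ∀ M ∈ 𝓜, ∀ M' ∈ 𝓜, M ≠ M' →
      SC (del H {g M}) r (g M').1 ∧ SC (del H {g M}) r (g M').2 := by
    intro M hM M' hM' hne
    by_contra hcon
    have h1 := comp_subset_or (H := H) (r := r) (g := g M) (h := g M') (by
      rw [mem_comp, mem_comp]; exact hcon)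
    rw [(hg M hM).1, (hg M' hM').1] at h1
    exact hne ((Finset.mem_filter.1 hM).2 M' (Finset.mem_filter.1 hM').1 h1).symm
  set P : Finset V → Finset V := fun M => V₀.filter fun w => ¬ Reach (del H {g M}) r w with hP
  set Q : Finset V → Finset V := fun M => V₀.filter fun w => ¬ Reach (del H {g M}) w r with hQ
  -- A vertex reached from `r` in the full graph is reached avoiding one of the two faults: when a
  -- walk meets one fault, the head of that edge is reached avoiding the other.
  have hPd : ∀ M ∈ 𝓜, ∀ M' ∈ 𝓜, M ≠ M' → Disjoint (P M) (P M') := by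
    intro M hM M' hM' hne
    rw [Finset.disjoint_left]
    intro w hw hw'
    simp only [hP, Finset.mem_filter, hV₀, mem_comp] at hw hw'
    have := hw.1.1.closed (fun a => Reach (del H {g M}) r a ∨ Reach (del H {g M'}) r a)
      (Or.inl Relation.ReflTransGen.refl) (by
        rintro a b (ha | ha) hab
        · by_cases hab' : (a, b) = g M
          · exact Or.inr (by have := (hin M' hM' M hM hne.symm).2.1; rwa [← hab'] at this)
          · exact Or.inl (ha.tail ⟨hab, by simpa using hab'⟩)
        · by_cases hab' : (a, b) = g M'
          · exact Or.inl (by have := (hin M hM M' hM' hne).2.1; rwa [← hab'] at this)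
          · exact Or.inr (ha.tail ⟨hab, by simpa using hab'⟩))
    exact this.elim hw.2 hw'.2
  have hQd : ∀ M ∈ 𝓜, ∀ M' ∈ 𝓜, M ≠ M' → Disjoint (Q M) (Q M') := by
    intro M hM M' hM' hne
    rw [Finset.disjoint_left]
    intro w hw hw'
    simp only [hQ, Finset.mem_filter, hV₀, mem_comp] at hw hw'
    have := (reach_flip.2 hw.1.2).closed
      (fun a => Reach (del H {g M}) a r ∨ Reach (del H {g M'}) a r)
      (Or.inl Relation.ReflTransGen.refl) (by
        rintro a b (ha | ha) hab
        · by_cases hab' : (b, a) = g M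
          · exact Or.inr (by have := (hin M' hM' M hM hne.symm).1.2; rwa [← hab'] at this)
          · exact Or.inl (ha.head ⟨hab, by simpa using hab'⟩)
        · by_cases hab' : (b, a) = g M'
          · exact Or.inl (by have := (hin M hM M' hM' hne).1.2; rwa [← hab'] at this)
          · exact Or.inr (ha.head ⟨hab, by simpa using hab'⟩))
    exact this.elim hw.2 hw'.2
  have hPs : ∑ M ∈ 𝓜, (P M).card ≤ V₀.card := by
    rw [← Finset.card_biUnion hPd]
    exact Finset.card_le_card (Finset.biUnion_subset.2 fun M _ => Finset.filter_subset _ _)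
  have hQs : ∑ M ∈ 𝓜, (Q M).card ≤ V₀.card := by
    rw [← Finset.card_biUnion hQd]
    exact Finset.card_le_card (Finset.biUnion_subset.2 fun M _ => Finset.filter_subset _ _)
  have hPQ : ∀ M ∈ 𝓜, V₀.card ≤ m + (P M).card + (Q M).card := by
    intro M hM
    have h1 : V₀ ⊆ M ∪ P M ∪ Q M := by
      intro w hw
      by_cases h1 : Reach (del H {g M}) r w
      · by_cases h2 : Reach (del H {g M}) w r
        · have : w ∈ M := by rw [← (hg M hM).1]; exact mem_comp.2 ⟨h1, h2⟩
          simp [this]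
        · simp [hQ, hw, h2]
      · simp [hP, hw, h1]
    refine (Finset.card_le_card h1).trans ((Finset.card_union_le _ _).trans ?_)
    have := Finset.card_union_le M (P M)
    have := (hg M hM).2
    omega
  -- Summing over the maximal components, with total 2|V₀| for the cut-off sets, gives t|V₀| ≤ tm +
  -- 2|V₀|. Together with |V₀| > 4m this bounds their number t.
  have hsum : 𝓜.card * V₀.card ≤ 𝓜.card * m + 2 * V₀.card := by
    have h1 := Finset.sum_le_sum hPQ
    simp only [Finset.sum_add_distrib, Finset.sum_const, smul_eq_mul] at h1
    omega
  have h𝓜card : 𝓜.card ≤ 4 := by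
    by_contra hcon
    push Not at hcon
    have h1 : 4 * (𝓜.card * m) ≤ 𝓜.card * V₀.card := by
      have := Nat.mul_le_mul_left 𝓜.card hbig.le
      linarith [this]
    have h2 : 5 * V₀.card ≤ 𝓜.card * V₀.card := Nat.mul_le_mul_right _ hcon
    omega
  calc (smallUnion H r m).card ≤ (𝓜.biUnion id).card := Finset.card_le_card hcover
    _ ≤ ∑ M ∈ 𝓜, M.card := Finset.card_biUnion_le
    _ ≤ ∑ M ∈ 𝓜, m := Finset.sum_le_sum fun M hM => (hg M hM).2
    _ ≤ 4 * m := by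
      rw [Finset.sum_const, smul_eq_mul]; exact Nat.mul_le_mul_right _ h𝓜card

open Classical in
/-- Unit capacities together with a source edge `(r₀, r)`. -/
noncomputable def rootCap (E : V → V → Prop) (r₀ r u w : V) : ℕ :=
  if E u w ∨ (u = r₀ ∧ w = r) then 1 else 0

theorem cut_rootCap_le {E : V → V → Prop} {r₀ r : V} (h0 : ∀ w, ¬ E r₀ w) :
    cut (rootCap E r₀ r) {r₀} ≤ 1 := by
  have h1 : cut (rootCap E r₀ r) {r₀} ≤ cut (fun u w => if u = r₀ ∧ w = r then 1 else 0) {r₀} :=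
    cut_mono fun u w hu _ => by
      have hu : u = r₀ := by simpa using hu
      subst hu
      simp [rootCap, h0]
  rw [cut_single] at h1
  split_ifs at h1 <;> omega

/-- A chain with one round selects at most 2 tails and tolerates one fault. An edge into `v` that
was not selected is therefore never needed to reach `v` from `r`. -/
theorem exists_critTails (H : V → V → Prop) (r₀ r v : V) (hv : v ≠ r₀) (h0 : ∀ w, ¬ H r₀ w) :
    ∃ K : Finset V, K.card ≤ 2 ∧ ∀ (u : V) (g : V × V), Reach (del H {g}) r v →
      ¬ Reach (del H {g, (u, v)}) r v → u ∈ K := by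
  obtain ⟨K, hK⟩ := exists_chain v 1 {r₀} (rootCap H r₀ r) (by simpa using hv)
  refine ⟨K, ?_, fun u g h1 h2 => ?_⟩
  · have h1 := hK.card_le {r₀} subset_rfl (by simpa using hv)
    have := cut_rootCap_le (r := r) h0
    omega
  · by_contra hu
    refine h2 ((hK.reach hv (fun _ _ => rfl) h0 {g} (by simp) h1).mono fun a b hab => ⟨hab.1.1, ?_⟩)
    have h3 := hab.2
    simp only [Finset.mem_insert, Finset.mem_singleton, Prod.mk.injEq, not_or] at h3 ⊢
    refine ⟨h3, fun h4 => hu ?_⟩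
    have := hab.1.2 h4.2
    rwa [h4.1] at this

theorem flip_del (H : V → V → Prop) (F : Finset (V × V)) :
    flip (del H F) = del (flip H) (F.map (Equiv.prodComm V V).toEmbedding) := by
  funext u w
  simp only [flip, del, eq_iff_iff]
  refine and_congr_right fun _ => not_congr ?_
  simp

/-- A graph all of whose edges are critical for a single fault is sparse. -/
theorem card_crit_le (H : V → V → Prop) (r₀ : V) (h0 : ∀ w, ¬ H r₀ w) (h0' : ∀ w, ¬ H w r₀)
    (S : Finset (V × V)) (hS : ∀ e ∈ S, H e.1 e.2 ∧ Crit H e) :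
    S.card ≤ 32 * Fintype.card V * (Nat.log 2 (Fintype.card V) + 1) := by
  classical
  have hex : ∀ e ∈ S, ∃ g, g ≠ e ∧ Reach (del H {g}) e.2 e.1 ∧ ¬ Reach (del H {g, e}) e.1 e.2 :=
    fun e he => (hS e he).2
  choose! g hg using hex
  set C : V × V → Finset V := fun e => comp (del H {g e}) e.1 with hC
  have hSC : ∀ e ∈ S, SC (del H {g e}) e.1 e.2 := fun e he =>
    ⟨Relation.ReflTransGen.single ⟨(hS e he).1, by simpa using (hg e he).1.symm⟩, (hg e he).2.1⟩
  have hKin : ∀ r v, ∃ K : Finset V, K.card ≤ 2 ∧ (v ≠ r₀ → ∀ (u : V) (g : V × V),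
      Reach (del H {g}) r v → ¬ Reach (del H {g, (u, v)}) r v → u ∈ K) := by
    intro r v
    by_cases hv : v = r₀
    · exact ⟨∅, by simp, fun h => absurd hv h⟩
    · obtain ⟨K, h1, h2⟩ := exists_critTails H r₀ r v hv h0
      exact ⟨K, h1, fun _ => h2⟩
  have hKout : ∀ r v, ∃ K : Finset V, K.card ≤ 2 ∧ (v ≠ r₀ → ∀ (u : V) (g : V × V),
      Reach (del H {g}) v r → ¬ Reach (del H {g, (v, u)}) v r → u ∈ K) := by
    intro r v
    by_cases hv : v = r₀
    · exact ⟨∅, by simp, fun h => absurd hv h⟩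
    · obtain ⟨K, h1, h2⟩ := exists_critTails (flip H) r₀ r v hv h0'
      refine ⟨K, h1, fun _ u g h3 h4 => h2 u g.swap ?_ ?_⟩
      · rw [← reach_flip, flip_del] at h3
        simpa using h3
      · rw [← reach_flip, flip_del] at h4
        simpa using h4
  choose Kin hKin1 hKin2 using hKin
  choose Kout hKout1 hKout2 using hKout
  have hscale : ∀ j, (S.filter fun e => Nat.log 2 (C e).card = j).card ≤ 32 * Fintype.card V := by
    intro j
    set T := S.filter fun e => Nat.log 2 (C e).card = j with hT
    -- The constant is 8 · 2^j possible endpoints, from `card_smallUnion_le` at size 2^(j+1), with 2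
    -- critical edges in and 2 out for each.
    have hroot : ∀ r, (T.filter fun e => r ∈ C e).card ≤ 32 * 2 ^ j := by
      intro r
      set A := smallUnion H r (2 ^ (j + 1)) with hA
      have hAc : A.card ≤ 4 * 2 ^ (j + 1) := card_smallUnion_le H r _
      have hsub : (T.filter fun e => r ∈ C e) ⊆
          (A.biUnion fun v => (Kin r v).image fun u => (u, v)) ∪
          (A.biUnion fun v => (Kout r v).image fun u => (v, u)) := by
        intro e he
        rw [Finset.mem_filter, hT, Finset.mem_filter] at he
        obtain ⟨⟨heS, hej⟩, hre⟩ := he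
        have hre' : SC (del H {g e}) e.1 r := mem_comp.1 hre
        have hcomp : comp (del H {g e}) r = C e := comp_eq hre'
        have hcard : (comp (del H {g e}) r).card ≤ 2 ^ (j + 1) := by
          rw [hcomp, ← hej]
          exact (Nat.lt_pow_succ_log_self (by norm_num) _).le
        have hmem : ∀ w, SC (del H {g e}) e.1 w → w ∈ A := fun w hw => by
          simp only [hA, smallUnion, Finset.mem_filter, Finset.mem_univ, true_and]
          exact ⟨g e, hcard, by rw [hcomp]; exact mem_comp.2 hw⟩
        rw [Finset.mem_union, Finset.mem_biUnion, Finset.mem_biUnion]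
        -- If the tail still reaches `r` without `e`, then `r` cannot reach the head without `e`,
        -- and `e` is critical for reaching its head from `r`. Otherwise `e` is critical for
        -- reaching `r` from its tail.
        by_cases h1 : Reach (del H {g e, e}) e.1 r
        · left
          refine ⟨e.2, hmem _ (hSC e heS), Finset.mem_image.2 ⟨e.1, ?_, rfl⟩⟩
          refine hKin2 r e.2 (fun h => h0' e.1 (h ▸ (hS e heS).1)) e.1 (g e)
            (hre'.symm.trans (hSC e heS)).1 fun h2 => (hg e heS).2.2 (h1.trans h2)
        · right
          refine ⟨e.1, hmem _ (SC.refl _ _), Finset.mem_image.2 ⟨e.2, ?_, rfl⟩⟩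
          exact hKout2 r e.1 (fun h => h0 e.2 (h ▸ (hS e heS).1)) e.2 (g e) hre'.1 h1
      refine (Finset.card_le_card hsub).trans ((Finset.card_union_le _ _).trans ?_)
      have h1 : (A.biUnion fun v => (Kin r v).image fun u => (u, v)).card ≤ A.card * 2 :=
        Finset.card_biUnion_le_card_mul _ _ _ fun v _ => Finset.card_image_le.trans (hKin1 r v)
      have h2 : (A.biUnion fun v => (Kout r v).image fun u => (v, u)).card ≤ A.card * 2 :=
        Finset.card_biUnion_le_card_mul _ _ _ fun v _ => Finset.card_image_le.trans (hKout1 r v)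
      rw [pow_succ] at hAc
      omega
    -- Count pairs of a critical edge and a root in its component: an edge of scale j has at least
    -- 2^j roots, while a root has at most 32 · 2^j edges.
    have hdouble : ∑ e ∈ T, (C e).card = ∑ r, (T.filter fun e => r ∈ C e).card := by
      simp only [Finset.card_filter]
      rw [Finset.sum_comm]
      refine Finset.sum_congr rfl fun e _ => ?_
      rw [← Finset.card_filter]
      congr 1
      ext r; simp
    have hlow : T.card * 2 ^ j ≤ ∑ e ∈ T, (C e).card := by
      rw [← smul_eq_mul, ← Finset.sum_const]
      refine Finset.sum_le_sum fun e he => ?_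
      rw [hT, Finset.mem_filter] at he
      rw [← he.2]
      exact Nat.pow_log_le_self 2 (Finset.card_pos.2 ⟨e.1, mem_comp.2 (SC.refl _ _)⟩).ne'
    have hup : ∑ r : V, (T.filter fun e => r ∈ C e).card ≤ Fintype.card V * (32 * 2 ^ j) := by
      rw [← smul_eq_mul, Fintype.card, ← Finset.sum_const]
      exact Finset.sum_le_sum fun r _ => hroot r
    have hpos : 0 < 2 ^ j := by positivity
    refine Nat.le_of_mul_le_mul_right ?_ hpos
    calc T.card * 2 ^ j ≤ _ := hlow
      _ = _ := hdouble
      _ ≤ _ := hup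
      _ = _ := by ring
  have hmap : ∀ e ∈ S, Nat.log 2 (C e).card ∈ Finset.range (Nat.log 2 (Fintype.card V) + 1) := by
    intro e _
    rw [Finset.mem_range, Nat.lt_succ_iff]
    exact Nat.log_mono_right (Finset.card_le_univ _)
  have := Finset.card_le_mul_card_image_of_maps_to hmap _ fun j _ => hscale j
  simpa using this

end SingleFault
end ConnCert

namespace ConnCert

set_option linter.unusedSectionVars false

/-! ### Fault-tolerant strong connectivity -/

section FaultTolerance

variable {V : Type*} [Fintype V] [DecidableEq V]

/-- `H` preserves the strongly connected components of `E` under at most `f` edge faults. -/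
def FTSS (f : ℕ) (E H : V → V → Prop) : Prop :=
  ∀ F : Finset (V × V), F.card ≤ f → ∀ x y, SC (del E F) x y → SC (del H F) x y

-- Each vertex that reaches `x` keeps one edge to a vertex of smaller rank, so there are at most as
-- many edges as such vertices.
open Classical in
theorem exists_inTree (E : V → V → Prop) (x : V) : ∃ S : Finset (V × V),
    (∀ e ∈ S, E e.1 e.2) ∧ S.card ≤ (Finset.univ.filter fun u => Reach E u x).card ∧
      ∀ u, Reach E u x → Reach (rel S) u x := by
  obtain ⟨d, hd⟩ := exists_rank E x
  choose! p hp using hd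
  refine ⟨((Finset.univ.filter fun u => Reach E u x).filter (· ≠ x)).image fun u => (u, p u),
    ?_, ?_, ?_⟩
  · intro e he
    simp only [Finset.mem_image, Finset.mem_filter, Finset.mem_univ, true_and] at he
    obtain ⟨u, ⟨h1, h2⟩, rfl⟩ := he
    exact (hp u h1 h2).1
  · exact Finset.card_image_le.trans (Finset.card_le_card (Finset.filter_subset _ _))
  · intro u hu
    generalize hn : d u = n
    induction n using Nat.strong_induction_on generalizing u with
    | _ n ih =>
      by_cases hux : u = x
      · rw [hux]
      · obtain ⟨h1, h2, h3⟩ := hp u hu hux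
        refine Relation.ReflTransGen.head ?_ (ih _ (hn ▸ h3) (p u) h2 rfl)
        simp only [Finset.mem_image, Finset.mem_filter, Finset.mem_univ, true_and]
        exact ⟨u, ⟨hu, hux⟩, rfl⟩

/-- Every strongly connected component has a sparse strongly connected spanning subgraph. -/
theorem exists_sparse (E : V → V → Prop) (x : V) : ∃ S : Finset (V × V),
    (∀ e ∈ S, E e.1 e.2) ∧ S.card ≤ 2 * (comp E x).card ∧ ∀ y, SC E x y → SC (rel S) x y := by
  classical
  -- Restricting to the component first ensures that both the in-tree and the out-tree have only as
  -- many edges as the component has vertices.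
  set E' : V → V → Prop := fun a b => E a b ∧ SC E x a ∧ SC E x b with hE'
  have hin : ∀ u, Reach E' u x → SC E x u := fun u hu => by
    induction hu using Relation.ReflTransGen.head_induction_on with
    | refl => exact SC.refl _ _
    | head hab _ _ => exact hab.2.1
  have hout : ∀ u, Reach (flip E') u x → SC E x u := fun u hu => by
    induction hu using Relation.ReflTransGen.head_induction_on with
    | refl => exact SC.refl _ _
    | head hab _ _ => exact hab.2.2
  obtain ⟨S₁, h11, h12, h13⟩ := exists_inTree E' x
  obtain ⟨S₂, h21, h22, h23⟩ := exists_inTree (flip E') x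
  refine ⟨S₁ ∪ S₂.image Prod.swap, ?_, ?_, ?_⟩
  · intro e he
    rcases Finset.mem_union.1 he with he | he
    · exact (h11 e he).1
    · obtain ⟨e', he', rfl⟩ := Finset.mem_image.1 he
      exact (h21 e' he').1
  · refine (Finset.card_union_le _ _).trans ?_
    have h1 : S₁.card ≤ (comp E x).card := h12.trans (Finset.card_le_card fun u hu =>
      mem_comp.2 (hin u (by simpa using hu)))
    have h2 : S₂.card ≤ (comp E x).card := h22.trans (Finset.card_le_card fun u hu =>
      mem_comp.2 (hout u (by simpa using hu)))
    have := Finset.card_image_le (s := S₂) (f := Prod.swap)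
    omega
  · intro y hy
    have hxy : Reach E' x y := hy.restrict
    have hyx : Reach E' y x := hy.symm.restrict.mono fun a b h =>
      ⟨h.1, hy.trans h.2.1, hy.trans h.2.2⟩
    refine ⟨?_, (h13 y hyx).mono fun a b h => Finset.mem_union_left _ h⟩
    have h3 := h23 y (reach_flip.2 hxy)
    rw [← reach_flip]
    refine h3.mono fun a b h => ?_
    exact Finset.mem_union_right _ (Finset.mem_image.2 ⟨_, h, rfl⟩)

/-- Small components are handled through the graphs `Γ`, large ones through roots. -/
theorem FTSS.of_cases {f : ℕ} {E H : V → V → Prop}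
    (h : ∀ F : Finset (V × V), F.card ≤ f → ∀ x,
      (∃ r, SC (del E F) x r ∧ (∀ w, Reach (del E F) r w → Reach (del H F) r w) ∧
        (∀ w, Reach (del E F) w r → Reach (del H F) w r)) ∨
      (∃ (S X : Finset (V × V)) (g : V × V) (Γ : V → V → Prop), (∀ e ∈ S, del E F e.1 e.2) ∧
        (∀ y, SC (del E F) x y → SC (rel S) x y) ∧ (g ∈ F ∨ ¬ E g.1 g.2) ∧ F.erase g ⊆ X ∧
        Disjoint X S ∧ FT1 (del E X) Γ ∧ (∀ u w, Γ u w → del E X u w) ∧ ∀ u w, Γ u w → H u w)) :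
    FTSS f E H := by
  intro F hF x y hxy
  rcases h F hF x with ⟨r, hr, h1, h2⟩ | ⟨S, X, g, Γ, hS, hSC, hg, hX, hd, hft, hΓ, hH⟩
  · have hry : SC (del E F) r y := hr.symm.trans hxy
    exact ⟨(h2 x hr.1).trans (h1 y hry.1), (h2 y hry.2).trans (h1 x hr.2)⟩
  · have h1 : SC (del (del E X) {g}) x y := (hSC y hxy).mono fun u w huw => by
      have h2 := hS _ huw
      refine ⟨⟨h2.1, fun h => Finset.disjoint_left.1 hd h huw⟩, fun h => ?_⟩
      have h3 : (u, w) = g := by simpa using h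
      rcases hg with hg | hg
      · exact h2.2 (h3 ▸ hg)
      · exact hg (h3 ▸ h2.1)
    refine (hft g x y h1).mono fun u w huw => ⟨hH u w huw.1, fun hF => ?_⟩
    refine (hΓ u w huw.1).2 (hX (Finset.mem_erase.2 ⟨?_, hF⟩))
    simpa using huw.2

end FaultTolerance

/-! ### Paths as lists -/

section Paths

variable {V : Type*}

theorem reach_of_chain {R R' : V → V → Prop} : ∀ (p : List V) (x y : V), p.head? = some x →
    p.getLast? = some y → p.IsChain R → (∀ e ∈ pathEdges p, R e.1 e.2 → R' e.1 e.2) → Reach R' x y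
  | [], x, y, h, _, _, _ => by simp at h
  | [a], x, y, h, h', _, _ => by
    simp at h h'; subst h; subst h'; exact Relation.ReflTransGen.refl
  | a :: b :: l, x, y, h, h', hc, he => by
    simp only [List.head?_cons, Option.some.injEq] at h
    subst h
    rw [List.isChain_cons_cons] at hc
    refine Relation.ReflTransGen.head (he (a, b) (by simp [pathEdges]) hc.1) ?_
    refine reach_of_chain (b :: l) b y rfl ?_ hc.2 fun e h => he e ?_
    · rw [← h']; simp [List.getLast?_cons_cons]
    · exact List.mem_cons_of_mem _ h

theorem chain_edges {R : V → V → Prop} : ∀ (p : List V), p.IsChain R → ∀ e ∈ pathEdges p, R e.1 e.2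
  | [], _, e, he => by simp [pathEdges] at he
  | [a], _, e, he => by simp [pathEdges] at he
  | a :: b :: l, hc, e, he => by
    rw [List.isChain_cons_cons] at hc
    rcases List.mem_cons.1 he with rfl | he
    · exact hc.1
    · exact chain_edges (b :: l) hc.2 e he

theorem mem_of_mem_pathEdges {p : List V} {e : V × V} (he : e ∈ pathEdges p) :
    e.1 ∈ p ∧ e.2 ∈ p :=
  ⟨(List.of_mem_zip he).1, List.mem_of_mem_tail (List.of_mem_zip he).2⟩

theorem exists_next : ∀ (p : List V) (y v : V), p.getLast? = some y → v ∈ p → v ≠ y →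
    ∃ w, (v, w) ∈ pathEdges p
  | [], _, v, _, h, _ => by simp at h
  | [a], y, v, h, hv, hne => by
    simp at h hv; exact absurd (hv.trans h) hne
  | a :: b :: l, y, v, h, hv, hne => by
    rcases List.mem_cons.1 hv with rfl | hv
    · exact ⟨b, by simp [pathEdges]⟩
    · obtain ⟨w, hw⟩ := exists_next (b :: l) y v (by rw [← h]; simp [List.getLast?_cons_cons]) hv hne
      exact ⟨w, List.mem_cons_of_mem _ hw⟩

theorem pathEdges_fst_ne : ∀ (p : List V) (y : V), p.getLast? = some y → p.Nodup →
    ∀ e ∈ pathEdges p, e.1 ≠ y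
  | [], _, _, _, e, h => by simp [pathEdges] at h
  | [a], _, _, _, e, h => by simp [pathEdges] at h
  | a :: b :: l, y, h, hn, e, he => by
    have h' : (b :: l).getLast? = some y := by rw [← h]; simp [List.getLast?_cons_cons]
    rcases List.mem_cons.1 he with rfl | he
    · rintro rfl
      exact (List.nodup_cons.1 hn).1 (List.mem_of_getLast? h')
    · exact pathEdges_fst_ne (b :: l) y h' (List.nodup_cons.1 hn).2 e he

theorem pathEdges_snd_ne {p : List V} {x : V} (hx : p.head? = some x) (hn : p.Nodup)
    {e : V × V} (he : e ∈ pathEdges p) : e.2 ≠ x := by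
  cases p with
  | nil => simp at hx
  | cons a l =>
    simp only [List.head?_cons, Option.some.injEq] at hx
    subst hx
    rintro rfl
    exact (List.nodup_cons.1 hn).1 (List.of_mem_zip he).2

/-- This settles the one edge that internally disjoint paths could share: two paths through the edge
from `x` to `y` coincide, against the required distinctness. -/
theorem eq_pair_of_mem {p : List V} {x y : V} (hx : p.head? = some x) (hy : p.getLast? = some y)
    (hn : p.Nodup) (he : (x, y) ∈ pathEdges p) : p = [x, y] := by
  match p, hx, hy, hn, he with
  | [], hx, _, _, _ => simp at hx
  | [a], _, _, _, he => simp [pathEdges] at he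
  | a :: b :: l, hx, hy, hn, he =>
    simp only [List.head?_cons, Option.some.injEq] at hx
    subst hx
    rcases List.mem_cons.1 he with he | he
    · simp only [Prod.mk.injEq, true_and] at he
      subst he
      cases l with
      | nil => rfl
      | cons c l =>
        have h1 : (c :: l).getLast? = some y := by rw [← hy]; simp [List.getLast?_cons_cons]
        exact absurd (List.mem_of_getLast? h1) (List.nodup_cons.1 (List.nodup_cons.1 hn).2).1
    · exact absurd (mem_of_mem_pathEdges he).1 (List.nodup_cons.1 hn).1

/-- Reachability is witnessed by a simple path. -/
theorem Reach.exists_path {R : V → V → Prop} {x y : V} (h : Reach R x y) :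
    ∃ p : List V, p.head? = some x ∧ p.getLast? = some y ∧ p.IsChain R ∧ p.Nodup := by
  obtain ⟨d, hd⟩ := exists_rank R y
  have : ∀ n x, Reach R x y → d x = n → ∃ l : List V, (x :: l).getLast? = some y ∧
      (x :: l).IsChain R ∧ (x :: l).Nodup ∧ ∀ v ∈ l, d v < n := by
    intro n
    induction n using Nat.strong_induction_on with
    | _ n ih =>
      intro x hx hn
      by_cases hxy : x = y
      · subst hxy; exact ⟨[], by simp⟩
      · obtain ⟨w, hw, hwy, hlt⟩ := hd x hx hxy
        obtain ⟨l, h1, h2, h3, h4⟩ := ih (d w) (hn ▸ hlt) w hwy rfl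
        have h5 : ∀ v ∈ w :: l, d v < n := by
          intro v hv
          rcases List.mem_cons.1 hv with rfl | hv
          · omega
          · have := h4 v hv; omega
        refine ⟨w :: l, by rw [← h1]; simp [List.getLast?_cons_cons], ?_, ?_, h5⟩
        · rw [List.isChain_cons_cons]; exact ⟨hw, h2⟩
        · exact List.nodup_cons.2 ⟨fun h => by have := h5 x h; omega, h3⟩
  obtain ⟨l, h1, h2, h3, -⟩ := this _ x h rfl
  exact ⟨x :: l, rfl, h1, h2, h3⟩

/-- A walk may be restarted at its last visit of `a` and stopped at its first visit of `b`. -/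
theorem Reach.strip {R : V → V → Prop} {a b : V} (h : Reach R a b) :
    Reach (fun u w => R u w ∧ w ≠ a ∧ u ≠ b) a b := by
  classical
  have h1 : Reach (fun u w => R u w ∧ w ≠ a) a b := by
    induction h with
    | refl => exact Relation.ReflTransGen.refl
    | @tail z c hz hc ih =>
      by_cases hca : c = a
      · rw [hca]
      · exact ih.tail ⟨hc, hca⟩
  have h2 : ∀ z, Reach (fun u w => R u w ∧ w ≠ a) z b →
      Reach (fun u w => R u w ∧ w ≠ a ∧ u ≠ b) z b := by
    intro z hz
    induction hz using Relation.ReflTransGen.head_induction_on with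
    | refl => exact Relation.ReflTransGen.refl
    | @head z c hc _ ih =>
      by_cases hzb : z = b
      · rw [hzb]
      · exact ih.head ⟨hc.1, hc.2, hzb⟩
  exact h2 a h1

/-- Pigeonhole: a fault spoils at most one of `k` disjoint paths, so fewer than `k` faults leave one
intact. -/
theorem exists_avoiding {ι : Type*} [DecidableEq ι] {k : ℕ} (F : Finset ι) (hF : F.card < k)
    (bad : Fin k → ι → Prop) (h : ∀ i j, i ≠ j → ∀ e ∈ F, bad i e → bad j e → False) :
    ∃ i, ∀ e ∈ F, ¬ bad i e := by
  by_contra hcon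
  push Not at hcon
  choose e he hb using hcon
  have h1 := Finset.card_le_card_of_injOn (s := Finset.univ) (t := F) e (fun i _ => he i) (by
    intro i _ j _ hij
    by_contra hne
    exact h i j hne (e i) (he i) (hb i) (hij ▸ hb j))
  simp at h1
  omega

end Paths

/-! ### The split graph -/

section Split

variable {n : ℕ}

/-- The entry copy of a vertex. -/
def inn (i : Fin n) : Fin (2 * n + 1) := ⟨i, by omega⟩

/-- The exit copy of a vertex. -/
def out (i : Fin n) : Fin (2 * n + 1) := ⟨n + i, by omega⟩

theorem inn_inj {i j : Fin n} : inn i = inn j ↔ i = j := by simp [inn, Fin.ext_iff]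
theorem out_inj {i j : Fin n} : out i = out j ↔ i = j := by simp [out, Fin.ext_iff]
theorem inn_ne_out (i j : Fin n) : inn i ≠ out j := by simp [inn, out, Fin.ext_iff]; omega

/-- The split graph: every vertex becomes an edge from its entry copy to its exit copy. -/
def splitRel (G : Digraph (Fin n)) (u w : Fin (2 * n + 1)) : Prop :=
  (∃ i, u = inn i ∧ w = out i) ∨ ∃ i j, G.Adj i j ∧ u = out i ∧ w = inn j

/-- The digraph on the original vertices given by a subgraph of the split graph. -/
def unsplit (H : Fin (2 * n + 1) → Fin (2 * n + 1) → Prop) : Digraph (Fin n) where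
  Adj i j := H (out i) (inn j)

theorem splitRel_split (G : Digraph (Fin n)) (i : Fin n) : splitRel G (inn i) (out i) :=
  Or.inl ⟨i, rfl, rfl⟩

theorem splitRel_cross {G : Digraph (Fin n)} {i j : Fin n} :
    splitRel G (out i) (inn j) ↔ G.Adj i j := by
  constructor
  · rintro (⟨a, h, -⟩ | ⟨a, b, h, h1, h2⟩)
    · exact absurd h.symm (inn_ne_out a i)
    · rwa [out_inj.1 h1, inn_inj.1 h2]
  · exact fun h => Or.inr ⟨i, j, h, rfl, rfl⟩

theorem split_reach {G : Digraph (Fin n)} {F : Finset (Fin (2 * n + 1) × Fin (2 * n + 1))}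
    {x z : Fin n}
    (h : Reach (fun u w => G.Adj u w ∧ (out u, inn w) ∉ F ∧ (inn u, out u) ∉ F) x z) :
    z = x ∨ Reach (del (splitRel G) F) (out x) (inn z) := by
  induction h with
  | refl => exact Or.inl rfl
  | @tail b c hab hbc ih =>
    right
    have hlast : del (splitRel G) F (out b) (inn c) := ⟨splitRel_cross.2 hbc.1, hbc.2.1⟩
    rcases ih with rfl | ih
    · exact Relation.ReflTransGen.single hlast
    · exact (ih.tail ⟨splitRel_split G b, hbc.2.2⟩).tail hlast

/-- Besides the projected walk, it is recorded that every vertex left, other than the start, was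
traversed through its split edge. Disjointness of edge sets upstairs becomes disjointness of inner
vertices downstairs through this record. -/
theorem unsplit_reach {G : Digraph (Fin n)} {Q : Fin (2 * n + 1) → Fin (2 * n + 1) → Prop}
    (hQ : ∀ u w, Q u w → splitRel G u w) {x : Fin n} {w : Fin (2 * n + 1)}
    (h : Reach Q (out x) w) : ∀ v,
      (w = inn v → Reach (fun a b => Q (out a) (inn b) ∧ (a = x ∨ Q (inn a) (out a))) x v) ∧
      (w = out v → Reach (fun a b => Q (out a) (inn b) ∧ (a = x ∨ Q (inn a) (out a))) x v ∧
        (v = x ∨ Q (inn v) (out v))) := by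
  induction h with
  | refl =>
    refine fun v => ⟨fun h => absurd h.symm (inn_ne_out v x), fun h => ?_⟩
    rw [out_inj.1 h]
    exact ⟨Relation.ReflTransGen.refl, Or.inl rfl⟩
  | @tail b c hab hbc ih =>
    intro v
    rcases hQ b c hbc with ⟨i, rfl, rfl⟩ | ⟨i, j, -, rfl, rfl⟩
    · refine ⟨fun h => absurd h.symm (inn_ne_out v i), fun h => ?_⟩
      rw [← out_inj.1 h]
      exact ⟨(ih i).1 rfl, Or.inr hbc⟩
    · refine ⟨fun h => ?_, fun h => absurd h (inn_ne_out j v)⟩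
      rw [← inn_inj.1 h]
      exact ((ih i).2 rfl).1.tail ⟨hbc, ((ih i).2 rfl).2⟩

theorem unsplit_reach_inn {G : Digraph (Fin n)} {Q : Fin (2 * n + 1) → Fin (2 * n + 1) → Prop}
    (hQ : ∀ u w, Q u w → splitRel G u w) {x : Fin n} {w : Fin (2 * n + 1)}
    (h : Reach Q (inn x) w) : ∀ v, (w = inn v ∨ w = out v) →
      Reach (fun a b => Q (out a) (inn b)) x v := by
  induction h with
  | refl =>
    rintro v (h | h)
    · rw [inn_inj.1 h]
    · exact absurd h (inn_ne_out x v)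
  | @tail b c hab hbc ih =>
    rintro v hv
    rcases hQ b c hbc with ⟨i, rfl, rfl⟩ | ⟨i, j, -, rfl, rfl⟩
    · rcases hv with h | h
      · exact absurd h.symm (inn_ne_out v i)
      · rw [← out_inj.1 h]; exact ih i (Or.inl rfl)
    · rcases hv with h | h
      · rw [← inn_inj.1 h]; exact (ih i (Or.inr rfl)).tail hbc
      · exact absurd h (inn_ne_out j v)

variable {k : ℕ} {G : Digraph (Fin n)} {H : Fin (2 * n + 1) → Fin (2 * n + 1) → Prop}

theorem unsplit_le (hsub : ∀ u w, H u w → splitRel G u w) : unsplit H ≤ G :=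
  fun {_ _} h => splitRel_cross.1 (hsub _ _ h)

/-- `H` may lack split edges, but the split graph of its projection has all of them, so passing to
it only adds edges. -/
theorem le_splitRel_unsplit (hsub : ∀ u w, H u w → splitRel G u w) :
    ∀ u w, H u w → splitRel (unsplit H) u w := by
  intro u w h
  rcases hsub u w h with ⟨i, rfl, rfl⟩ | ⟨i, j, -, rfl, rfl⟩
  · exact splitRel_split _ i
  · exact splitRel_cross.2 h

theorem hasEdgeDisjointPaths_of_reach {G : Digraph (Fin n)} {x y : Fin n}
    (h : ∀ F : Finset (Fin n × Fin n), F.card < k → Reach (del G.Adj F) x y) :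
    HasEdgeDisjointPaths G k x y := by
  obtain ⟨T, hT, hTr, hTd⟩ := menger G.Adj k x y h
  choose P hP using fun i => (hTr i).exists_path
  refine ⟨P, fun i => ⟨(hP i).1, (hP i).2.1, (hP i).2.2.1.imp fun a b h => hT i _ h,
    (hP i).2.2.2⟩, fun i j hij => ?_⟩
  rw [List.disjoint_left]
  intro e hi hj
  exact Finset.disjoint_left.1 (hTd i j hij) (chain_edges _ (hP i).2.2.1 e hi)
    (chain_edges _ (hP j).2.2.1 e hj)

theorem HasEdgeDisjointPaths.reach {G : Digraph (Fin n)} {x y : Fin n}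
    (h : HasEdgeDisjointPaths G k x y) (F : Finset (Fin n × Fin n)) (hF : F.card < k) :
    Reach (del G.Adj F) x y := by
  obtain ⟨P, hP, hd⟩ := h
  obtain ⟨i, hi⟩ := exists_avoiding F hF (fun i e => e ∈ pathEdges (P i))
    fun i j hij e _ h1 h2 => hd i j hij h1 h2
  exact reach_of_chain (P i) x y (hP i).1 (hP i).2.1 (hP i).2.2.1 fun e he h =>
    ⟨h, fun hF => hi e hF he⟩

/-- Edge faults correspond to cross edges, which leave all split edges intact. One path survives in
each direction, the entry copies stay mutually reachable, and the projection of the surviving walk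
avoids the faults. Menger's theorem converts this back into paths. -/
theorem FTSS.isEdgeCertificate (hk : 1 ≤ k) (hsub : ∀ u w, H u w → splitRel G u w)
    (h : FTSS (k - 1) (splitRel G) H) : IsEdgeCertificate k G (unsplit H) := by
  refine ⟨unsplit_le hsub, fun x y hxy => ?_⟩
  have key : ∀ x y, HasEdgeDisjointPaths G k x y → HasEdgeDisjointPaths G k y x →
      HasEdgeDisjointPaths (unsplit H) k x y := by
    intro x y h1 h2
    refine hasEdgeDisjointPaths_of_reach fun F hF => ?_
    by_cases hne : y = x
    · rw [hne]
    set F' := F.image fun e : Fin n × Fin n => (out e.1, inn e.2) with hF'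
    have hcross : ∀ u w, (out u, inn w) ∈ F' → (u, w) ∈ F := by
      intro u w huw
      simp only [hF', Finset.mem_image, Prod.mk.injEq] at huw
      obtain ⟨e, he, h3, h4⟩ := huw
      rw [← out_inj.1 h3, ← inn_inj.1 h4]; exact he
    have hsplit : ∀ u, (inn u, out u) ∉ F' := by
      intro u huw
      simp only [hF', Finset.mem_image, Prod.mk.injEq] at huw
      obtain ⟨e, he, h3, h4⟩ := huw
      exact inn_ne_out _ _ h3.symm
    have hone : ∀ x y, y ≠ x → HasEdgeDisjointPaths G k x y →
        Reach (del (splitRel G) F') (inn x) (inn y) := by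
      intro x y hne hp
      refine Relation.ReflTransGen.head ⟨splitRel_split G x, hsplit x⟩ ?_
      exact (split_reach ((hp.reach F hF).mono fun u w huw =>
        ⟨huw.1, fun h => huw.2 (hcross u w h), hsplit u⟩)).resolve_left hne
    have hcard : F'.card ≤ k - 1 := Finset.card_image_le.trans (by omega)
    have h3 := (h F' hcard (inn x) (inn y) ⟨hone x y hne h1, hone y x (Ne.symm hne) h2⟩).1
    have h4 := unsplit_reach_inn (G := G) (fun u w h => hsub u w h.1) h3 y (Or.inl rfl)
    refine h4.mono fun a b hab => ⟨hab.1, fun hF => hab.2 ?_⟩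
    exact Finset.mem_image.2 ⟨(a, b), hF, rfl⟩
  exact ⟨key x y hxy.1 hxy.2, key y x hxy.2 hxy.1⟩

/-- For `k ≥ 2` distinctness excludes `x = y`, where the one-vertex path is the only simple path. -/
theorem HasVertexDisjointPaths.ne {x y : Fin n} (hk : 2 ≤ k)
    (h : HasVertexDisjointPaths G k x y) : y ≠ x := by
  rintro rfl
  obtain ⟨P, hP, hd⟩ := h
  have h1 : ∀ i, P i = [y] := by
    intro i
    obtain ⟨h1, h2, -, h4⟩ := hP i
    cases hp : P i with
    | nil => rw [hp] at h1; simp at h1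
    | cons a l =>
      rw [hp] at h1 h2 h4
      simp only [List.head?_cons, Option.some.injEq] at h1
      subst h1
      cases l with
      | nil => rfl
      | cons b l =>
        have : (b :: l).getLast? = some a := by rw [← h2]; simp [List.getLast?_cons_cons]
        exact absurd (List.mem_of_getLast? this) (List.nodup_cons.1 h4).1
  exact (hd ⟨0, by omega⟩ ⟨1, by omega⟩ (by simp)).1 ((h1 _).trans (h1 _).symm)

theorem HasVertexDisjointPaths.reach {x y : Fin n} (h : HasVertexDisjointPaths G k x y)
    (hne : y ≠ x) (F : Finset (Fin (2 * n + 1) × Fin (2 * n + 1))) (hF : F.card < k)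
    (hx : (inn x, out x) ∉ F) (hy : (inn y, out y) ∉ F) :
    Reach (del (splitRel G) F) (out x) (inn y) := by
  obtain ⟨P, hP, hd⟩ := h
  obtain ⟨i, hi⟩ := exists_avoiding F hF
    -- A path is spoiled by the cross edge of one of its edges or by the split edge of the tail. The
    -- split edges of `x` and `y`, the only ones that two paths may share, are excluded by
    -- hypothesis.
    (fun i e => ∃ d ∈ pathEdges (P i), e = (out d.1, inn d.2) ∨ e = (inn d.1, out d.1)) (by
    rintro i j hij e he ⟨d, hd1, hd2⟩ ⟨d', hd1', hd2'⟩
    obtain ⟨hneP, hcap⟩ := hd i j hij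
    rcases hd2 with hd2 | hd2 <;> rcases hd2' with hd2' | hd2'
    · rw [hd2, Prod.mk.injEq, out_inj, inn_inj] at hd2'
      have hdd : d = d' := Prod.ext hd2'.1 hd2'.2
      subst hdd
      have e1 := (hcap d.1 (mem_of_mem_pathEdges hd1).1 (mem_of_mem_pathEdges hd1').1).resolve_right
        (pathEdges_fst_ne _ y (hP i).2.1 (hP i).2.2.2 d hd1)
      have e2 := (hcap d.2 (mem_of_mem_pathEdges hd1).2 (mem_of_mem_pathEdges hd1').2).resolve_left
        (pathEdges_snd_ne (hP i).1 (hP i).2.2.2 hd1)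
      have hdxy : d = (x, y) := Prod.ext e1 e2
      rw [hdxy] at hd1 hd1'
      exact hneP ((eq_pair_of_mem (hP i).1 (hP i).2.1 (hP i).2.2.2 hd1).trans
        (eq_pair_of_mem (hP j).1 (hP j).2.1 (hP j).2.2.2 hd1').symm)
    · rw [hd2, Prod.mk.injEq] at hd2'
      exact inn_ne_out _ _ hd2'.1.symm
    · rw [hd2, Prod.mk.injEq] at hd2'
      exact inn_ne_out _ _ hd2'.1
    · rw [hd2, Prod.mk.injEq, inn_inj] at hd2'
      rcases hcap d.1 (mem_of_mem_pathEdges hd1).1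
        (hd2'.1 ▸ (mem_of_mem_pathEdges hd1').1) with h1 | h1
      · rw [hd2, h1] at he; exact hx he
      · rw [hd2, h1] at he; exact hy he)
  have h1 := reach_of_chain (R' := fun u w => G.Adj u w ∧ (out u, inn w) ∉ F ∧ (inn u, out u) ∉ F)
    (P i) x y (hP i).1 (hP i).2.1 (hP i).2.2.1 fun e he h =>
    ⟨h, fun hF => hi _ hF ⟨e, he, Or.inl rfl⟩, fun hF => hi _ hF ⟨e, he, Or.inr rfl⟩⟩
  exact (split_reach h1).resolve_left hne

/-- Disjoint edge sets share no split edge, hence their paths share no inner vertex. The paths are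
distinct because their first edges come from disjoint sets. -/
theorem hasVertexDisjointPaths_of_reach {G : Digraph (Fin n)} {x y : Fin n} (hne : y ≠ x)
    (h : ∀ F : Finset (Fin (2 * n + 1) × Fin (2 * n + 1)), F.card < k →
      Reach (del (splitRel G) F) (out x) (inn y)) : HasVertexDisjointPaths G k x y := by
  obtain ⟨T, hT, hTr, hTd⟩ := menger (splitRel G) k (out x) (inn y) h
  have hr := fun i => (unsplit_reach (Q := rel (T i)) (fun u w huw => hT i _ huw) (hTr i) y).1 rfl
  choose P hP using fun i => (hr i).exists_path
  refine ⟨P, fun i => ⟨(hP i).1, (hP i).2.1, (hP i).2.2.1.imp fun a b h =>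
    splitRel_cross.1 (hT i _ h.1), (hP i).2.2.2⟩, fun i j hij => ⟨fun heq => ?_, fun v hi hj => ?_⟩⟩
  · have hx : x ∈ P i := List.mem_of_head? (hP i).1
    obtain ⟨w, hw⟩ := exists_next (P i) y x (hP i).2.1 hx (Ne.symm hne)
    have h1 := chain_edges _ (hP i).2.2.1 _ hw
    rw [heq] at hw
    have h2 := chain_edges _ (hP j).2.2.1 _ hw
    exact Finset.disjoint_left.1 (hTd i j hij) h1.1 h2.1
  · by_contra hcon
    push Not at hcon
    obtain ⟨w, hw⟩ := exists_next (P i) y v (hP i).2.1 hi hcon.2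
    obtain ⟨w', hw'⟩ := exists_next (P j) y v (hP j).2.1 hj hcon.2
    have h1 := (chain_edges _ (hP i).2.2.1 _ hw).2.resolve_left hcon.1
    have h2 := (chain_edges _ (hP j).2.2.1 _ hw').2.resolve_left hcon.1
    exact Finset.disjoint_left.1 (hTd i j hij) h1 h2

/-- Faults at the split edges of `x` and `y` are first ignored, since paths may share these
vertices. The two split edges then close the surviving paths into mutual reachability of the exit
copy of `x` and the entry copy of `y`. -/
theorem FTSS.isVertexCertificate (hk : 2 ≤ k) (hsub : ∀ u w, H u w → splitRel G u w)
    (h : FTSS (k - 1) (splitRel G) H) : IsVertexCertificate k G (unsplit H) := by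
  refine ⟨unsplit_le hsub, fun x y hxy => ?_⟩
  have key : ∀ x y, HasVertexDisjointPaths G k x y → HasVertexDisjointPaths G k y x →
      HasVertexDisjointPaths (unsplit H) k x y := by
    intro x y h1 h2
    have hne := h1.ne hk
    refine hasVertexDisjointPaths_of_reach hne fun F hF => ?_
    set F' := (F.erase (inn x, out x)).erase (inn y, out y) with hF'
    have hcard : F'.card ≤ k - 1 := by
      have : F'.card ≤ F.card :=
        Finset.card_le_card ((Finset.erase_subset _ _).trans (Finset.erase_subset _ _))
      omega
    have hx : (inn x, out x) ∉ F' := by simp [hF']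
    have hy : (inn y, out y) ∉ F' := by simp [hF']
    have r1 := h1.reach hne F' (by omega) hx hy
    have r2 := h2.reach hne.symm F' (by omega) hy hx
    have s1 : Reach (del (splitRel G) F') (inn y) (out x) :=
      (Relation.ReflTransGen.head ⟨splitRel_split G y, hy⟩ r2).tail ⟨splitRel_split G x, hx⟩
    -- Neither ignored fault is used by the stripped walk: one of these edges enters its start and
    -- the other leaves its end.
    have h3 := (h F' hcard (out x) (inn y) ⟨r1, s1⟩).1.strip
    refine h3.mono fun u w huw => ⟨le_splitRel_unsplit hsub u w huw.1.1, fun huF => huw.1.2 ?_⟩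
    refine Finset.mem_erase.2 ⟨fun h => ?_, Finset.mem_erase.2 ⟨fun h => ?_, huF⟩⟩
    · exact huw.2.2 (congrArg Prod.fst h)
    · exact huw.2.1 (congrArg Prod.snd h)
  exact ⟨key x y hxy.1 hxy.2, key y x hxy.2 hxy.1⟩

end Split
end ConnCert

namespace ConnCert

/-! ### Independent coins -/

section Coins

instance : IsProbabilityMeasure coins := by unfold coins; infer_instance

/-- The event `E` depends only on the coins in `J`. -/
def DependsOnCoins (J : Finset ℕ) (E : Set (ℕ → Bool)) : Prop :=
  ∀ ω ω' : ℕ → Bool, (∀ j ∈ J, ω j = ω' j) → (ω ∈ E ↔ ω' ∈ E)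

/-- Such an event is the preimage of a set of finitely many coin patterns, which gives measurability
and independence without further work. -/
theorem DependsOnCoins.exists_preimage {J : Finset ℕ} {E : Set (ℕ → Bool)}
    (h : DependsOnCoins J E) :
    ∃ S : Set (J → Bool), E = (fun ω (i : J) => ω i) ⁻¹' S := by
  classical
  refine ⟨{x | (fun j => if hj : j ∈ J then x ⟨j, hj⟩ else false) ∈ E}, ?_⟩
  ext ω
  exact h _ _ fun j hj => by simp [hj]

theorem DependsOnCoins.measurableSet {J : Finset ℕ} {E : Set (ℕ → Bool)}
    (h : DependsOnCoins J E) : MeasurableSet E := by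
  obtain ⟨S, rfl⟩ := h.exists_preimage
  exact measurableSet_preimage (by fun_prop) (Set.toFinite S).measurableSet

theorem DependsOnCoins.mono {J J' : Finset ℕ} {E : Set (ℕ → Bool)} (h : DependsOnCoins J E)
    (hJ : J ⊆ J') : DependsOnCoins J' E := fun ω ω' hω => h ω ω' fun j hj => hω j (hJ hj)

theorem DependsOnCoins.compl {J : Finset ℕ} {E : Set (ℕ → Bool)} (h : DependsOnCoins J E) :
    DependsOnCoins J Eᶜ := fun ω ω' hω => not_congr (h ω ω' hω)

theorem DependsOnCoins.biInter {ι : Type*} {s : Finset ι} {J : Finset ℕ}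
    {E : ι → Set (ℕ → Bool)} (h : ∀ i ∈ s, DependsOnCoins J (E i)) :
    DependsOnCoins J (⋂ i ∈ s, E i) := fun ω ω' hω => by
  simp only [Set.mem_iInter]
  exact forall₂_congr fun i hi => h i hi ω ω' hω

theorem coins_inter {J J' : Finset ℕ} {E E' : Set (ℕ → Bool)} (h : DependsOnCoins J E)
    (h' : DependsOnCoins J' E') (hJ : Disjoint J J') :
    coins.real (E ∩ E') = coins.real E * coins.real E' := by
  obtain ⟨S, rfl⟩ := h.exists_preimage
  obtain ⟨S', rfl⟩ := h'.exists_preimage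
  have hind : ProbabilityTheory.iIndepFun (fun (i : ℕ) (ω : ℕ → Bool) => ω i) coins :=
    ProbabilityTheory.iIndepFun_infinitePi (X := fun _ b => b) fun _ => measurable_id
  have h2 := hind.indepFun_finset J J' hJ fun i => by fun_prop
  have h3 := h2.measure_inter_preimage_eq_mul S S' (Set.toFinite S).measurableSet
    (Set.toFinite S').measurableSet
  simp only [Measure.real]
  rw [← ENNReal.toReal_mul]
  exact congrArg ENNReal.toReal h3

theorem coins_biInter {ι : Type*} [DecidableEq ι] (s : Finset ι) {J : ι → Finset ℕ}
    {E : ι → Set (ℕ → Bool)} (h : ∀ i ∈ s, DependsOnCoins (J i) (E i))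
    (hJ : ∀ i ∈ s, ∀ j ∈ s, i ≠ j → Disjoint (J i) (J j)) :
    coins.real (⋂ i ∈ s, E i) = ∏ i ∈ s, coins.real (E i) := by
  induction s using Finset.induction_on with
  | empty => simp
  | insert a s ha ih =>
    rw [Finset.prod_insert ha, ← ih (fun i hi => h i (Finset.mem_insert_of_mem hi))
      fun i hi j hj => hJ i (Finset.mem_insert_of_mem hi) j (Finset.mem_insert_of_mem hj),
      Finset.set_biInter_insert]
    refine coins_inter (h a (Finset.mem_insert_self _ _)) (J' := s.biUnion J) ?_ ?_
    · exact DependsOnCoins.biInter fun i hi =>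
        (h i (Finset.mem_insert_of_mem hi)).mono (Finset.subset_biUnion_of_mem J hi)
    · rw [Finset.disjoint_biUnion_right]
      intro i hi
      exact hJ a (Finset.mem_insert_self _ _) i (Finset.mem_insert_of_mem hi)
        fun h => ha (h ▸ hi)

theorem coins_single (j : ℕ) (b : Bool) : coins.real {ω | ω j = b} = 1 / 2 := by
  have h1 := Measure.infinitePi_map_eval
    (μ := fun _ : ℕ => (PMF.uniformOfFintype Bool).toMeasure) j
  have h2 : coins {ω | ω j = b} = (PMF.uniformOfFintype Bool).toMeasure {b} := by
    rw [← h1, Measure.map_apply (by fun_prop) (measurableSet_singleton b)]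
    rfl
  simp only [Measure.real]
  rw [h2, PMF.toMeasure_apply_singleton _ _ (measurableSet_singleton b)]
  simp

theorem dependsOnCoins_single (j : ℕ) (b : Bool) : DependsOnCoins {j} {ω | ω j = b} :=
  fun ω ω' h => by simp [h j (Finset.mem_singleton_self j)]

/-- Independent repetitions all fail. -/
theorem coins_repeat {M L p : ℕ} {E : ℕ → Set (ℕ → Bool)} {ρ : ℝ}
    (hE : ∀ t, DependsOnCoins (Finset.Ico (p + t * L) (p + t * L + L)) (E t))
    (hρ : ∀ t, coins.real (E t) = ρ) : coins.real {ω | ∀ t < M, ω ∉ E t} = (1 - ρ) ^ M := by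
  have h1 : {ω | ∀ t < M, ω ∉ E t} = ⋂ t ∈ Finset.range M, (E t)ᶜ := by ext ω; simp
  rw [h1, coins_biInter (Finset.range M) (fun t _ => (hE t).compl)]
  · rw [Finset.prod_congr rfl fun t _ => ?_, Finset.prod_const, Finset.card_range]
    rw [measureReal_compl (hE t).measurableSet, hρ]
    simp
  · intro i _ j _ hij
    rw [Finset.disjoint_left]
    intro x hx hx'
    simp only [Finset.mem_Ico] at hx hx'
    rcases lt_or_gt_of_ne hij with h | h
    · have := Nat.mul_le_mul_right L (show i + 1 ≤ j from h)
      rw [Nat.succ_mul] at this; omega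
    · have := Nat.mul_le_mul_right L (show j + 1 ≤ i from h)
      rw [Nat.succ_mul] at this; omega

/-! ### Random roots and random fault sets read off the coins -/

/-- The number given by the `b` coins from position `p` on. -/
def rootVal (ω : ℕ → Bool) (p : ℕ) : ℕ → ℕ
  | 0 => 0
  | b + 1 => rootVal ω p b + rootVal ω p b + if ω (p + b) = true then 1 else 0

theorem rootVal_congr {ω ω' : ℕ → Bool} {p b : ℕ}
    (h : ∀ j ∈ Finset.Ico p (p + b), ω j = ω' j) : rootVal ω p b = rootVal ω' p b := by
  induction b with
  | zero => rfl
  | succ b ih =>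
    simp only [rootVal]
    rw [ih fun j hj => h j (by simp at hj ⊢; omega), h (p + b) (by simp)]

theorem coins_rootVal_eq (p b c : ℕ) (hc : c < 2 ^ b) :
    coins.real {ω | rootVal ω p b = c} = 1 / 2 ^ b := by
  induction b generalizing c with
  | zero =>
    have : c = 0 := by simpa using hc
    subst this
    simp [rootVal]
  | succ b ih =>
    have h1 : {ω | rootVal ω p (b + 1) = c} =
        {ω | rootVal ω p b = c / 2} ∩ {ω | ω (p + b) = decide (c % 2 = 1)} := by
      ext ω
      simp only [rootVal, Set.mem_ofPred_eq, Set.mem_inter_iff]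
      cases ω (p + b) <;> by_cases h : c % 2 = 1 <;> simp [h] <;> omega
    rw [h1, coins_inter (J := Finset.Ico p (p + b)) (J' := {p + b}), ih, coins_single, pow_succ]
    · field_simp
    · rw [pow_succ] at hc; omega
    · exact fun ω ω' h => by simp only [Set.mem_ofPred_eq, rootVal_congr h]
    · exact dependsOnCoins_single _ _
    · simp

theorem coins_root_miss (p b Q : ℕ) (C : Finset ℕ) (hC : ∀ c ∈ C, c < 2 ^ b) :
    coins.real {ω | ∀ i < Q, rootVal ω (p + i * b) b ∉ C} = (1 - C.card / 2 ^ b) ^ Q := by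
  refine coins_repeat (L := b) (p := p) (E := fun i => {ω | rootVal ω (p + i * b) b ∈ C})
    (fun t ω ω' h => by simp only [Set.mem_ofPred_eq, rootVal_congr h]) fun t => ?_
  have h1 : {ω | rootVal ω (p + t * b) b ∈ C} = ⋃ c ∈ C, {ω | rootVal ω (p + t * b) b = c} := by
    ext ω; simp
  rw [h1, measureReal_biUnion_finset]
  · rw [Finset.sum_congr rfl fun c hc => coins_rootVal_eq _ b c (hC c hc)]
    simp [div_eq_mul_inv]
  · intro c _ c' _ hne
    exact Set.disjoint_left.2 fun ω h h' => hne (h.symm.trans h')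
  · intro c _
    exact DependsOnCoins.measurableSet (J := Finset.Ico (p + t * b) (p + t * b + b))
      fun ω ω' h => by simp only [Set.mem_ofPred_eq, rootVal_congr h]

/-- All `a` coins from position `p` on show heads. -/
def AllHeads (ω : ℕ → Bool) (p a : ℕ) : Prop := ∀ l < a, ω (p + l) = true

theorem allHeads_depends (p a : ℕ) : DependsOnCoins (Finset.Ico p (p + a)) {ω | AllHeads ω p a} :=
  fun ω ω' h => by
    simp only [Set.mem_ofPred_eq, AllHeads]
    exact forall₂_congr fun l hl => by rw [h (p + l) (by simp; omega)]

theorem coins_allHeads (p a : ℕ) : coins.real {ω | AllHeads ω p a} = 1 / 2 ^ a := by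
  have h1 : {ω | AllHeads ω p a} = ⋂ l ∈ Finset.range a, {ω | ω (p + l) = true} := by
    ext ω; simp [AllHeads]
  rw [h1, coins_biInter (Finset.range a) (fun l _ => dependsOnCoins_single (p + l) true)]
  · simp [coins_single]
  · intro i _ j _ hij
    simpa using hij

/-- The position of the first coin for the pair `e`. -/
def pairPos {N : ℕ} (a : ℕ) (e : Fin N × Fin N) : ℕ := (e.1 * N + e.2) * a

theorem pairPos_add_le {N : ℕ} (a : ℕ) (e : Fin N × Fin N) : pairPos a e + a ≤ N * N * a := by
  have h1 : (e.1 : ℕ) * N + e.2 + 1 ≤ N * N := by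
    have h2 : ((e.1 : ℕ) + 1) * N ≤ N * N := Nat.mul_le_mul_right N e.1.2
    have := e.2.2
    rw [Nat.succ_mul] at h2
    omega
  have := Nat.mul_le_mul_right a h1
  rw [Nat.succ_mul] at this
  exact this

theorem pairPos_disjoint {N : ℕ} (a p : ℕ) {e e' : Fin N × Fin N} (h : e ≠ e') :
    Disjoint (Finset.Ico (p + pairPos a e) (p + pairPos a e + a))
      (Finset.Ico (p + pairPos a e') (p + pairPos a e' + a)) := by
  have hne : (e.1 : ℕ) * N + e.2 ≠ e'.1 * N + e'.2 := by
    intro heq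
    have hN : 0 < N := e.1.pos
    have h1 := congrArg (· / N) heq
    have h2 := congrArg (· % N) heq
    simp only [Nat.mul_add_mod', Nat.mod_eq_of_lt e.2.2, Nat.mod_eq_of_lt e'.2.2] at h2
    have h3 : ∀ x y : ℕ, y < N → (x * N + y) / N = x := fun x y hy => by
      rw [mul_comm, Nat.mul_add_div hN, Nat.div_eq_of_lt hy, add_zero]
    simp only [h3 _ _ e.2.2, h3 _ _ e'.2.2] at h1
    exact h (Prod.ext (Fin.ext h1) (Fin.ext h2))
  rw [Finset.disjoint_left]
  intro x hx hx'
  simp only [Finset.mem_Ico, pairPos] at hx hx'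
  rcases lt_or_gt_of_ne hne with h | h
  · have := Nat.mul_le_mul_right a (Nat.succ_le_of_lt h)
    rw [Nat.succ_mul] at this; omega
  · have := Nat.mul_le_mul_right a (Nat.succ_le_of_lt h)
    rw [Nat.succ_mul] at this; omega

/-- Different pairs use disjoint blocks of `a` coins and different rounds use disjoint blocks of `N
* N * a` coins, so all probabilities multiply. -/
theorem coins_sample_miss {N : ℕ} (p a M : ℕ) (F S : Finset (Fin N × Fin N)) (hFS : Disjoint F S) :
    coins.real {ω | ∀ t < M, ¬ ((∀ e ∈ F, AllHeads ω (p + t * (N * N * a) + pairPos a e) a) ∧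
      ∀ e ∈ S, ¬ AllHeads ω (p + t * (N * N * a) + pairPos a e) a)} =
      (1 - (1 / 2 ^ a) ^ F.card * (1 - 1 / 2 ^ a) ^ S.card) ^ M := by
  classical
  refine coins_repeat (L := N * N * a) (p := p)
    (E := fun t => {ω | (∀ e ∈ F, AllHeads ω (p + t * (N * N * a) + pairPos a e) a) ∧
      ∀ e ∈ S, ¬ AllHeads ω (p + t * (N * N * a) + pairPos a e) a}) (fun t => ?_) fun t => ?_
  · generalize p + t * (N * N * a) = P
    have h1 : ∀ e : Fin N × Fin N, DependsOnCoins (Finset.Ico P (P + N * N * a))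
        {ω | AllHeads ω (P + pairPos a e) a} := fun e =>
      (allHeads_depends _ a).mono (Finset.Ico_subset_Ico (by omega)
        (by have := pairPos_add_le a e; omega))
    intro ω ω' h
    exact and_congr (forall₂_congr fun e _ => h1 e ω ω' h)
      (forall₂_congr fun e _ => not_congr (h1 e ω ω' h))
  · generalize p + t * (N * N * a) = P
    set A : Fin N × Fin N → Set (ℕ → Bool) := fun e =>
      if e ∈ F then {ω | AllHeads ω (P + pairPos a e) a}
      else {ω | AllHeads ω (P + pairPos a e) a}ᶜ with hA
    have hAF : ∀ e ∈ F, A e = {ω | AllHeads ω (P + pairPos a e) a} := fun e he => by simp [hA, he]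
    have hAS : ∀ e ∈ S, A e = {ω | AllHeads ω (P + pairPos a e) a}ᶜ := fun e he => by
      simp [hA, Finset.disjoint_right.1 hFS he]
    have h1 : {ω | (∀ e ∈ F, AllHeads ω (P + pairPos a e) a) ∧
        ∀ e ∈ S, ¬ AllHeads ω (P + pairPos a e) a} = ⋂ e ∈ F ∪ S, A e := by
      ext ω
      simp only [Set.mem_ofPred_eq, Set.mem_iInter, Finset.mem_union]
      constructor
      · rintro ⟨h1, h2⟩ e (he | he)
        · rw [hAF e he]; exact h1 e he
        · rw [hAS e he]; exact h2 e he
      · intro h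
        refine ⟨fun e he => ?_, fun e he => ?_⟩
        · have := h e (Or.inl he); rwa [hAF e he] at this
        · have := h e (Or.inr he); rwa [hAS e he] at this
    rw [h1, coins_biInter (F ∪ S) (J := fun e => Finset.Ico (P + pairPos a e) (P + pairPos a e + a)),
      Finset.prod_union hFS]
    · congr 1
      · rw [Finset.prod_congr rfl fun e he => by rw [hAF e he, coins_allHeads], Finset.prod_const]
      · rw [Finset.prod_congr rfl fun e he => by
          rw [hAS e he, measureReal_compl (allHeads_depends _ a).measurableSet, coins_allHeads],
          Finset.prod_const]
        simp
    · intro e _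
      simp only [hA]
      split_ifs
      · exact allHeads_depends _ a
      · exact (allHeads_depends _ a).compl
    · exact fun e _ e' _ hne => pairPos_disjoint a P hne

end Coins
end ConnCert

namespace ConnCert
namespace FP

/-! ### Basic program components -/

/-- The value of a variable. -/
abbrev v (x : ℕ) : Expr := .var x
/-- A constant. -/
abbrev num (x : ℕ) : Expr := .const x
/-- An array entry. -/
abbrev rd (a : ℕ) (i j : Expr) : Expr := .read a i j
/-- Nonzero iff the two expressions differ. -/
abbrev neq (e e' : Expr) : Expr := .add (.sub e e') (.sub e' e)

theorem sem_seq (ω : ℕ → Bool) (c₁ c₂ : FP) (s : State) :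
    sem ω (c₁ ;; c₂) s = sem ω c₂ (sem ω c₁ s) := rfl

theorem sem_var {ω : ℕ → Bool} {c : FP} {s : State} {z : ℕ} (h : z ∉ c.mv) :
    (sem ω c s).var z = s.var z := (frame_sem ω c s).var z h

theorem sem_arr {ω : ℕ → Bool} {c : FP} {s : State} {a : ℕ} (h : a ∉ c.ma) :
    (sem ω c s).arr a = s.arr a := (frame_sem ω c s).arr a h

theorem sem_used {ω : ℕ → Bool} {c : FP} {s : State} (h : c.flips = false) :
    (sem ω c s).used = s.used := (frame_sem ω c s).used h

/-- A loop over the entries of a row. -/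
theorem sem_vecLoop {ω : ℕ → Bool} {a x bd N : ℕ} {c : FP} {s : State} (hmv : c.mv = [])
    (hb : s.var bd = N) (h2 : N ≤ s.var 2) (row : ℕ)
    (val : ℕ → ℕ)
    (h : ∀ s₁ i, i < N → s₁.var x = i → (∀ z, z ≠ x → s₁.var z = s.var z) →
      (∀ a', a' ∉ c.ma → s₁.arr a' = s.arr a') → s₁.arr a row i = s.arr a row i →
      (sem ω c s₁).arr a row i = val i ∧
        ∀ p q, (p ≠ row ∨ q ≠ i) → (sem ω c s₁).arr a p q = s₁.arr a p q) (p q : ℕ) :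
    (sem ω (loop x bd c) s).arr a p q = if p = row ∧ q < N then val q else s.arr a p q := by
  have hB : min (s.var bd) (s.var 2) = N := by omega
  have := loop_inv (ω := ω) (y := bd) (c := c) (x := x) (by simp [hmv])
    (fun i s₁ => ∀ p q, s₁.arr a p q = if p = row ∧ q < i then val q else s.arr a p q) s
    (by simp [State.setVar_arr]) (by
      intro i hi s₁ hI hfr hx p q
      rw [hB] at hi
      obtain ⟨h1, h3⟩ := h s₁ i hi hx
        (fun z hz => hfr.var z (by simp [mv, hmv, hz])) (fun a' ha' => hfr.arr a' ha')
        (by rw [hI]; simp)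
      rw [State.setVar_arr]
      by_cases hpq : p = row ∧ q = i
      · obtain ⟨rfl, rfl⟩ := hpq
        rw [h1]; simp
      · rw [h3 p q (by tauto), hI]
        refine if_congr ?_ rfl rfl
        constructor
        · rintro ⟨h4, h5⟩; exact ⟨h4, by omega⟩
        · rintro ⟨h4, h5⟩; refine ⟨h4, ?_⟩
          rcases Nat.lt_succ_iff_lt_or_eq.1 h5 with h6 | h6
          · exact h6
          · exact absurd ⟨h4, h6⟩ hpq)
  rw [hB] at this
  exact this p q

/-- A double loop over the entries of a matrix. -/
theorem sem_matLoop {ω : ℕ → Bool} {a x y bd N : ℕ} {c : FP} {s : State} (hxy : x ≠ y)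
    (hxb : x ≠ bd) (hx2 : x ≠ 2) (hyb : y ≠ bd) (hy2 : y ≠ 2) (hmv : c.mv = [])
    (hb : s.var bd = N) (h2 : N ≤ s.var 2) (val : ℕ → ℕ → ℕ)
    (h : ∀ s₁ i j, i < N → j < N → s₁.var x = i → s₁.var y = j →
      (∀ z, z ≠ x → z ≠ y → s₁.var z = s.var z) →
      (∀ a', a' ∉ c.ma → s₁.arr a' = s.arr a') → s₁.arr a i j = s.arr a i j →
      (sem ω c s₁).arr a i j = val i j ∧
        ∀ p q, (p ≠ i ∨ q ≠ j) → (sem ω c s₁).arr a p q = s₁.arr a p q) (p q : ℕ) :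
    (sem ω (loop x bd (loop y bd c)) s).arr a p q =
      if p < N ∧ q < N then val p q else s.arr a p q := by
  have hB : min (s.var bd) (s.var 2) = N := by omega
  have := loop_inv (ω := ω) (y := bd) (c := loop y bd c) (x := x) (by simp [mv, hmv, hxy])
    (fun i s₁ => ∀ p q, s₁.arr a p q = if p < i ∧ q < N then val p q else s.arr a p q) s
    (by simp [State.setVar_arr]) (by
      intro i hi s₁ hI hfr hx p q
      rw [hB] at hi
      have hv : ∀ z, z ≠ x → z ≠ y → s₁.var z = s.var z := fun z hz hz' =>
        hfr.var z (by simp [mv, hmv, hz, hz'])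
      have := sem_vecLoop (ω := ω) (a := a) (x := y) (bd := bd) (N := N) (c := c) (s := s₁) hmv
        (by rw [hv bd hxb.symm hyb.symm, hb]) (by rw [hv 2 hx2.symm hy2.symm]; exact h2) i (val i) (by
          intro s₂ j hj hy hv2 ha2 hij
          refine h s₂ i j hi hj (by rw [hv2 x hxy, hx]) hy (fun z hz hz' => ?_) (fun a' ha' => ?_) ?_
          · rw [hv2 z hz', hv z hz hz']
          · rw [ha2 a' ha']; exact hfr.arr a' ha'
          · rw [hij, hI]; simp)
      rw [State.setVar_arr, this, hI]
      by_cases hp : p = i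
      · subst hp; simp
      · simp only [hp, false_and, if_false]
        refine if_congr ?_ rfl rfl
        constructor <;> rintro ⟨h4, h5⟩ <;> exact ⟨by omega, h5⟩)
  rw [hB] at this
  exact this p q

/-- Fill the matrix `a` with the values of an expression. -/
def fill (a x y : ℕ) (e : Expr) : FP := loop x 3 (loop y 3 (write a (v x) (v y) e))

theorem sem_fill {ω : ℕ → Bool} {a x y N : ℕ} {e : Expr} {s : State} (hxy : x ≠ y)
    (hx3 : x ≠ 3) (hx2 : x ≠ 2) (hy3 : y ≠ 3) (hy2 : y ≠ 2)
    (h3 : s.var 3 = N) (h2 : N ≤ s.var 2) (val : ℕ → ℕ → ℕ)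
    (h : ∀ s₁ i j, s₁.var x = i → s₁.var y = j → (∀ z, z ≠ x → z ≠ y → s₁.var z = s.var z) →
      (∀ a', a' ≠ a → s₁.arr a' = s.arr a') → e.eval s₁ = val i j) (p q : ℕ) :
    (sem ω (fill a x y e) s).arr a p q = if p < N ∧ q < N then val p q else s.arr a p q := by
  refine sem_matLoop hxy hx3 hx2 hy3 hy2 rfl h3 h2 val ?_ p q
  intro s₁ i j hi hj hx hy hv ha hij
  have he := h s₁ i j hx hy hv fun a' ha' => ha a' (by simp [ma, ha'])
  constructor
  · simp [sem, State.setArr_arr, Expr.eval, hx, hy, he]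
  · intro p q hpq
    simp only [sem, State.setArr_arr, Expr.eval, hx, hy]
    rw [if_neg (by tauto)]

/-- The `N × N` matrix in an array. -/
def mat (N : ℕ) (s : State) (a : ℕ) (i j : Fin N) : ℕ := s.arr a i j

/-! ### Backward reachability -/

/-- One relaxation step of the backward search. -/
def backStep : FP :=
  ite (rd 6 (num 0) (v 22)) skip (when (rd 6 (num 0) (v 23)) (when (rd 5 (v 22) (v 23))
    (write 10 (num 0) (v 22) (v 23) ;;
      write 6 (num 0) (v 22) (.add (rd 6 (num 0) (v 23)) (num 1)))))

/-- Computes in array 6 which vertices reach the vertex in variable 20 along positive entries of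
array 5 (with labels), and in array 10 the next vertex on such a walk. -/
def backReach : FP :=
  loop 22 3 (write 6 (num 0) (v 22) (num 0)) ;;
  write 6 (num 0) (v 20) (num 1) ;;
  loop 21 3 (loop 22 3 (loop 23 3 backStep))

/-- The invariant of the backward search. -/
structure BInv (N : ℕ) (W : Fin N → Fin N → ℕ) (z : Fin N) (A : ℕ → ℕ → ℕ → ℕ) : Prop where
  root : A 6 0 z = 1
  sound : ∀ u : Fin N, A 6 0 u ≠ 0 → Reach (supp W) u z
  next : ∀ u : Fin N, A 6 0 u ≠ 0 → u ≠ z → ∃ w : Fin N, A 10 0 u = w ∧ W u w ≠ 0 ∧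
    A 6 0 w ≠ 0 ∧ A 6 0 u = A 6 0 w + 1
  bound : ∀ u : Fin N, A 6 0 u ≤ (Finset.univ.filter fun u : Fin N => A 6 0 u ≠ 0).card

theorem backStep_spec {ω : ℕ → Bool} {N : ℕ} {W : Fin N → Fin N → ℕ} {z : Fin N} {s : State}
    (hW : ∀ i j, mat N s 5 i j = W i j) (u w : Fin N) (hu : s.var 22 = u) (hw : s.var 23 = w)
    (h : BInv N W z s.arr) :
    BInv N W z (sem ω backStep s).arr ∧
      (∀ x : Fin N, s.arr 6 0 x ≠ 0 → (sem ω backStep s).arr 6 0 x ≠ 0) ∧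
      (W u w ≠ 0 → s.arr 6 0 w ≠ 0 → (sem ω backStep s).arr 6 0 u ≠ 0) := by
  by_cases h1 : s.arr 6 0 u ≠ 0
  · have e : sem ω backStep s = s := by
      simp [backStep, sem, Expr.eval, hu, h1]
    rw [e]; exact ⟨h, fun _ h => h, fun _ _ => h1⟩
  push Not at h1
  by_cases h2 : s.arr 6 0 w = 0
  · have e : sem ω backStep s = s := by
      simp [backStep, sem, Expr.eval, hu, hw, h1, h2]
    rw [e]; exact ⟨h, fun _ h => h, fun _ h3 => absurd h2 h3⟩
  by_cases h3 : W u w = 0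
  · have h3' : s.arr 5 u w = 0 := (hW u w).trans h3
    have e : sem ω backStep s = s := by
      simp [backStep, sem, Expr.eval, hu, hw, h1, h2, h3']
    rw [e]; exact ⟨h, fun _ h => h, fun h4 => absurd h3 h4⟩
  have h3' : s.arr 5 u w ≠ 0 := fun h4 => h3 ((hW u w).symm.trans h4)
  set A := (sem ω backStep s).arr with hA
  have e6 : ∀ x : Fin N, A 6 0 x = if x = u then s.arr 6 0 w + 1 else s.arr 6 0 x := by
    intro x
    simp [hA, backStep, sem, Expr.eval, hu, hw, h1, h2, h3', State.setArr_arr, State.setArr_var,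
      Fin.ext_iff]
  have e10 : ∀ x : Fin N, A 10 0 x = if x = u then (w : ℕ) else s.arr 10 0 x := by
    intro x
    simp [hA, backStep, sem, Expr.eval, hu, hw, h1, h2, h3', State.setArr_arr, State.setArr_var,
      Fin.ext_iff]
  have hzu : z ≠ u := fun h4 => by have := h.root; rw [h4, h1] at this; omega
  have hwu : w ≠ u := fun h4 => h2 (h4 ▸ h1)
  have hmono : ∀ x : Fin N, s.arr 6 0 x ≠ 0 → A 6 0 x ≠ 0 := by
    intro x hx
    rw [e6]; split_ifs
    · omega
    · exact hx
  refine ⟨⟨?_, ?_, ?_, ?_⟩, hmono, fun _ _ => by rw [e6, if_pos rfl]; omega⟩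
  · rw [e6, if_neg hzu]; exact h.root
  · intro x hx
    rw [e6] at hx
    split_ifs at hx with hxu
    · rw [hxu]; exact (h.sound w h2).head h3
    · exact h.sound x hx
  · intro x hx hxz
    rw [e6] at hx
    split_ifs at hx with hxu
    · refine ⟨w, ?_, ?_, ?_, ?_⟩
      · rw [e10, if_pos hxu]
      · rw [hxu]; exact h3
      · exact hmono w h2
      · rw [e6, e6, if_pos hxu, if_neg hwu]
    · obtain ⟨y, hy1, hy2, hy3, hy4⟩ := h.next x hx hxz
      have hyu : y ≠ u := fun h4 => hy3 (h4 ▸ h1)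
      exact ⟨y, by rw [e10, if_neg hxu, hy1], hy2, hmono y hy3,
        by rw [e6, e6, if_neg hxu, if_neg hyu, hy4]⟩
  -- A new label exceeds an old one by 1 while the number of labelled vertices grows by 1. Labels
  -- thus stay at most N, which bounds the length of the walks found.
  · have hcard : (Finset.univ.filter fun u : Fin N => s.arr 6 0 u ≠ 0).card + 1 ≤
        (Finset.univ.filter fun u : Fin N => A 6 0 u ≠ 0).card := by
      rw [← Finset.card_insert_of_notMem (a := u) (by simp [h1])]
      refine Finset.card_le_card fun x hx => ?_
      simp only [Finset.mem_insert, Finset.mem_filter, Finset.mem_univ, true_and] at hx ⊢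
      rcases hx with rfl | hx
      · rw [e6, if_pos rfl]; omega
      · exact hmono x hx
    intro x
    rw [e6]
    split_ifs
    · have := h.bound w; omega
    · have := h.bound x; omega

theorem backReach_spec (ω : ℕ → Bool) {N : ℕ} (s : State) (h3 : s.var 3 = N) (h2 : N ≤ s.var 2)
    (z : Fin N) (hz : s.var 20 = z) :
    BInv N (mat N s 5) z (sem ω backReach s).arr ∧
      ∀ u : Fin N, Reach (supp (mat N s 5)) u z → (sem ω backReach s).arr 6 0 u ≠ 0 := by
  set W := mat N s 5 with hW
  rw [backReach, sem_seq, sem_seq]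
  set s₁ := sem ω (loop 22 3 (write 6 (num 0) (v 22) (num 0))) s with hs₁
  have e1 : ∀ p q, s₁.arr 6 p q = if p = 0 ∧ q < N then 0 else s.arr 6 p q :=
    sem_vecLoop rfl h3 h2 0 (fun _ => 0) (by
      intro s₁ i hi hx _ _ _
      constructor
      · simp [sem, State.setArr_arr, Expr.eval, hx]
      · intro p q hpq
        simp only [sem, State.setArr_arr, Expr.eval, hx]
        rw [if_neg (by tauto)])
  have hz1 : s₁.var 20 = z := (sem_var (by decide)).trans hz
  set s₂ := sem ω (write 6 (num 0) (v 20) (num 1)) s₁ with hs₂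
  have e2 : ∀ q : Fin N, s₂.arr 6 0 q = if q = z then 1 else 0 := by
    intro q
    simp [hs₂, sem, State.setArr_arr, Expr.eval, hz1, e1, Fin.ext_iff]
  have hW2 : ∀ i j, mat N s₂ 5 i j = W i j := by
    intro i j
    have h4 : s₂.arr 5 = s₁.arr 5 := sem_arr (by decide)
    have h5 : s₁.arr 5 = s.arr 5 := sem_arr (by decide)
    simp only [mat, hW, h4, h5]
  have h32 : s₂.var 3 = N := ((sem_var (by decide)).trans (sem_var (by decide))).trans h3
  have h22 : s₂.var 2 = s.var 2 := (sem_var (by decide)).trans (sem_var (by decide))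
  have hinv : BInv N W z s₂.arr := by
    refine ⟨by rw [e2]; simp, fun u hu => ?_, fun u hu huz => ?_, fun u => ?_⟩
    · rw [e2] at hu
      have : u = z := by by_contra h; simp [h] at hu
      rw [this]
    · rw [e2] at hu; simp [huz] at hu
    · rw [e2]
      split_ifs with h
      · refine Finset.card_pos.2 ⟨z, ?_⟩
        simp [e2]
      · exact Nat.zero_le _
  have hB : min (s₂.var 3) (s₂.var 2) = N := by omega
  -- A round that labels nothing new shows that the labelled set is closed and the search complete.
  -- Otherwise the number of labelled vertices grows, which cannot happen in each of N rounds
  -- starting from one vertex.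
  have main := loop_inv (ω := ω) (x := 21) (y := 3) (c := loop 22 3 (loop 23 3 backStep))
    (by decide) (fun i s' => BInv N W z s'.arr ∧
      ((∀ u : Fin N, Reach (supp W) u z → s'.arr 6 0 u ≠ 0) ∨
        i + 1 ≤ (Finset.univ.filter fun u : Fin N => s'.arr 6 0 u ≠ 0).card)) s₂
    ⟨hinv, Or.inr (Finset.card_pos.2 ⟨z, by simp [State.setVar_arr, e2]⟩)⟩ (by
    rintro i hi s₃ ⟨hI, hor⟩ hfr -
    rw [State.setVar_arr]
    have hW3 : s₃.arr 5 = s₂.arr 5 := hfr.arr 5 (by decide)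
    have h33 : s₃.var 3 = N := (hfr.var 3 (by decide)).trans h32
    have h23 : s₃.var 2 = s.var 2 := (hfr.var 2 (by decide)).trans h22
    have hB3 : min (s₃.var 3) (s₃.var 2) = N := by omega
    have pass := loop_inv (ω := ω) (x := 22) (y := 3) (c := loop 23 3 backStep) (by decide)
      (fun i s' => BInv N W z s'.arr ∧ (∀ x : Fin N, s₃.arr 6 0 x ≠ 0 → s'.arr 6 0 x ≠ 0) ∧
        ∀ u : Fin N, (u : ℕ) < i → ∀ w : Fin N, W u w ≠ 0 → s₃.arr 6 0 w ≠ 0 → s'.arr 6 0 u ≠ 0) s₃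
      ⟨hI, fun _ h => h, fun u hu => absurd hu (by omega)⟩ (by
      rintro i hi s₄ ⟨hI4, hm4, hp4⟩ hfr4 hx4
      rw [hB3] at hi
      have hW4 : s₄.arr 5 = s₂.arr 5 := (hfr4.arr 5 (by decide)).trans hW3
      have h34 : s₄.var 3 = N := (hfr4.var 3 (by decide)).trans h33
      have h24 : s₄.var 2 = s.var 2 := (hfr4.var 2 (by decide)).trans h23
      have hB4 : min (s₄.var 3) (s₄.var 2) = N := by omega
      have inner := loop_inv (ω := ω) (x := 23) (y := 3) (c := backStep) (by decide)
        (fun j s' => BInv N W z s'.arr ∧ (∀ x : Fin N, s₄.arr 6 0 x ≠ 0 → s'.arr 6 0 x ≠ 0) ∧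
          ∀ w : Fin N, (w : ℕ) < j → W ⟨i, hi⟩ w ≠ 0 → s₃.arr 6 0 w ≠ 0 → s'.arr 6 0 i ≠ 0) s₄
        ⟨hI4, fun _ h => h, fun w hw => absurd hw (by omega)⟩ (by
        rintro j hj s₅ ⟨hI5, hm5, hp5⟩ hfr5 hx5
        rw [hB4] at hj
        have hW5 : ∀ i j, mat N s₅ 5 i j = W i j := fun i j => by
          rw [← hW2]; simp only [mat, hfr5.arr 5 (by decide), hW4]
        obtain ⟨g1, g2, g3⟩ := backStep_spec (ω := ω) hW5 ⟨i, hi⟩ ⟨j, hj⟩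
          ((hfr5.var 22 (by decide)).trans hx4) hx5 hI5
        refine ⟨g1, fun x hx => g2 x (hm5 x hx), fun w hw hWw hw3 => ?_⟩
        rcases Nat.lt_succ_iff_lt_or_eq.1 hw with hw | hw
        · exact g2 ⟨i, hi⟩ (hp5 w hw hWw hw3)
        · have hwj : w = ⟨j, hj⟩ := Fin.ext hw
          subst hwj
          exact g3 hWw (hm5 _ (hm4 _ hw3)))
      rw [hB4] at inner
      obtain ⟨g1, g2, g3⟩ := inner
      refine ⟨g1, fun x hx => g2 x (hm4 x hx), fun u hu w hWw hw3 => ?_⟩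
      rcases Nat.lt_succ_iff_lt_or_eq.1 hu with hu | hu
      · exact g2 u (hp4 u hu w hWw hw3)
      · have hui : u = ⟨i, hi⟩ := Fin.ext hu
        subst hui
        exact g3 w w.2 hWw hw3)
    rw [hB3] at pass
    obtain ⟨g1, g2, g3⟩ := pass
    refine ⟨g1, ?_⟩
    set s₄ := sem ω (loop 22 3 (loop 23 3 backStep)) s₃ with hs₄
    rcases hor with hor | hor
    · exact Or.inl fun u hu => g2 u (hor u hu)
    by_cases hsame : ∀ x : Fin N, s₄.arr 6 0 x ≠ 0 → s₃.arr 6 0 x ≠ 0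
    · left
      intro u hu
      induction hu using Relation.ReflTransGen.head_induction_on with
      | refl => rw [g1.root]; omega
      | @head a c hac _ ih => exact g3 a a.2 c hac (hsame c ih)
    · right
      push Not at hsame
      obtain ⟨x, hx1, hx2⟩ := hsame
      have hlt : (Finset.univ.filter fun u : Fin N => s₃.arr 6 0 u ≠ 0).card <
          (Finset.univ.filter fun u : Fin N => s₄.arr 6 0 u ≠ 0).card := by
        refine Finset.card_lt_card ⟨fun y hy => ?_, fun hsub => ?_⟩
        · simp only [Finset.mem_filter, Finset.mem_univ, true_and] at hy ⊢
          exact g2 y hy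
        · have := hsub (x := x) (by simpa using hx1)
          simp [hx2] at this
      omega)
  rw [hB] at main
  obtain ⟨g1, g2⟩ := main
  refine ⟨g1, g2.resolve_right fun h => ?_⟩
  have := Finset.card_le_univ (Finset.univ.filter fun u : Fin N =>
    (sem ω (loop 21 3 (loop 22 3 (loop 23 3 backStep))) s₂).arr 6 0 u ≠ 0)
  simp only [Fintype.card_fin] at this
  omega

theorem backReach_iff (ω : ℕ → Bool) {N : ℕ} (s : State) (h3 : s.var 3 = N) (h2 : N ≤ s.var 2)
    (z : Fin N) (hz : s.var 20 = z) (u : Fin N) :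
    (sem ω backReach s).arr 6 0 u ≠ 0 ↔ Reach (supp (mat N s 5)) u z :=
  ⟨(backReach_spec ω s h3 h2 z hz).1.sound u, (backReach_spec ω s h3 h2 z hz).2 u⟩

end FP
end ConnCert

namespace ConnCert
namespace FP

theorem mat_setVar (N : ℕ) (s : State) (x y a : ℕ) : mat N (s.setVar x y) a = mat N s a := rfl

/-! ### Maximum flows -/

/-- One step of sending flow along the walk found by the backward search. -/
def pushStep : FP :=
  when (neq (v 24) (v 20))
    (assign 25 (rd 10 (num 0) (v 24)) ;;
      write 5 (v 24) (v 25) (.sub (rd 5 (v 24) (v 25)) (num 1)) ;;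
      write 5 (v 25) (v 24) (.add (rd 5 (v 25) (v 24)) (num 1)) ;;
      assign 24 (v 25))

/-- Send one unit of flow from the vertex in variable 24 to the one in variable 20. -/
def pathPush : FP := loop 26 3 pushStep

/-- Look for a vertex of the source set (array 9) that reaches the target, and push. -/
def augment : FP :=
  backReach ;; assign 24 (v 3) ;;
  loop 27 3 (when (rd 9 (num 0) (v 27)) (when (rd 6 (num 0) (v 27)) (assign 24 (v 27)))) ;;
  when (.sub (v 3) (v 24)) pathPush

/-- Maximum flow for the capacities in array 7; the residual network is left in array 5. -/
def maxFlow : FP := fill 5 29 30 (rd 7 (v 29) (v 30)) ;; loop 28 3 augment ;; backReach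

theorem pushStep_spec {ω : ℕ → Bool} {N : ℕ} {s : State} {x z w : Fin N} (hz : s.var 20 = z)
    (hx : s.var 24 = x) (hxz : x ≠ z) (hw : s.arr 10 0 x = w) (hxw : x ≠ w) :
    (sem ω pushStep s).var 24 = w ∧
      mat N (sem ω pushStep s) 5 = push (mat N s 5) x w := by
  have hne : ((x : ℕ) - z + (z - x)) ≠ 0 := by
    have : (x : ℕ) ≠ z := fun h => hxz (Fin.ext h)
    omega
  have hxw' : (x : ℕ) ≠ w := fun h => hxw (Fin.ext h)
  have hg : (neq (v 24) (v 20)).eval s ≠ 0 := by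
    simpa only [Expr.eval, hx, hz] using hne
  have e : sem ω pushStep s = (((s.setVar 25 w).setArr 5 x w (s.arr 5 x w - 1)).setArr 5 w x
      (s.arr 5 w x + 1)).setVar 24 w := by
    rw [pushStep, when, sem, if_pos hg]
    simp [sem, Expr.eval, hx, hw, State.setArr_var, State.setVar_var,
      State.setVar_arr, State.setArr_arr, hxw'.symm]
  rw [e]
  constructor
  · simp [State.setVar_var]
  · funext i j
    have e1 : ((((s.setVar 25 w).setArr 5 x w (s.arr 5 x w - 1)).setArr 5 w x
        (s.arr 5 w x + 1)).setVar 24 w).arr 5 i j = if (i : ℕ) = w ∧ (j : ℕ) = x then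
        s.arr 5 w x + 1
        else if (i : ℕ) = x ∧ (j : ℕ) = w then s.arr 5 x w - 1 else s.arr 5 i j := by
      simp [State.setVar_arr, State.setArr_arr]
    simp only [mat, e1, push, Fin.ext_iff]
    by_cases h1 : (i : ℕ) = x ∧ (j : ℕ) = w
    · rw [if_neg (by rintro ⟨h2, -⟩; exact hxw' (h1.1.symm.trans h2)), if_pos h1, if_pos h1,
        h1.1, h1.2]
    · by_cases h2 : (i : ℕ) = w ∧ (j : ℕ) = x
      · rw [if_pos h2, if_neg h1, if_pos h2, h2.1, h2.2]
      · simp only [h1, h2, if_false]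

/-- The label drops in each round until the target is reached, and it starts at no more than N, so N
rounds suffice. Once at the target the loop idles. -/
theorem pathPush_spec {ω : ℕ → Bool} {N : ℕ} {s : State} (h3 : s.var 3 = N) (h2 : N ≤ s.var 2)
    {x₀ z : Fin N} (hz : s.var 20 = z) (hx : s.var 24 = x₀) (hB : BInv N (mat N s 5) z s.arr)
    (h0 : s.arr 6 0 x₀ ≠ 0) :
    PushInv (mat N s 5) (fun u : Fin N => s.arr 6 0 u) z x₀ (mat N (sem ω pathPush s) 5) z := by
  have hmin : min (s.var 3) (s.var 2) = N := by omega
  have main := loop_inv (ω := ω) (x := 26) (y := 3) (c := pushStep) (by decide)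
    (fun i s' => ∃ x : Fin N, s'.var 24 = x ∧ s.arr 6 0 x ≠ 0 ∧
      PushInv (mat N s 5) (fun u : Fin N => s.arr 6 0 u) z x₀ (mat N s' 5) x ∧
      (x = z ∨ s.arr 6 0 x + i ≤ s.arr 6 0 x₀)) s
    ⟨x₀, by rw [State.setVar_var, if_neg (by decide), hx], h0, PushInv.refl _ _ _ _, Or.inr le_rfl⟩
    (by
      rintro i hi s₁ ⟨x, hx, hx0, hinv, hor⟩ hfr -
      have hz1 : s₁.var 20 = z := (hfr.var 20 (by decide)).trans hz
      have e10 : s₁.arr 10 = s.arr 10 := hfr.arr 10 (by decide)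
      by_cases hxz : x = z
      · subst hxz
        have e : sem ω pushStep s₁ = s₁ := by
          simp [pushStep, sem, Expr.eval, hx, hz1]
        rw [e]
        exact ⟨x, by rw [State.setVar_var, if_neg (by decide), hx], hx0, hinv, Or.inl rfl⟩
      · obtain ⟨w, hw1, hw2, hw3, hw4⟩ := hB.next x hx0 hxz
        have hxw : x ≠ w := by rintro rfl; omega
        obtain ⟨g1, g2⟩ := pushStep_spec (ω := ω) hz1 hx hxz (by rw [e10, hw1]) hxw
        refine ⟨w, by rw [State.setVar_var, if_neg (by decide), g1], hw3, ?_, Or.inr ?_⟩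
        · have : mat N ((sem ω pushStep s₁).setVar 26 (i + 1)) 5 = push (mat N s₁ 5) x w := g2
          rw [this]
          exact hinv.step hxz (Nat.pos_of_ne_zero hw2) (by
            show s.arr 6 0 _ < s.arr 6 0 _
            omega)
        · have := hor.resolve_left hxz
          omega)
  rw [hmin] at main
  obtain ⟨x, hx, hx0, hinv, hor⟩ := main
  have hxz : x = z := by
    refine hor.resolve_right fun h => ?_
    have h1 := hB.bound x₀
    have h2 := Finset.card_le_univ (Finset.univ.filter fun u : Fin N => s.arr 6 0 u ≠ 0)
    simp only [Fintype.card_fin] at h2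
    omega
  rw [hxz] at hinv
  exact hinv

/-- The value N in variable 24 signals that no source reaches the target. The second alternative
holds for all capacities of which the current state is a residual network, so that it can also be
applied to the current residual network itself. -/
theorem augment_spec {ω : ℕ → Bool} {N : ℕ} {s : State} (h3 : s.var 3 = N) (h2 : N ≤ s.var 2)
    {z : Fin N} (hz : s.var 20 = z) {A : Finset (Fin N)}
    (hA : ∀ u : Fin N, s.arr 9 0 u ≠ 0 ↔ u ∈ A) :
    (Blocked (mat N s 5) A z ∧ mat N (sem ω augment s) 5 = mat N s 5) ∨
      ∀ c m, Resid c A z (mat N s 5) m → Resid c A z (mat N (sem ω augment s) 5) (m + 1) := by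
  rw [augment, sem_seq, sem_seq, sem_seq]
  set s₁ := sem ω backReach s with hs₁
  obtain ⟨hB, hB'⟩ := backReach_spec ω s h3 h2 z hz
  rw [← hs₁] at hB hB'
  set s₂ := sem ω (assign 24 (v 3)) s₁ with hs₂
  have v24 : s₂.var 24 = N := by
    simp [hs₂, sem, Expr.eval, State.setVar_var]
    exact (sem_var (by decide)).trans h3
  have e2 : s₂.arr = s₁.arr := rfl
  have w3 : s₂.var 3 = N := (sem_var (by decide)).trans ((sem_var (by decide)).trans h3)
  have w2 : s₂.var 2 = s.var 2 := (sem_var (by decide)).trans (sem_var (by decide))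
  have w20 : s₂.var 20 = z := (sem_var (by decide)).trans ((sem_var (by decide)).trans hz)
  have hA2 : ∀ u : Fin N, s₂.arr 9 0 u ≠ 0 ↔ u ∈ A := fun u => by
    rw [e2, hs₁, sem_arr (by decide)]; exact hA u
  have hm2 : mat N s₂ 5 = mat N s 5 := by
    funext i j; simp only [mat, e2, hs₁]; rw [sem_arr (by decide)]
  set sel : FP := when (rd 9 (num 0) (v 27)) (when (rd 6 (num 0) (v 27)) (assign 24 (v 27)))
    with hsel
  set s₃ := sem ω (loop 27 3 sel) s₂ with hs₃
  have hmin : min (s₂.var 3) (s₂.var 2) = N := by omega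
  have hfr3 := frame_sem ω (loop 27 3 sel) s₂
  rw [← hs₃] at hfr3
  have hloop := loop_inv (ω := ω) (x := 27) (y := 3) (c := sel) (by decide)
    (fun i s' => (s'.var 24 = N ∧ ∀ u : Fin N, (u : ℕ) < i → u ∈ A → s₁.arr 6 0 u = 0) ∨
      ∃ x : Fin N, s'.var 24 = x ∧ x ∈ A ∧ s₁.arr 6 0 x ≠ 0) s₂
    (Or.inl ⟨by rw [State.setVar_var, if_neg (by decide), v24], fun u hu => absurd hu (by omega)⟩)
    (by
      rintro i hi s' hI hfr hx
      rw [hmin] at hi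
      have a9 : s'.arr 9 = s₂.arr 9 := hfr.arr 9 (by decide)
      have a6 : s'.arr 6 = s₁.arr 6 := (hfr.arr 6 (by decide)).trans (by rw [e2])
      rw [State.setVar_var, if_neg (by decide)]
      by_cases h1 : (⟨i, hi⟩ : Fin N) ∈ A ∧ s₁.arr 6 0 i ≠ 0
      · right
        refine ⟨⟨i, hi⟩, ?_, h1.1, h1.2⟩
        have h4 : s₂.arr 9 0 i ≠ 0 := (hA2 ⟨i, hi⟩).2 h1.1
        simp [hsel, sem, Expr.eval, hx, a9, a6, h4, h1.2, State.setVar_var]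
      · have e : sem ω sel s' = s' := by
          by_cases h4 : s₂.arr 9 0 i = 0
          · simp [hsel, sem, Expr.eval, hx, a9, h4]
          · have h5 : s₁.arr 6 0 i = 0 := by
              by_contra h5; exact h1 ⟨(hA2 ⟨i, hi⟩).1 h4, h5⟩
            simp [hsel, sem, Expr.eval, hx, a9, a6, h4, h5]
        rw [e]
        rcases hI with ⟨hI1, hI2⟩ | hI
        · refine Or.inl ⟨hI1, fun u hu huA => ?_⟩
          rcases Nat.lt_succ_iff_lt_or_eq.1 hu with hu | hu
          · exact hI2 u hu huA
          · by_contra h5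
            refine h1 ⟨?_, by rw [← hu]; exact h5⟩
            rwa [show (⟨i, hi⟩ : Fin N) = u from Fin.ext hu.symm]
        · exact Or.inr hI)
  rw [hmin, ← hs₃] at hloop
  have v3 : s₃.var 3 = N := (hfr3.var 3 (by decide)).trans w3
  have hm3 : mat N s₃ 5 = mat N s 5 := by
    rw [← hm2]; funext i j; simp only [mat]; rw [hfr3.arr 5 (by decide)]
  rcases hloop with ⟨h4, h5⟩ | ⟨x, hx, hxA, hx0⟩
  · left
    have e : sem ω (when (.sub (v 3) (v 24)) pathPush) s₃ = s₃ := by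
      simp [sem, Expr.eval, h4, v3]
    rw [e]
    exact ⟨fun a ha har => hB' a har (h5 a a.2 ha), hm3⟩
  · right
    have e : sem ω (when (.sub (v 3) (v 24)) pathPush) s₃ = sem ω pathPush s₃ := by
      have : N - (x : ℕ) ≠ 0 := by have := x.2; omega
      simp [sem, Expr.eval, hx, v3, this]
    rw [e]
    have e36 : s₃.arr 6 = s₁.arr 6 := hfr3.arr 6 (by decide)
    have e310 : s₃.arr 10 = s₁.arr 10 := hfr3.arr 10 (by decide)
    have hB3 : BInv N (mat N s₃ 5) z s₃.arr := by
      rw [hm3]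
      exact ⟨by rw [e36]; exact hB.root, by rw [e36]; exact hB.sound,
        by rw [e36, e310]; exact hB.next, by rw [e36]; exact hB.bound⟩
    have hp := pathPush_spec (ω := ω) v3 (by rw [hfr3.var 2 (by decide), w2]; exact h2)
      ((hfr3.var 20 (by decide)).trans w20) hx hB3 (by rw [e36]; exact hx0)
    rw [hm3] at hp
    exact fun c m hr => hr.push hxA hp

/-- The flow value never exceeds the cut around `A`, which is below N. After N rounds the flow must
therefore be blocked. -/
theorem maxFlow_spec {ω : ℕ → Bool} {N : ℕ} {s : State} (h3 : s.var 3 = N) (h2 : N ≤ s.var 2)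
    {z : Fin N} (hz : s.var 20 = z) {A : Finset (Fin N)}
    (hA : ∀ u : Fin N, s.arr 9 0 u ≠ 0 ↔ u ∈ A) (hzA : z ∉ A) (hcut : cut (mat N s 7) A < N) :
    ∃ r m, mat N (sem ω maxFlow s) 5 = r ∧ Resid (mat N s 7) A z r m ∧ Blocked r A z ∧
      ∀ u : Fin N, (sem ω maxFlow s).arr 6 0 u ≠ 0 ↔ Reach (supp r) u z := by
  rw [maxFlow, sem_seq, sem_seq]
  set s₁ := sem ω (fill 5 29 30 (rd 7 (v 29) (v 30))) s with hs₁
  have hm1 : mat N s₁ 5 = mat N s 7 := by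
    funext i j
    have := sem_fill (ω := ω) (a := 5) (x := 29) (y := 30) (e := rd 7 (v 29) (v 30)) (by decide)
      (by decide) (by decide) (by decide) (by decide) h3 h2 (fun i j => s.arr 7 i j) (by
        intro s₁ i j hi hj _ ha
        simp [Expr.eval, hi, hj, ha 7 (by decide)]) i j
    simp only [mat, hs₁, this, i.2, j.2, and_self, if_true]
  have hfr1 := frame_sem ω (fill 5 29 30 (rd 7 (v 29) (v 30))) s
  rw [← hs₁] at hfr1
  have w3 : s₁.var 3 = N := (hfr1.var 3 (by decide)).trans h3
  have w2 : s₁.var 2 = s.var 2 := hfr1.var 2 (by decide)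
  have hmin : min (s₁.var 3) (s₁.var 2) = N := by omega
  set s₂ := sem ω (loop 28 3 augment) s₁ with hs₂
  have hfr2 := frame_sem ω (loop 28 3 augment) s₁
  rw [← hs₂] at hfr2
  have hloop := loop_inv (ω := ω) (x := 28) (y := 3) (c := augment) (by decide)
    (fun i s' => ∃ m, Resid (mat N s 7) A z (mat N s' 5) m ∧ (Blocked (mat N s' 5) A z ∨ m = i)) s₁
    ⟨0, by
      have : mat N (s₁.setVar 28 0) 5 = mat N s 7 := hm1
      rw [this]; exact Resid.refl _ _ _, Or.inr rfl⟩ (by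
    rintro i hi s' ⟨m, hres, hor⟩ hfr -
    have hsp := augment_spec (ω := ω) ((hfr.var 3 (by decide)).trans w3)
      (by rw [hfr.var 2 (by decide), w2]; exact h2)
      ((hfr.var 20 (by decide)).trans ((hfr1.var 20 (by decide)).trans hz)) (A := A)
      (by rw [hfr.arr 9 (by decide), hfr1.arr 9 (by decide)]; exact hA)
    simp only [mat_setVar]
    rcases hsp with ⟨h4, h5⟩ | h4
    · rw [h5]; exact ⟨m, hres, Or.inl h4⟩
    · rcases hor with hor | hor
      -- No push occurs once the flow is blocked: it would lower a residual cut that is already 0.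
      · have h5 := (h4 _ _ (Resid.refl _ _ _)).cut_eq _ (hres.isMaxMinCut hor).sub
          (hres.isMaxMinCut hor).notMem
        rw [cut_nonReach] at h5
        omega
      · exact ⟨m + 1, h4 _ _ hres, Or.inr (by rw [hor])⟩)
  rw [hmin, ← hs₂] at hloop
  obtain ⟨m, hres, hor⟩ := hloop
  have hm3 : mat N (sem ω backReach s₂) 5 = mat N s₂ 5 := by
    funext i j; simp only [mat]; rw [sem_arr (by decide)]
  refine ⟨mat N s₂ 5, m, hm3, hres, hor.resolve_right fun h => ?_, fun u => ?_⟩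
  · have := hres.cut_eq A subset_rfl hzA
    omega
  · exact backReach_iff ω s₂ ((hfr2.var 3 (by decide)).trans w3)
      (by rw [hfr2.var 2 (by decide), w2]; exact h2) z
      ((hfr2.var 20 (by decide)).trans ((hfr1.var 20 (by decide)).trans hz)) u

/-! ### Fault-tolerant reachability subgraphs -/

/-- Make the vertices that do not reach the target the new source set. -/
def newSources : FP :=
  loop 29 3 (ite (rd 6 (num 0) (v 29)) (write 9 (num 0) (v 29) (num 0))
    (write 9 (num 0) (v 29) (num 1)))

/-- Double the capacities that leave the new source set. -/
def doubleCaps : FP :=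
  loop 29 3 (loop 30 3 (ite (rd 6 (num 0) (v 29)) skip (when (rd 6 (num 0) (v 30))
    (write 7 (v 29) (v 30) (.add (rd 7 (v 29) (v 30)) (rd 7 (v 29) (v 30)))))))

/-- Replace the source set by the largest minimum cut and double the capacities leaving it. -/
def stage : FP := maxFlow ;; newSources ;; doubleCaps

/-- Delete the edges into the target that carry no flow. -/
def dropUnused : FP :=
  loop 29 3 (ite (.sub (rd 7 (v 29) (v 20)) (rd 5 (v 29) (v 20))) skip
    (write 8 (v 29) (v 20) (num 0)))

/-- Keep only those edges of array 8 into the target that carry flow. -/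
def keepStep : FP := maxFlow ;; dropUnused

theorem newSources_spec {ω : ℕ → Bool} {N : ℕ} {s : State} (h3 : s.var 3 = N)
    (h2 : N ≤ s.var 2) (q : ℕ) (hq : q < N) :
    (sem ω newSources s).arr 9 0 q = if s.arr 6 0 q ≠ 0 then 0 else 1 := by
  have e2 : ∀ p q, (sem ω newSources s).arr 9 p q =
      if p = 0 ∧ q < N then (if s.arr 6 0 q ≠ 0 then 0 else 1) else s.arr 9 p q :=
    sem_vecLoop rfl h3 h2 0 (fun q => if s.arr 6 0 q ≠ 0 then 0 else 1) (by
      intro s' i hi hx _ ha _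
      have a6 : s'.arr 6 = s.arr 6 := ha 6 (by decide)
      by_cases h : s.arr 6 0 i = 0
      · simp only [sem, Expr.eval, hx, a6, h, ne_eq, not_true_eq_false, if_false,
          State.setArr_arr, and_self, if_true, true_and]
        exact fun p q hpq => if_neg (by tauto)
      · simp only [sem, Expr.eval, hx, a6, h, ne_eq, not_false_eq_true,
          State.setArr_arr, and_self, if_true, true_and]
        exact fun p q hpq => if_neg (by tauto))
  rw [e2, if_pos ⟨rfl, hq⟩]

theorem doubleCaps_spec {ω : ℕ → Bool} {N : ℕ} {s : State} (h3 : s.var 3 = N)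
    (h2 : N ≤ s.var 2) (p q : ℕ) (hp : p < N) (hq : q < N) :
    (sem ω doubleCaps s).arr 7 p q = if s.arr 6 0 p = 0 ∧ s.arr 6 0 q ≠ 0 then
      2 * s.arr 7 p q else s.arr 7 p q := by
  have e3 : ∀ p q, (sem ω doubleCaps s).arr 7 p q = if p < N ∧ q < N then
      (if s.arr 6 0 p = 0 ∧ s.arr 6 0 q ≠ 0 then 2 * s.arr 7 p q else s.arr 7 p q)
      else s.arr 7 p q :=
    sem_matLoop (by decide) (by decide) (by decide) (by decide) (by decide) rfl h3 h2
      (fun p q => if s.arr 6 0 p = 0 ∧ s.arr 6 0 q ≠ 0 then 2 * s.arr 7 p q else s.arr 7 p q) (by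
      intro s' i j hi hj hx hy _ ha hij
      have a6 : s'.arr 6 = s.arr 6 := ha 6 (by decide)
      by_cases h4 : s.arr 6 0 i = 0
      · by_cases h5 : s.arr 6 0 j = 0
        · simp only [sem, Expr.eval, hx, hy, a6, h4, h5, hij, ne_eq, not_true_eq_false, if_false,
            and_false, implies_true, and_self]
        · simp only [sem, Expr.eval, hx, hy, a6, h4, h5, hij, ne_eq, not_true_eq_false, if_false,
            not_false_eq_true, and_self, if_true, State.setArr_arr, two_mul, true_and]
          exact fun p q hpq => if_neg (by tauto)
      · simp only [sem, Expr.eval, hx, a6, h4, hij, ne_eq, not_false_eq_true, if_true, false_and,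
          if_false, implies_true, and_self])
  rw [e3, if_pos ⟨hp, hq⟩]

theorem stage_spec {ω : ℕ → Bool} {N : ℕ} {s : State} (h3 : s.var 3 = N) (h2 : N ≤ s.var 2)
    {z : Fin N} (hz : s.var 20 = z) {A : Finset (Fin N)}
    (hA : ∀ u : Fin N, s.arr 9 0 u ≠ 0 ↔ u ∈ A) (hzA : z ∉ A) (hcut : cut (mat N s 7) A < N) :
    ∃ A' : Finset (Fin N), IsMaxMinCut (mat N s 7) z A A' ∧
      (∀ u : Fin N, (sem ω stage s).arr 9 0 u ≠ 0 ↔ u ∈ A') ∧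
      mat N (sem ω stage s) 7 = dbl (mat N s 7) A' := by
  obtain ⟨r, m, -, hres, hb, hr⟩ := maxFlow_spec (ω := ω) h3 h2 hz hA hzA hcut
  refine ⟨nonReach r z, hres.isMaxMinCut hb, ?_⟩
  rw [stage, sem_seq, sem_seq]
  have hfr := frame_sem ω maxFlow s
  generalize sem ω maxFlow s = s₁ at hr hfr ⊢
  have w3 : s₁.var 3 = N := (hfr.var 3 (by decide)).trans h3
  have w2 : N ≤ s₁.var 2 := by rw [hfr.var 2 (by decide)]; exact h2
  have a7 := hfr.arr 7 (by decide)
  have e2 := newSources_spec (ω := ω) w3 w2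
  have hfr2 := frame_sem ω newSources s₁
  generalize sem ω newSources s₁ = s₂ at e2 hfr2 ⊢
  have e3 := doubleCaps_spec (ω := ω) ((hfr2.var 3 (by decide)).trans w3)
    (by rw [hfr2.var 2 (by decide)]; exact w2)
  have a9 := (frame_sem ω doubleCaps s₂).arr 9 (by decide)
  have b6 := hfr2.arr 6 (by decide)
  have b7 := hfr2.arr 7 (by decide)
  constructor
  · intro u
    rw [a9, e2 u u.2, mem_nonReach, ← hr u]
    by_cases h : s₁.arr 6 0 u = 0 <;> simp [h]
  · funext i j
    simp only [mat, e3 i j i.2 j.2, b6, b7, dbl, mem_nonReach, ← hr i, ← hr j, a7, not_not,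
      two_mul, ne_eq]

theorem dropUnused_spec {ω : ℕ → Bool} {N : ℕ} {s : State} (h3 : s.var 3 = N) (h2 : N ≤ s.var 2)
    {z : Fin N} (hz : s.var 20 = z) (p q : ℕ) : (sem ω dropUnused s).arr 8 p q =
      if q = z ∧ p < N ∧ ¬ (s.arr 5 p z < s.arr 7 p z) then 0 else s.arr 8 p q := by
  have hmin : min (s.var 3) (s.var 2) = N := by omega
  have hloop := loop_inv (ω := ω) (x := 29) (y := 3)
    (c := ite (.sub (rd 7 (v 29) (v 20)) (rd 5 (v 29) (v 20))) skip
    (write 8 (v 29) (v 20) (num 0))) (by decide)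
    (fun i s' => ∀ p q, s'.arr 8 p q =
      if q = z ∧ p < i ∧ ¬ (s.arr 5 p z < s.arr 7 p z) then 0 else s.arr 8 p q) s
    (by intro p q; simp [State.setVar_arr]) (by
    intro i hi s' hI hfr hx p q
    rw [State.setVar_arr]
    have b7 : s'.arr 7 = s.arr 7 := hfr.arr 7 (by decide)
    have b5 : s'.arr 5 = s.arr 5 := hfr.arr 5 (by decide)
    have b20 : s'.var 20 = z := (hfr.var 20 (by decide)).trans hz
    have key : ∀ P : Prop, (P ∧ p < i + 1 ∧ ¬ (s.arr 5 p z < s.arr 7 p z)) ↔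
        (P ∧ p < i ∧ ¬ (s.arr 5 p z < s.arr 7 p z)) ∨
          (P ∧ p = i ∧ ¬ (s.arr 5 p z < s.arr 7 p z)) := by
      intro P
      rw [Nat.lt_succ_iff_lt_or_eq]; tauto
    by_cases h : s.arr 5 i z < s.arr 7 i z
    · have : s.arr 7 i z - s.arr 5 i z ≠ 0 := by omega
      simp only [sem, Expr.eval, hx, b20, b7, b5, this, ne_eq, not_false_eq_true, if_true]
      rw [hI]
      refine if_congr ?_ rfl rfl
      rw [key]
      refine (or_iff_left ?_).symm
      rintro ⟨-, rfl, h5⟩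
      exact h5 h
    · have : s.arr 7 i z - s.arr 5 i z = 0 := by omega
      simp only [sem, Expr.eval, hx, b20, b7, b5, this, ne_eq, not_true_eq_false, if_false]
      rw [State.setArr_arr, hI]
      by_cases hpq : p = i ∧ q = z
      · obtain ⟨rfl, rfl⟩ := hpq
        simp [h]
      · rw [if_neg (by tauto)]
        refine if_congr ?_ rfl rfl
        rw [key]
        exact (or_iff_left (by tauto)).symm)
  rw [hmin] at hloop
  exact hloop p q

theorem keepStep_spec {ω : ℕ → Bool} {N : ℕ} {s : State} (h3 : s.var 3 = N) (h2 : N ≤ s.var 2)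
    {z : Fin N} (hz : s.var 20 = z) {A : Finset (Fin N)}
    (hA : ∀ u : Fin N, s.arr 9 0 u ≠ 0 ↔ u ∈ A) (hzA : z ∉ A) (hcut : cut (mat N s 7) A < N) :
    ∃ K : Finset (Fin N), Chain z 0 A (mat N s 7) K ∧
      ∀ u w, mat N (sem ω keepStep s) 8 u w = keep (mat N s 8) z K u w := by
  obtain ⟨r, m, hr5, hres, hb, -⟩ := maxFlow_spec (ω := ω) h3 h2 hz hA hzA hcut
  refine ⟨Finset.univ.filter fun u => r u z < mat N s 7 u z,
    hres.chain_base hb hzA (by simp), ?_⟩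
  rw [keepStep, sem_seq]
  have hfr := frame_sem ω maxFlow s
  generalize sem ω maxFlow s = s₁ at hr5 hfr ⊢
  have hloop := dropUnused_spec (ω := ω) ((hfr.var 3 (by decide)).trans h3)
    (by rw [hfr.var 2 (by decide)]; exact h2) ((hfr.var 20 (by decide)).trans hz)
  have a7 := hfr.arr 7 (by decide)
  have a8 := hfr.arr 8 (by decide)
  intro u w
  have h5 : s₁.arr 5 u z = r u z := by rw [← hr5]; rfl
  rw [mat, hloop u w, keep, h5, a7, a8]
  refine if_congr ?_ rfl rfl
  rw [Finset.mem_filter]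
  simp [mat, Fin.ext_iff]

end FP
end ConnCert

/-! ### Thinning a graph for reachability from one root under faults -/

namespace ConnCert
namespace FP

/-- Capacities: those of array 8, and one more edge from the auxiliary vertex to the root. -/
def initCaps : FP := fill 7 29 30 (rd 8 (v 29) (v 30)) ;; write 7 (v 9) (v 32) (num 1)

/-- Sources: only the auxiliary vertex. -/
def initSources : FP :=
  loop 29 3 (write 9 (num 0) (v 29) (num 0)) ;; write 9 (num 0) (v 9) (num 1)

/-- Thin out the edges into the target. -/
def ftrsStep : FP := initCaps ;; initSources ;; loop 31 4 stage ;; keepStep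

/-- Turns array 8 into a subgraph preserving reachability from the root in variable 32 under
`var 4` faults. -/
def ftrs : FP := loop 20 9 ftrsStep

theorem initCaps_spec {ω : ℕ → Bool} {N : ℕ} {s : State} (h3 : s.var 3 = N) (h2 : N ≤ s.var 2)
    {r₀ r : Fin N} (h9 : s.var 9 = r₀) (h32 : s.var 32 = r) (h1 : ∀ u w, mat N s 8 u w ≤ 1) :
    mat N (sem ω initCaps s) 7 = rootCap (supp (mat N s 8)) r₀ r := by
  rw [initCaps, sem_seq]
  have hm := sem_fill (ω := ω) (a := 7) (x := 29) (y := 30) (e := rd 8 (v 29) (v 30)) (by decide)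
    (by decide) (by decide) (by decide) (by decide) h3 h2 (fun i j => s.arr 8 i j) (by
      intro s₁ i j hi hj _ ha
      simp only [Expr.eval, hi, hj, ha 8 (by decide)])
  have hfr := frame_sem ω (fill 7 29 30 (rd 8 (v 29) (v 30))) s
  generalize sem ω (fill 7 29 30 (rd 8 (v 29) (v 30))) s = s₁ at hm hfr ⊢
  have w9 := (hfr.var 9 (by decide)).trans h9
  have w32 := (hfr.var 32 (by decide)).trans h32
  funext u w
  have h1 := h1 u w
  simp only [mat] at h1
  simp only [mat, sem, Expr.eval, w9, w32, State.setArr_arr, hm, u.2, w.2, and_self, if_true,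
    true_and, rootCap, supp, Fin.ext_iff]
  by_cases h4 : (u : ℕ) = r₀ ∧ (w : ℕ) = r
  · simp [h4]
  · by_cases h5 : s.arr 8 u w = 0
    · simp [h4, h5]
    · simp [h4, h5]; omega

theorem initSources_spec {ω : ℕ → Bool} {N : ℕ} {s : State} (h3 : s.var 3 = N) (h2 : N ≤ s.var 2)
    {r₀ : Fin N} (h9 : s.var 9 = r₀) (u : Fin N) :
    (sem ω initSources s).arr 9 0 u ≠ 0 ↔ u ∈ ({r₀} : Finset (Fin N)) := by
  rw [initSources, sem_seq]
  have hm : ∀ p q, (sem ω (loop 29 3 (write 9 (num 0) (v 29) (num 0))) s).arr 9 p q =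
      if p = 0 ∧ q < N then 0 else s.arr 9 p q :=
    sem_vecLoop rfl h3 h2 0 (fun _ => 0) (by
      intro s₁ i hi hx _ _ _
      simp only [sem, State.setArr_arr, Expr.eval, hx, and_self, if_true, true_and]
      exact fun p q hpq => if_neg (by tauto))
  have hfr := frame_sem ω (loop 29 3 (write 9 (num 0) (v 29) (num 0))) s
  generalize sem ω (loop 29 3 (write 9 (num 0) (v 29) (num 0))) s = s₁ at hm hfr ⊢
  have w9 := (hfr.var 9 (by decide)).trans h9
  simp only [sem, Expr.eval, w9, State.setArr_arr, hm, u.2, and_self, if_true,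
    true_and, Finset.mem_singleton, Fin.ext_iff]
  by_cases h : (u : ℕ) = r₀ <;> simp [h]

theorem stages_spec {ω : ℕ → Bool} {N : ℕ} {s : State} (h3 : s.var 3 = N) (h2 : N ≤ s.var 2)
    {z : Fin N} (hz : s.var 20 = z) {f : ℕ} (h4 : s.var 4 = f) (hf : 2 ^ f < N)
    {A : Finset (Fin N)} (hA : ∀ u : Fin N, s.arr 9 0 u ≠ 0 ↔ u ∈ A) (hzA : z ∉ A)
    (hcut : cut (mat N s 7) A ≤ 1) :
    ∃ A' : Finset (Fin N), (∀ u : Fin N, (sem ω (loop 31 4 stage) s).arr 9 0 u ≠ 0 ↔ u ∈ A') ∧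
      z ∉ A' ∧ cut (mat N (sem ω (loop 31 4 stage) s) 7) A' < N ∧
      ∀ K, Chain z 0 A' (mat N (sem ω (loop 31 4 stage) s) 7) K → Chain z f A (mat N s 7) K := by
  have hmin : min (s.var 4) (s.var 2) = f := by have := f.lt_two_pow_self; omega
  have hloop := loop_inv (ω := ω) (x := 31) (y := 4) (c := stage) (by decide)
    (fun i s' => ∃ A' : Finset (Fin N), (∀ u : Fin N, s'.arr 9 0 u ≠ 0 ↔ u ∈ A') ∧
      z ∉ A' ∧ cut (mat N s' 7) A' ≤ 2 ^ i ∧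
      ∀ j K, Chain z j A' (mat N s' 7) K → Chain z (j + i) A (mat N s 7) K) s
    ⟨A, hA, hzA, by rw [pow_zero]; exact hcut, fun j K h => h⟩ (by
    rintro i hi s' ⟨A', hA', hzA', hc, hch⟩ hfr -
    rw [hmin] at hi
    -- Before round i < f the minimum cut is at most 2^i < 2^f < N, as the maximum flow loop
    -- requires.
    have hlt := Nat.pow_lt_pow_right (a := 2) (by omega) hi
    obtain ⟨A₂, hm, h5, h6⟩ := stage_spec (ω := ω) ((hfr.var 3 (by decide)).trans h3)
      (by rw [hfr.var 2 (by decide)]; exact h2) ((hfr.var 20 (by decide)).trans hz) hA' hzA'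
      (by omega)
    simp only [mat_setVar, State.setVar_arr]
    refine ⟨A₂, h5, hm.notMem, ?_, fun j K hK => ?_⟩
    · rw [h6, cut_dbl, pow_succ]
      have := hm.le A' subset_rfl hzA'
      omega
    · rw [h6] at hK
      have := hch (j + 1) K (Chain.step hm hK)
      rwa [add_assoc, add_comm 1 i] at this)
  rw [hmin] at hloop
  obtain ⟨A', hA', hzA', hc, hch⟩ := hloop
  exact ⟨A', hA', hzA', by omega, fun K hK => by simpa using hch 0 K hK⟩

theorem ftrsStep_spec {ω : ℕ → Bool} {N : ℕ} {s : State} (h3 : s.var 3 = N) (h2 : N ≤ s.var 2)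
    {z r₀ r : Fin N} (hz : s.var 20 = z) (h9 : s.var 9 = r₀) (h32 : s.var 32 = r) {f : ℕ}
    (h4 : s.var 4 = f) (hf : 2 ^ f < N) (hzr : z ≠ r₀) (h1 : ∀ u w, mat N s 8 u w ≤ 1)
    (h0 : ∀ w, mat N s 8 r₀ w = 0) :
    ∃ K : Finset (Fin N), K.card ≤ 2 ^ f ∧
      (∀ F : Finset (Fin N × Fin N), F.card ≤ f → Reach (del (supp (mat N s 8)) F) r z →
        Reach (del (restr (supp (mat N s 8)) z K) F) r z) ∧
      ∀ u w, mat N (sem ω ftrsStep s) 8 u w = keep (mat N s 8) z K u w := by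
  rw [ftrsStep, sem_seq, sem_seq, sem_seq]
  have e1 := initCaps_spec (ω := ω) h3 h2 h9 h32 h1
  have hfr1 := frame_sem ω initCaps s
  generalize sem ω initCaps s = s₁ at e1 hfr1 ⊢
  have e2 := initSources_spec (ω := ω) ((hfr1.var 3 (by decide)).trans h3)
    (by rw [hfr1.var 2 (by decide)]; exact h2) ((hfr1.var 9 (by decide)).trans h9)
  have hfr2 := frame_sem ω initSources s₁
  generalize sem ω initSources s₁ = s₂ at e2 hfr2 ⊢
  have w3 : s₂.var 3 = N := by rw [hfr2.var 3 (by decide), hfr1.var 3 (by decide), h3]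
  have w2 : N ≤ s₂.var 2 := by rw [hfr2.var 2 (by decide), hfr1.var 2 (by decide)]; exact h2
  have w20 : s₂.var 20 = z := by rw [hfr2.var 20 (by decide), hfr1.var 20 (by decide), hz]
  have w4 : s₂.var 4 = f := by rw [hfr2.var 4 (by decide), hfr1.var 4 (by decide), h4]
  have a8 : s₂.arr 8 = s.arr 8 := by rw [hfr2.arr 8 (by decide), hfr1.arr 8 (by decide)]
  have m7 : mat N s₂ 7 = rootCap (supp (mat N s 8)) r₀ r := by
    rw [← e1]; funext u w; simp only [mat, hfr2.arr 7 (by decide)]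
  have hE0 : ∀ w, ¬ supp (mat N s 8) r₀ w := fun w h => h (h0 w)
  have hcut := cut_rootCap_le (r := r) hE0
  obtain ⟨A', hA', hzA', hc, hch⟩ := stages_spec (ω := ω) w3 w2 w20 w4 hf e2 (by simpa using hzr)
    (by rw [m7]; exact hcut)
  have hfr3 := frame_sem ω (loop 31 4 stage) s₂
  generalize sem ω (loop 31 4 stage) s₂ = s₃ at hA' hc hch hfr3 ⊢
  obtain ⟨K, hK, e4⟩ := keepStep_spec (ω := ω) (by rw [hfr3.var 3 (by decide), w3])
    (by rw [hfr3.var 2 (by decide)]; exact w2) (by rw [hfr3.var 20 (by decide), w20]) hA' hzA' hc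
  have hK := hch K hK
  rw [m7] at hK
  refine ⟨K, ?_, fun F hF hr => hK.reach hzr (fun u w => rfl) hE0 F hF hr, ?_⟩
  · refine (hK.card_le {r₀} subset_rfl (by simpa using hzr)).trans ?_
    exact (Nat.mul_le_mul_left _ hcut).trans (by simp)
  · have m8 : mat N s₃ 8 = mat N s 8 := by
      funext u w; simp only [mat, hfr3.arr 8 (by decide), a8]
    rw [← m8]; exact e4

/-- The number of edges of a graph all of whose in-degrees are bounded. -/
theorem card_le_of_inDegree {N D : ℕ} {E : Fin N → Fin N → Prop}
    (h : ∀ w, ∃ K : Finset (Fin N), K.card ≤ D ∧ ∀ u, E u w → u ∈ K)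
    (S : Finset (Fin N × Fin N)) (hS : ∀ e ∈ S, E e.1 e.2) : S.card ≤ N * D := by
  rw [Finset.card_eq_sum_card_fiberwise (f := Prod.snd) (t := Finset.univ) (by simp)]
  refine (Finset.sum_le_card_nsmul _ _ D fun w _ => ?_).trans (by simp)
  obtain ⟨K, hK, hK'⟩ := h w
  refine (Finset.card_le_card_of_injOn Prod.fst ?_ ?_).trans hK
  · intro e he
    simp only [Finset.coe_filter, Set.mem_ofPred_eq] at he
    exact hK' _ (he.2 ▸ hS e he.1)
  · intro e he e' he' hee
    simp only [Finset.coe_filter, Set.mem_ofPred_eq] at he he'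
    exact Prod.ext hee (he.2.trans he'.2.symm)

/-- The targets are thinned one after the other in the same array. Reachability is kept by composing
the steps, and in-degrees already bounded can only shrink. The loop ends before the last vertex, the
auxiliary source, which has no in-edges anyway. -/
theorem ftrs_spec {ω : ℕ → Bool} {N : ℕ} {s : State} (h3 : s.var 3 = N) (h2 : N ≤ s.var 2)
    {r₀ r : Fin N} (h9 : s.var 9 = r₀) (hr₀ : (r₀ : ℕ) + 1 = N) (h32 : s.var 32 = r) {f : ℕ}
    (h4 : s.var 4 = f) (hf : 2 ^ f < N) (h1 : ∀ u w, mat N s 8 u w ≤ 1)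
    (h0 : ∀ w, mat N s 8 r₀ w = 0) (h0' : ∀ w, mat N s 8 w r₀ = 0) :
    (∀ u w, mat N (sem ω ftrs s) 8 u w ≤ mat N s 8 u w) ∧
      (∀ F : Finset (Fin N × Fin N), F.card ≤ f → ∀ w, Reach (del (supp (mat N s 8)) F) r w →
        Reach (del (supp (mat N (sem ω ftrs s) 8)) F) r w) ∧
      ∀ S : Finset (Fin N × Fin N), (∀ e ∈ S, supp (mat N (sem ω ftrs s) 8) e.1 e.2) →
        S.card ≤ N * 2 ^ f := by
  have hmin : min (s.var 9) (s.var 2) = r₀ := by omega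
  have hloop := loop_inv (ω := ω) (x := 20) (y := 9) (c := ftrsStep) (by decide)
    (fun i s' => (∀ u w, mat N s' 8 u w ≤ mat N s 8 u w) ∧
      (∀ F : Finset (Fin N × Fin N), F.card ≤ f → ∀ w, Reach (del (supp (mat N s 8)) F) r w →
        Reach (del (supp (mat N s' 8)) F) r w) ∧
      ∀ w : Fin N, (w : ℕ) < i → ∃ K : Finset (Fin N), K.card ≤ 2 ^ f ∧
        ∀ u, supp (mat N s' 8) u w → u ∈ K) s
    ⟨fun _ _ => le_rfl, fun _ _ _ h => h, fun w hw => absurd hw (by omega)⟩ (by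
    rintro i hi s' ⟨hle, hre, hdeg⟩ hfr hx
    rw [hmin] at hi
    obtain ⟨z, hzi⟩ : ∃ z : Fin N, (z : ℕ) = i := ⟨⟨i, by omega⟩, rfl⟩
    have hz : s'.var 20 = z := hx.trans hzi.symm
    have hzr : z ≠ r₀ := fun h => by
      have := congrArg Fin.val h; omega
    obtain ⟨K, hK, hKF, hKm⟩ := ftrsStep_spec (ω := ω) ((hfr.var 3 (by decide)).trans h3)
      (by rw [hfr.var 2 (by decide)]; exact h2) hz ((hfr.var 9 (by decide)).trans h9)
      ((hfr.var 32 (by decide)).trans h32) ((hfr.var 4 (by decide)).trans h4) hf hzr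
      (fun u w => (hle u w).trans (h1 u w)) (fun w => Nat.le_zero.1 ((hle _ _).trans (h0 w).le))
    have e : mat N (sem ω ftrsStep s') 8 = keep (mat N s' 8) z K := by
      funext u w; exact hKm u w
    simp only [mat_setVar, e]
    have hsupp : ∀ u w, supp (keep (mat N s' 8) z K) u w ↔ restr (supp (mat N s' 8)) z K u w := by
      intro u w
      simp only [supp, keep, restr]
      by_cases h : w = z <;> by_cases h' : u ∈ K <;> simp [h, h']
    have hsupp' : supp (keep (mat N s' 8) z K) = restr (supp (mat N s' 8)) z K := by
      funext u w; exact propext (hsupp u w)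
    refine ⟨fun u w => (keep_le _ _ _ _ _).trans (hle u w), fun F hF w hw => ?_, fun w hw => ?_⟩
    · rw [hsupp']
      exact restr_reach (hKF F hF) (hre F hF w hw)
    · rw [hsupp']
      rcases Nat.lt_succ_iff_lt_or_eq.1 hw with hw | hw
      · obtain ⟨K', hK', hK''⟩ := hdeg w hw
        exact ⟨K', hK', fun u hu => hK'' u hu.1⟩
      · exact ⟨K, hK, fun u hu => hu.2 (Fin.ext (hw.trans hzi.symm))⟩)
  rw [hmin] at hloop
  obtain ⟨hle, hre, hdeg⟩ := hloop
  refine ⟨hle, hre, fun S hS => card_le_of_inDegree (fun w => ?_) S hS⟩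
  by_cases hw : (w : ℕ) < r₀
  · exact hdeg w hw
  · have : w = r₀ := Fin.ext (by omega)
    refine ⟨∅, by simp, fun u hu => absurd ((hle u w).trans ?_) (by
      have : mat N (sem ω ftrs s) 8 u w ≠ 0 := hu
      omega : ¬ mat N (sem ω ftrs s) 8 u w ≤ 0)⟩
    rw [this]; exact (h0' u).le

end FP
end ConnCert

namespace ConnCert
namespace FP

/-! ### Minimal certificates for a single fault -/

/-- Rule for double loops: an invariant `I`, and a property `P` of pairs that persists. -/
theorem pairLoop {ω : ℕ → Bool} {x y bd N : ℕ} {c : FP} {s : State} (hxy : x ≠ y)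
    (hxb : x ≠ bd) (hx2 : x ≠ 2) (hyb : y ≠ bd) (hy2 : y ≠ 2) (hx : x ∉ c.mv) (hy : y ∉ c.mv)
    (hbd : bd ∉ c.mv) (h2c : 2 ∉ c.mv)
    (hb : s.var bd = N) (h2 : N ≤ s.var 2) (I : State → Prop) (P : State → ℕ → ℕ → Prop)
    (hI : ∀ s z a, z = x ∨ z = y → I s → I (s.setVar z a))
    (hP : ∀ s z a p q, z = x ∨ z = y → P s p q → P (s.setVar z a) p q)
    (hs : I s)
    (h : ∀ s₁ i j, i < N → j < N → s₁.var x = i → s₁.var y = j → I s₁ →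
      Frame (loop x bd (loop y bd c)) s s₁ →
      I (sem ω c s₁) ∧ P (sem ω c s₁) i j ∧
        ∀ p q, p < N → q < N → P s₁ p q → P (sem ω c s₁) p q) :
    I (sem ω (loop x bd (loop y bd c)) s) ∧
      ∀ p q, p < N → q < N → P (sem ω (loop x bd (loop y bd c)) s) p q := by
  have hB : min (s.var bd) (s.var 2) = N := by omega
  have := loop_inv (ω := ω) (y := bd) (c := loop y bd c) (x := x) (by simp [mv, hxy, hx])
    (fun i s₁ => I s₁ ∧ ∀ p q, p < i → q < N → P s₁ p q) s
    ⟨hI _ _ _ (Or.inl rfl) hs, fun p q hp => absurd hp (by omega)⟩ (by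
    rintro i hi s₁ ⟨hI₁, hP₁⟩ hfr hxi
    rw [hB] at hi
    have hb₁ : s₁.var bd = N := (hfr.var bd (by simp [mv, hbd, hxb.symm, hyb.symm])).trans hb
    have h2₁ : s₁.var 2 = s.var 2 := hfr.var 2 (by simp [mv, h2c, hx2.symm, hy2.symm])
    have hB₁ : min (s₁.var bd) (s₁.var 2) = N := by omega
    have inner := loop_inv (ω := ω) (y := bd) (c := c) (x := y) hy
      (fun j s₂ => I s₂ ∧ (∀ p q, p < i → q < N → P s₂ p q) ∧ ∀ q, q < j → P s₂ i q) s₁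
      ⟨hI _ _ _ (Or.inr rfl) hI₁, fun p q hp hq => hP _ _ _ _ _ (Or.inr rfl) (hP₁ p q hp hq),
        fun q hq => absurd hq (by omega)⟩ (by
      rintro j hj s₂ ⟨hI₂, hP₂, hQ₂⟩ hfr₂ hyj
      rw [hB₁] at hj
      have hfr₃ : Frame (loop x bd (loop y bd c)) s s₂ :=
        hfr.trans (hfr₂.mono (by simp +contextual [mv]) (by simp [ma]) (by simp [flips]))
      obtain ⟨g1, g2, g3⟩ := h s₂ i j hi hj ((hfr₂.var x (by simp [mv, hx, hxy])).trans hxi) hyj hI₂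
        hfr₃
      refine ⟨hI _ _ _ (Or.inr rfl) g1, fun p q hp hq => hP _ _ _ _ _ (Or.inr rfl)
        (g3 p q (by omega) hq (hP₂ p q hp hq)), fun q hq => hP _ _ _ _ _ (Or.inr rfl) ?_⟩
      rcases Nat.lt_succ_iff_lt_or_eq.1 hq with hq | rfl
      · exact g3 i q hi (by omega) (hQ₂ q hq)
      · exact g2)
    rw [hB₁] at inner
    obtain ⟨g1, g2, g3⟩ := inner
    refine ⟨hI _ _ _ (Or.inl rfl) g1, fun p q hp hq => hP _ _ _ _ _ (Or.inl rfl) ?_⟩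
    rcases Nat.lt_succ_iff_lt_or_eq.1 hp with hp | rfl
    · exact g2 p q hp hq
    · exact g3 q hq)
  rw [hB] at this
  exact this

/-- Does the pair in variables 35, 36 witness that the edge in variables 33, 34 is critical? -/
def critTest : FP :=
  fill 5 29 30 (rd 4 (v 29) (v 30)) ;;
  write 5 (v 35) (v 36) (num 0) ;;
  assign 20 (v 33) ;; backReach ;; assign 38 (rd 6 (num 0) (v 34)) ;;
  write 5 (v 33) (v 34) (num 0) ;;
  assign 20 (v 34) ;; backReach ;;
  when (v 38) (ite (rd 6 (num 0) (v 33)) skip (assign 37 (num 1)))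

/-- Is the edge in variables 33, 34 critical? -/
def critCheck : FP :=
  assign 37 (num 0) ;;
  loop 35 3 (loop 36 3 (ite (.add (neq (v 35) (v 33)) (neq (v 36) (v 34))) critTest skip))

/-- Delete the edge in variables 33, 34 from array 4 unless it is critical. -/
def thinStep : FP :=
  when (rd 4 (v 33) (v 34)) (critCheck ;; ite (v 37) skip (write 4 (v 33) (v 34) (num 0)))

/-- Delete noncritical edges from array 4 one after the other. -/
def thin : FP := loop 33 3 (loop 34 3 thinStep)

theorem supp_setArr {N : ℕ} (s : State) (a : ℕ) (x y : Fin N) :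
    supp (mat N (s.setArr a x y 0) a) = del (supp (mat N s a)) {(x, y)} := by
  funext u w
  simp only [supp, mat, State.setArr_arr, del, Finset.mem_singleton, Prod.mk.injEq, Fin.ext_iff,
    true_and]
  by_cases h : (u : ℕ) = x ∧ (w : ℕ) = y <;> simp [h]

theorem critTest_spec {ω : ℕ → Bool} {N : ℕ} {s : State} (h3 : s.var 3 = N) (h2 : N ≤ s.var 2)
    {x y p q : Fin N} (h33 : s.var 33 = x) (h34 : s.var 34 = y) (h35 : s.var 35 = p)
    (h36 : s.var 36 = q) :
    (Reach (del (supp (mat N s 4)) {(p, q)}) y x ∧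
      ¬ Reach (del (supp (mat N s 4)) {(p, q), (x, y)}) x y → (sem ω critTest s).var 37 = 1) ∧
    (¬ (Reach (del (supp (mat N s 4)) {(p, q)}) y x ∧
      ¬ Reach (del (supp (mat N s 4)) {(p, q), (x, y)}) x y) →
        (sem ω critTest s).var 37 = s.var 37) := by
  rw [critTest]
  simp only [sem_seq]
  have e1 : mat N (sem ω (fill 5 29 30 (rd 4 (v 29) (v 30))) s) 5 = mat N s 4 := by
    funext i j
    have := sem_fill (ω := ω) (a := 5) (x := 29) (y := 30) (e := rd 4 (v 29) (v 30)) (by decide)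
      (by decide) (by decide) (by decide) (by decide) h3 h2 (fun i j => s.arr 4 i j) (by
        intro s₁ i j hi hj _ ha
        simp only [Expr.eval, hi, hj, ha 4 (by decide)]) i j
    rw [mat, this, if_pos ⟨i.2, j.2⟩, mat]
  have hfr1 := frame_sem ω (fill 5 29 30 (rd 4 (v 29) (v 30))) s
  generalize sem ω (fill 5 29 30 (rd 4 (v 29) (v 30))) s = s₁ at e1 hfr1 ⊢
  have g33 := (hfr1.var 33 (by decide)).trans h33
  have g34 := (hfr1.var 34 (by decide)).trans h34
  have g35 := (hfr1.var 35 (by decide)).trans h35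
  have g36 := (hfr1.var 36 (by decide)).trans h36
  have g37 := hfr1.var 37 (by decide)
  have g3 := (hfr1.var 3 (by decide)).trans h3
  have g2 : N ≤ s₁.var 2 := by rw [hfr1.var 2 (by decide)]; exact h2
  have e2 : sem ω (write 5 (v 35) (v 36) (num 0)) s₁ = s₁.setArr 5 p q 0 := by
    simp only [sem, Expr.eval, g35, g36]
  have m2 : supp (mat N (s₁.setArr 5 p q 0) 5) = del (supp (mat N s 4)) {(p, q)} := by
    rw [supp_setArr, e1]
  have v2 : (s₁.setArr 5 p q 0).var = s₁.var := rfl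
  rw [e2]
  generalize s₁.setArr 5 p q 0 = s₂ at m2 v2 ⊢
  have e3 : sem ω (assign 20 (v 33)) s₂ = s₂.setVar 20 x := by
    simp only [sem, Expr.eval, v2, g33]
  rw [e3]
  have r3 := backReach_iff ω (s₂.setVar 20 x) (N := N)
    (by rw [State.setVar_var, if_neg (by decide), v2, g3])
    (by rw [State.setVar_var, if_neg (by decide), v2]; exact g2) x
    (by rw [State.setVar_var, if_pos rfl]) y
  rw [mat_setVar, m2] at r3
  have hfr4 := frame_sem ω backReach (s₂.setVar 20 x)
  generalize sem ω backReach (s₂.setVar 20 x) = s₄ at r3 hfr4 ⊢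
  have k : ∀ z, z ∉ backReach.mv → z ≠ 20 → s₄.var z = s₁.var z := fun z hz hz' => by
    rw [hfr4.var z hz, State.setVar_var, if_neg hz', v2]
  have m4 : mat N s₄ 5 = mat N s₂ 5 := by
    funext u w; simp only [mat, hfr4.arr 5 (by decide), State.setVar_arr]
  generalize hb : s₄.arr 6 0 y = b at r3
  have e5 : sem ω (write 5 (v 33) (v 34) (num 0)) (sem ω (assign 38 (rd 6 (num 0) (v 34))) s₄) =
      (s₄.setVar 38 b).setArr 5 x y 0 := by
    simp only [sem, Expr.eval, State.setVar_var, k 33 (by decide) (by decide),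
      k 34 (by decide) (by decide), g33, g34, hb]
    rfl
  rw [e5]
  have m5 : supp (mat N ((s₄.setVar 38 b).setArr 5 x y 0) 5) =
      del (supp (mat N s 4)) {(p, q), (x, y)} := by
    rw [supp_setArr, mat_setVar, m4, m2]
    funext u w
    simp only [del, Finset.mem_insert, Finset.mem_singleton, not_or, and_assoc]
  have v5 : ((s₄.setVar 38 b).setArr 5 x y 0).var = (s₄.setVar 38 b).var := rfl
  generalize (s₄.setVar 38 b).setArr 5 x y 0 = s₅ at m5 v5 ⊢
  have k5 : ∀ z, z ∉ backReach.mv → z ≠ 20 → z ≠ 38 → s₅.var z = s₁.var z := fun z hz hz' hz2 => by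
    rw [v5, State.setVar_var, if_neg hz2, k z hz hz']
  have b5 : s₅.var 38 = b := by rw [v5, State.setVar_var, if_pos rfl]
  have e6 : sem ω (assign 20 (v 34)) s₅ = s₅.setVar 20 y := by
    simp only [sem, Expr.eval, k5 34 (by decide) (by decide) (by decide), g34]
  rw [e6]
  have r6 := backReach_iff ω (s₅.setVar 20 y) (N := N)
    (by rw [State.setVar_var, if_neg (by decide), k5 3 (by decide) (by decide) (by decide), g3])
    (by rw [State.setVar_var, if_neg (by decide), k5 2 (by decide) (by decide) (by decide)]
        exact g2) y
    (by rw [State.setVar_var, if_pos rfl]) x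
  rw [mat_setVar, m5] at r6
  have hfr6 := frame_sem ω backReach (s₅.setVar 20 y)
  generalize sem ω backReach (s₅.setVar 20 y) = s₆ at r6 hfr6 ⊢
  have k6 : ∀ z, z ∉ backReach.mv → z ≠ 20 → s₆.var z = s₅.var z := fun z hz hz' => by
    rw [hfr6.var z hz, State.setVar_var, if_neg hz']
  have v38 : s₆.var 38 = b := by rw [k6 38 (by decide) (by decide), b5]
  have v33 : s₆.var 33 = x := by
    rw [k6 33 (by decide) (by decide), k5 33 (by decide) (by decide) (by decide), g33]
  have v37 : s₆.var 37 = s.var 37 := by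
    rw [k6 37 (by decide) (by decide), k5 37 (by decide) (by decide) (by decide), g37]
  rw [← r3, ← r6]
  constructor
  · rintro ⟨h4, h5⟩
    push Not at h5
    simp only [sem, Expr.eval, v38, v33, h4, h5, ne_eq, not_false_eq_true, not_true_eq_false,
      if_true, if_false, State.setVar_var]
  · intro h4
    by_cases h5 : b = 0
    · simp only [sem, Expr.eval, v38, h5, ne_eq, not_true_eq_false, if_false, v37]
    · have h6 : s₆.arr 6 0 x ≠ 0 := by tauto
      simp only [sem, Expr.eval, v38, v33, h5, h6, ne_eq, not_false_eq_true, if_true, v37]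

theorem critCheck_spec {ω : ℕ → Bool} {N : ℕ} {s : State} (h3 : s.var 3 = N) (h2 : N ≤ s.var 2)
    {x y : Fin N} (h33 : s.var 33 = x) (h34 : s.var 34 = y) :
    (sem ω critCheck s).var 37 ≠ 0 ↔ Crit (supp (mat N s 4)) (x, y) := by
  rw [critCheck, sem_seq]
  have e1 : sem ω (assign 37 (num 0)) s = s.setVar 37 0 := rfl
  rw [e1]
  set Γ := supp (mat N s 4) with hΓ
  have hv : ∀ z, z ≠ 37 → (s.setVar 37 0).var z = s.var z := fun z hz => by
    rw [State.setVar_var, if_neg hz]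
  have h37 : (s.setVar 37 0).var 37 = 0 := by rw [State.setVar_var, if_pos rfl]
  have hm : mat N (s.setVar 37 0) 4 = mat N s 4 := rfl
  generalize s.setVar 37 0 = s₁ at hv h37 hm ⊢
  have main := pairLoop (ω := ω) (x := 35) (y := 36) (bd := 3) (N := N)
    (c := ite (.add (neq (v 35) (v 33)) (neq (v 36) (v 34))) critTest skip) (s := s₁)
    (by decide) (by decide) (by decide) (by decide) (by decide) (by decide) (by decide) (by decide)
    (by decide) ((hv 3 (by decide)).trans h3) (by rw [hv 2 (by decide)]; exact h2)
    (fun s' => s'.var 37 ≠ 0 → Crit Γ (x, y))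
    (fun s' p q => ∀ p' q' : Fin N, (p' : ℕ) = p → (q' : ℕ) = q → (p', q') ≠ (x, y) →
      Reach (del Γ {(p', q')}) y x → ¬ Reach (del Γ {(p', q'), (x, y)}) x y → s'.var 37 ≠ 0)
    (by
      rintro s' z a hz h h'
      rw [State.setVar_var, if_neg (by rcases hz with rfl | rfl <;> decide)] at h'
      exact h h')
    (by
      rintro s' z a p q hz h p' q' h4 h5 h6 h7 h8
      rw [State.setVar_var, if_neg (by rcases hz with rfl | rfl <;> decide)]
      exact h p' q' h4 h5 h6 h7 h8)
    (fun h => absurd h37 h)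
    (by
      intro s' i j hi hj h35 h36 hI hfr
      obtain ⟨p, rfl⟩ : ∃ p : Fin N, (p : ℕ) = i := ⟨⟨i, hi⟩, rfl⟩
      obtain ⟨q, rfl⟩ : ∃ q : Fin N, (q : ℕ) = j := ⟨⟨j, hj⟩, rfl⟩
      have g33 : s'.var 33 = x := by rw [hfr.var 33 (by decide), hv 33 (by decide), h33]
      have g34 : s'.var 34 = y := by rw [hfr.var 34 (by decide), hv 34 (by decide), h34]
      have g3 : s'.var 3 = N := by rw [hfr.var 3 (by decide), hv 3 (by decide), h3]
      have g2 : N ≤ s'.var 2 := by rw [hfr.var 2 (by decide), hv 2 (by decide)]; exact h2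
      have gm : supp (mat N s' 4) = Γ := by
        rw [hΓ, ← hm]; congr 1; funext u w; simp only [mat, hfr.arr 4 (by decide)]
      by_cases hpq : (p, q) = (x, y)
      · have hpq' : p = x ∧ q = y := by simpa using hpq
        have e : sem ω (ite (.add (neq (v 35) (v 33)) (neq (v 36) (v 34))) critTest skip) s' = s' := by
          rw [sem, if_neg (by simp [Expr.eval, h35, h36, g33, g34, hpq'.1, hpq'.2]), sem]
        rw [e]
        refine ⟨hI, ?_, fun _ _ _ _ h => h⟩
        intro p' q' h4 h5 h6
        rw [Fin.ext h4, Fin.ext h5] at h6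
        exact absurd hpq h6
      · have hg : (Expr.add (neq (v 35) (v 33)) (neq (v 36) (v 34))).eval s' ≠ 0 := by
          simp only [Expr.eval, h35, h36, g33, g34]
          intro h
          apply hpq
          rw [Prod.mk.injEq, Fin.ext_iff, Fin.ext_iff]
          omega
        rw [sem, if_pos hg]
        obtain ⟨t1, t2⟩ := critTest_spec (ω := ω) g3 g2 g33 g34 h35 h36
        rw [gm] at t1 t2
        by_cases hc : Reach (del Γ {(p, q)}) y x ∧ ¬ Reach (del Γ {(p, q), (x, y)}) x y
        · have := t1 hc
          refine ⟨fun _ => ⟨(p, q), hpq, hc⟩, fun _ _ _ _ _ _ _ => by omega,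
            fun _ _ _ _ _ _ _ _ _ _ _ _ => by omega⟩
        · have := t2 hc
          rw [this]
          refine ⟨hI, ?_, fun _ _ _ _ h => h⟩
          intro p' q' h4 h5 _ h7 h8
          rw [Fin.ext h4, Fin.ext h5] at h7 h8
          exact absurd ⟨h7, h8⟩ hc)
  refine ⟨main.1, ?_⟩
  rintro ⟨⟨p, q⟩, hg, h4, h5⟩
  exact main.2 p q p.2 q.2 p q rfl rfl hg h4 h5

theorem thinStep_spec {ω : ℕ → Bool} {N : ℕ} {s : State} (h3 : s.var 3 = N) (h2 : N ≤ s.var 2)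
    {x y : Fin N} (h33 : s.var 33 = x) (h34 : s.var 34 = y) :
    (supp (mat N s 4) x y → Crit (supp (mat N s 4)) (x, y)) ∧
        mat N (sem ω thinStep s) 4 = mat N s 4 ∨
      ¬ Crit (supp (mat N s 4)) (x, y) ∧
        supp (mat N (sem ω thinStep s) 4) = del (supp (mat N s 4)) {(x, y)} := by
  have hc := critCheck_spec (ω := ω) h3 h2 h33 h34
  by_cases h : s.arr 4 x y = 0
  · left
    refine ⟨fun h' => absurd h h', ?_⟩
    rw [thinStep, when, sem, if_neg (by simp [Expr.eval, h33, h34, h]), sem]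
  · rw [thinStep, when, sem, if_pos (by simp [Expr.eval, h33, h34, h]), sem_seq]
    have hfr := frame_sem ω critCheck s
    generalize sem ω critCheck s = s₁ at hc hfr ⊢
    have hm : mat N s₁ 4 = mat N s 4 := by
      funext u w; simp only [mat, hfr.arr 4 (by decide)]
    have g33 := (hfr.var 33 (by decide)).trans h33
    have g34 := (hfr.var 34 (by decide)).trans h34
    by_cases h37 : s₁.var 37 = 0
    · right
      refine ⟨fun h' => hc.2 h' h37, ?_⟩
      rw [sem, if_neg (by simp [Expr.eval, h37])]
      simp only [sem, Expr.eval, g33, g34]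
      rw [supp_setArr, hm]
    · left
      refine ⟨fun _ => hc.1 h37, ?_⟩
      rw [sem, if_pos (by simp [Expr.eval, h37]), sem, hm]

/-- A single pass leaves only critical edges, because an edge found critical remains so under all
later deletions (`Crit.of_FT1`). -/
theorem thin_spec {ω : ℕ → Bool} {N : ℕ} {s : State} (h3 : s.var 3 = N) (h2 : N ≤ s.var 2) :
    (∀ u w, supp (mat N (sem ω thin s) 4) u w → supp (mat N s 4) u w) ∧
      FT1 (supp (mat N s 4)) (supp (mat N (sem ω thin s) 4)) ∧
      ∀ u w, supp (mat N (sem ω thin s) 4) u w →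
        Crit (supp (mat N (sem ω thin s) 4)) (u, w) := by
  have main := pairLoop (ω := ω) (x := 33) (y := 34) (bd := 3) (N := N) (c := thinStep) (s := s)
    (by decide) (by decide) (by decide) (by decide) (by decide) (by decide) (by decide) (by decide)
    (by decide) h3 h2
    (fun s' => (∀ u w, supp (mat N s' 4) u w → supp (mat N s 4) u w) ∧
      FT1 (supp (mat N s 4)) (supp (mat N s' 4)))
    (fun s' p q => ∀ p' q' : Fin N, (p' : ℕ) = p → (q' : ℕ) = q → supp (mat N s' 4) p' q' →
      Crit (supp (mat N s' 4)) (p', q'))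
    (fun s' z a _ h => by simpa only [mat_setVar] using h)
    (fun s' z a p q _ h => by simpa only [mat_setVar] using h)
    ⟨fun _ _ h => h, FT1.refl _⟩
    (by
      rintro s' i j hi hj h33 h34 ⟨hI, hI'⟩ hfr
      obtain ⟨x, rfl⟩ : ∃ p : Fin N, (p : ℕ) = i := ⟨⟨i, hi⟩, rfl⟩
      obtain ⟨y, rfl⟩ : ∃ q : Fin N, (q : ℕ) = j := ⟨⟨j, hj⟩, rfl⟩
      rcases thinStep_spec (ω := ω) ((hfr.var 3 (by decide)).trans h3)
        (by rw [hfr.var 2 (by decide)]; exact h2) h33 h34 with ⟨h4, h5⟩ | ⟨h4, h5⟩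
      · rw [h5]
        refine ⟨⟨hI, hI'⟩, ?_, fun _ _ _ _ h => h⟩
        intro p' q' hp hq hh
        rw [Fin.ext hp, Fin.ext hq] at hh ⊢
        exact h4 hh
      · rw [h5]
        refine ⟨⟨fun u w h => hI u w h.1, hI'.trans (FT1.del h4)⟩, ?_, ?_⟩
        · intro p' q' hp hq hh
          rw [Fin.ext hp, Fin.ext hq] at hh
          exact absurd hh.2 (by simp)
        · intro p q _ _ hpq p' q' hp hq hh
          exact (hpq p' q' hp hq hh.1).of_FT1 (fun u w h => h.1) (FT1.del h4) hh.1)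
  exact ⟨main.1.1, main.1.2, fun u w => main.2 u w u.2 w.2 u w rfl rfl⟩

end FP
end ConnCert

namespace ConnCert
namespace FP

/-! ### Random faults and random roots -/

/-- Variable 45 tells whether the next `var 6` coins all show heads. -/
def sampleBit : FP :=
  assign 45 (num 1) ;; loop 43 6 (flip 44 ;; ite (v 44) skip (assign 45 (num 0)))

/-- Copy an entry from array 2 to array 4 unless it is sampled as a fault. -/
def sampleCell : FP :=
  sampleBit ;;
  ite (v 45) (write 4 (v 41) (v 42) (num 0)) (write 4 (v 41) (v 42) (rd 2 (v 41) (v 42)))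

/-- Array 4 becomes array 2 without a random set of faults. -/
def sample : FP := loop 41 3 (loop 42 3 sampleCell)

/-- Mark in array 3 the entries at which the expression does not vanish. -/
def merge (e : Expr) : FP :=
  loop 29 3 (loop 30 3 (when e (write 3 (v 29) (v 30) (num 1))))

/-- Add a sparse certificate for a random set of faults. -/
def sampleRound : FP := sample ;; thin ;; merge (rd 4 (v 29) (v 30))

/-- A random number of `var 5` bits. -/
def randomRoot : FP :=
  assign 32 (num 0) ;; loop 43 5 (flip 44 ;; assign 32 (.add (.add (v 32) (v 32)) (v 44)))

/-- Add sparse subgraphs for reachability from and to the root. -/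
def rootEdges : FP :=
  fill 8 29 30 (rd 2 (v 29) (v 30)) ;; ftrs ;; merge (rd 8 (v 29) (v 30)) ;;
  fill 8 29 30 (rd 2 (v 30) (v 29)) ;; ftrs ;; merge (rd 8 (v 30) (v 29))

/-- Add sparse subgraphs for reachability from and to a random root. -/
def rootRound : FP := randomRoot ;; when (.sub (v 9) (v 32)) rootEdges

theorem sampleBit_spec {ω : ℕ → Bool} {s : State} {a : ℕ} (h6 : s.var 6 = a) (h2 : a ≤ s.var 2) :
    (sem ω sampleBit s).used = s.used + a ∧
      ((sem ω sampleBit s).var 45 ≠ 0 ↔ AllHeads ω s.used a) := by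
  rw [sampleBit, sem_seq]
  have e : sem ω (assign 45 (num 1)) s = s.setVar 45 1 := rfl
  rw [e]
  have hmin : min ((s.setVar 45 1).var 6) ((s.setVar 45 1).var 2) = a := by
    rw [State.setVar_var, State.setVar_var, if_neg (by decide), if_neg (by decide)]; omega
  have main := loop_inv (ω := ω) (x := 43) (y := 6)
    (c := flip 44 ;; ite (v 44) skip (assign 45 (num 0))) (by decide)
    (fun i s' => s'.used = s.used + i ∧ (s'.var 45 ≠ 0 ↔ AllHeads ω s.used i)) (s.setVar 45 1)
    ⟨rfl, by simp [State.setVar_var, AllHeads]⟩ (by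
    rintro i - s₁ ⟨hu, hv⟩ - -
    have hall : AllHeads ω s.used (i + 1) ↔ AllHeads ω s.used i ∧ ω s₁.used = true := by
      rw [hu, AllHeads, AllHeads]
      constructor
      · exact fun h => ⟨fun l hl => h l (by omega), h i (by omega)⟩
      · rintro ⟨h, h'⟩ l hl
        rcases Nat.lt_succ_iff_lt_or_eq.1 hl with hl | rfl
        · exact h l hl
        · exact h'
    rw [hall, ← hv]
    have hadd : s₁.used + 1 = s.used + (i + 1) := by omega
    by_cases hω : ω s₁.used = true
    · simp [sem, State.flip, Expr.eval, State.setVar_var, State.setVar_used, hω, hadd]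
    · simp [sem, State.flip, Expr.eval, State.setVar_var, State.setVar_used, hω, hadd])
  rw [hmin] at main
  exact main

open Classical in
theorem sampleCell_spec {ω : ℕ → Bool} {s : State} {a i j : ℕ} (h6 : s.var 6 = a)
    (h2 : a ≤ s.var 2) (h41 : s.var 41 = i) (h42 : s.var 42 = j) :
    (sem ω sampleCell s).used = s.used + a ∧
      (sem ω sampleCell s).arr 4 i j = (if AllHeads ω s.used a then 0 else s.arr 2 i j) ∧
      ∀ p q, (p ≠ i ∨ q ≠ j) → (sem ω sampleCell s).arr 4 p q = s.arr 4 p q := by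
  rw [sampleCell, sem_seq]
  obtain ⟨h4, h5⟩ := sampleBit_spec (ω := ω) h6 h2
  have hfr := frame_sem ω sampleBit s
  generalize sem ω sampleBit s = s₁ at h4 h5 hfr ⊢
  have g41 := (hfr.var 41 (by decide)).trans h41
  have g42 := (hfr.var 42 (by decide)).trans h42
  have a2 := hfr.arr 2 (by decide)
  have a4 := hfr.arr 4 (by decide)
  by_cases h : s₁.var 45 = 0
  · have h' : ¬ AllHeads ω s.used a := fun h' => h5.2 h' h
    rw [sem, if_neg (by simp [Expr.eval, h]), if_neg h']
    simp only [sem, Expr.eval, g41, g42, State.setArr_used, State.setArr_arr, h4, a2, a4, and_self,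
      if_true, true_and]
    exact fun p q hpq => if_neg (by tauto)
  · have h' : AllHeads ω s.used a := h5.1 h
    rw [sem, if_pos (by simp [Expr.eval, h]), if_pos h']
    simp only [sem, Expr.eval, g41, g42, State.setArr_used, State.setArr_arr, h4, a4, and_self,
      if_true, true_and]
    exact fun p q hpq => if_neg (by tauto)

open Classical in
theorem sample_spec {ω : ℕ → Bool} {N : ℕ} {s : State} {a : ℕ} (h3 : s.var 3 = N)
    (h2 : N ≤ s.var 2) (h6 : s.var 6 = a) (ha : a ≤ s.var 2) :
    (sem ω sample s).used = s.used + N * N * a ∧ ∀ u w : Fin N,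
      mat N (sem ω sample s) 4 u w =
        if AllHeads ω (s.used + pairPos a (u, w)) a then 0 else mat N s 2 u w := by
  have hmin : min (s.var 3) (s.var 2) = N := by omega
  have main := loop_inv (ω := ω) (x := 41) (y := 3) (c := loop 42 3 sampleCell) (by decide)
    (fun i s' => s'.used = s.used + i * N * a ∧ ∀ p q, p < i → q < N → s'.arr 4 p q =
      if AllHeads ω (s.used + (p * N + q) * a) a then 0 else s.arr 2 p q) s
    ⟨by simp [State.setVar_used], fun p q hp => absurd hp (by omega)⟩ (by
    rintro i - s₁ ⟨hu, hI⟩ hfr hx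
    have g3 : s₁.var 3 = N := (hfr.var 3 (by decide)).trans h3
    have g2 := hfr.var 2 (by decide)
    have hmin₁ : min (s₁.var 3) (s₁.var 2) = N := by omega
    have inner := loop_inv (ω := ω) (x := 42) (y := 3) (c := sampleCell) (by decide)
      (fun j s' => s'.used = s.used + (i * N + j) * a ∧ (∀ p q, p < i → q < N → s'.arr 4 p q =
        if AllHeads ω (s.used + (p * N + q) * a) a then 0 else s.arr 2 p q) ∧
        ∀ q, q < j → s'.arr 4 i q =
          if AllHeads ω (s.used + (i * N + q) * a) a then 0 else s.arr 2 i q) s₁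
      ⟨by simp [State.setVar_used, hu], hI, fun q hq => absurd hq (by omega)⟩ (by
      rintro j hj s₂ ⟨hu₂, hI₂, hJ₂⟩ hfr₂ hy
      obtain ⟨t1, t2, t3⟩ := sampleCell_spec (ω := ω) (s := s₂) (a := a) (i := i) (j := j)
        (by rw [hfr₂.var 6 (by decide), hfr.var 6 (by decide), h6])
        (by rw [hfr₂.var 2 (by decide), g2]; exact ha)
        (by rw [hfr₂.var 41 (by decide), hx]) hy
      simp only [State.setVar_used, State.setVar_arr]
      refine ⟨by rw [t1, hu₂]; ring, fun p q hp hq => ?_, fun q hq => ?_⟩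
      · rw [t3 p q (Or.inl (by omega)), hI₂ p q hp hq]
      · rcases Nat.lt_succ_iff_lt_or_eq.1 hq with hq | rfl
        · rw [t3 i q (Or.inr (by omega)), hJ₂ q hq]
        · rw [t2, hu₂, hfr₂.arr 2 (by decide), hfr.arr 2 (by decide)])
    rw [hmin₁] at inner
    obtain ⟨t1, t2, t3⟩ := inner
    simp only [State.setVar_used, State.setVar_arr]
    refine ⟨by rw [t1]; ring, fun p q hp hq => ?_⟩
    rcases Nat.lt_succ_iff_lt_or_eq.1 hp with hp | rfl
    · exact t2 p q hp hq
    · exact t3 q hq)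
  rw [hmin] at main
  exact ⟨main.1, fun u w => main.2 u w u.2 w.2⟩

theorem merge_spec {ω : ℕ → Bool} {N : ℕ} {e : Expr} {s : State} (h3 : s.var 3 = N)
    (h2 : N ≤ s.var 2) (val : ℕ → ℕ → ℕ)
    (h : ∀ s₁ i j, s₁.var 29 = i → s₁.var 30 = j → (∀ a, a ≠ 3 → s₁.arr a = s.arr a) →
      e.eval s₁ = val i j) (u w : Fin N) :
    supp (mat N (sem ω (merge e) s) 3) u w ↔ supp (mat N s 3) u w ∨ val u w ≠ 0 := by
  have := sem_matLoop (ω := ω) (a := 3) (x := 29) (y := 30) (bd := 3)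
    (c := when e (write 3 (v 29) (v 30) (num 1))) (by decide)
    (by decide) (by decide) (by decide) (by decide) rfl h3 h2
    (fun p q => if val p q ≠ 0 then 1 else s.arr 3 p q) (by
      intro s₁ i j hi hj hx hy hv ha hij
      have he := h s₁ i j hx hy fun a' ha' => ha a' (by simp [ma, ha'])
      by_cases hv : val i j = 0
      · rw [when, sem, if_neg (by rw [he, hv]; simp), sem, if_neg (by simp [hv])]
        exact ⟨hij, fun _ _ _ => rfl⟩
      · rw [when, sem, if_pos (by rw [he]; exact hv), if_pos hv]
        simp only [sem, Expr.eval, State.setArr_arr, hx, hy, and_self, if_true, true_and]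
        exact fun p q hpq => if_neg (by tauto)) u w
  simp only [supp, mat, merge, this, u.2, w.2, and_self, if_true]
  by_cases hv : val u w = 0 <;> simp [hv]

open Classical in
/-- The set of faults read off the coins from position `p` on. -/
noncomputable def faults (N : ℕ) (ω : ℕ → Bool) (p a : ℕ) : Finset (Fin N × Fin N) :=
  Finset.univ.filter fun e => AllHeads ω (p + pairPos a e) a

theorem mem_faults {N : ℕ} {ω : ℕ → Bool} {p a : ℕ} {e : Fin N × Fin N} :
    e ∈ faults N ω p a ↔ AllHeads ω (p + pairPos a e) a := by simp [faults]

theorem sampleRound_spec {ω : ℕ → Bool} {N : ℕ} {s : State} {a : ℕ} {r₀ : Fin N}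
    (h3 : s.var 3 = N) (h2 : N ≤ s.var 2) (h6 : s.var 6 = a) (ha : a ≤ s.var 2)
    (h0 : ∀ w, mat N s 2 r₀ w = 0) (h0' : ∀ w, mat N s 2 w r₀ = 0) :
    (sem ω sampleRound s).used = s.used + N * N * a ∧ ∃ Γ : Fin N → Fin N → Prop,
      FT1 (del (supp (mat N s 2)) (faults N ω s.used a)) Γ ∧
      (∀ u w, Γ u w → del (supp (mat N s 2)) (faults N ω s.used a) u w) ∧
      (∃ S : Finset (Fin N × Fin N), S.card ≤ 32 * N * (Nat.log 2 N + 1) ∧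
        ∀ u w, Γ u w → (u, w) ∈ S) ∧
      ∀ u w, supp (mat N (sem ω sampleRound s) 3) u w ↔ supp (mat N s 3) u w ∨ Γ u w := by
  classical
  rw [sampleRound, sem_seq, sem_seq]
  obtain ⟨hu, hm⟩ := sample_spec (ω := ω) h3 h2 h6 ha
  have hfr := frame_sem ω sample s
  generalize sem ω sample s = s₁ at hu hm hfr ⊢
  have hE : supp (mat N s₁ 4) = del (supp (mat N s 2)) (faults N ω s.used a) := by
    funext u w
    simp only [supp, hm, del, mem_faults]
    by_cases h : AllHeads ω (s.used + pairPos a (u, w)) a <;> simp [h]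
  have g3 : s₁.var 3 = N := (hfr.var 3 (by decide)).trans h3
  have g2 : N ≤ s₁.var 2 := by rw [hfr.var 2 (by decide)]; exact h2
  obtain ⟨t1, t2, t3⟩ := thin_spec (ω := ω) g3 g2
  have hfr₂ := frame_sem ω thin s₁
  generalize sem ω thin s₁ = s₂ at t1 t2 t3 hfr₂ ⊢
  rw [hE] at t1 t2
  refine ⟨?_, supp (mat N s₂ 4), t2, t1, ?_, ?_⟩
  · rw [sem_used rfl, hfr₂.used rfl, hu]
  · refine ⟨Finset.univ.filter fun e => supp (mat N s₂ 4) e.1 e.2, ?_, fun u w h => by simpa using h⟩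
    have := card_crit_le (supp (mat N s₂ 4)) r₀ (fun w hw => (t1 _ _ hw).1 (h0 w))
      (fun w hw => (t1 _ _ hw).1 (h0' w))
      (Finset.univ.filter fun e => supp (mat N s₂ 4) e.1 e.2) (fun e he => by
        have he : supp (mat N s₂ 4) e.1 e.2 := by simpa using he
        exact ⟨he, t3 _ _ he⟩)
    simpa using this
  · intro u w
    have m3 : mat N s₂ 3 = mat N s 3 := by
      funext u w; simp only [mat, hfr₂.arr 3 (by decide), hfr.arr 3 (by decide)]
    rw [← m3]
    exact merge_spec (ω := ω) ((hfr₂.var 3 (by decide)).trans g3)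
      (by rw [hfr₂.var 2 (by decide)]; exact g2) (fun i j => s₂.arr 4 i j) (by
      intro s' i j hi hj h'
      simp only [Expr.eval, hi, hj, h' 4 (by decide)]) u w

theorem randomRoot_spec {ω : ℕ → Bool} {s : State} {b : ℕ} (h5 : s.var 5 = b) (h2 : b ≤ s.var 2) :
    (sem ω randomRoot s).used = s.used + b ∧
      (sem ω randomRoot s).var 32 = rootVal ω s.used b := by
  rw [randomRoot, sem_seq]
  have e : sem ω (assign 32 (num 0)) s = s.setVar 32 0 := rfl
  rw [e]
  have hmin : min ((s.setVar 32 0).var 5) ((s.setVar 32 0).var 2) = b := by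
    rw [State.setVar_var, State.setVar_var, if_neg (by decide), if_neg (by decide)]; omega
  have main := loop_inv (ω := ω) (x := 43) (y := 5)
    (c := flip 44 ;; assign 32 (.add (.add (v 32) (v 32)) (v 44))) (by decide)
    (fun i s' => s'.used = s.used + i ∧ s'.var 32 = rootVal ω s.used i) (s.setVar 32 0)
    ⟨rfl, by simp [State.setVar_var, rootVal]⟩ (by
    rintro i - s₁ ⟨hu, hv⟩ - -
    simp only [sem, State.flip, Expr.eval, State.setVar_var, State.setVar_used, hu, hv, rootVal,
      add_assoc]
    simp)
  rw [hmin] at main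
  exact main

theorem rootEdges_spec {ω : ℕ → Bool} {N : ℕ} {s : State} (h3 : s.var 3 = N) (h2 : N ≤ s.var 2)
    {r₀ r : Fin N} (h9 : s.var 9 = r₀) (hr₀ : (r₀ : ℕ) + 1 = N) (h32 : s.var 32 = r) {f : ℕ}
    (h4 : s.var 4 = f) (hf : 2 ^ f < N) (h1 : ∀ u w, mat N s 2 u w ≤ 1)
    (h0 : ∀ w, mat N s 2 r₀ w = 0) (h0' : ∀ w, mat N s 2 w r₀ = 0) :
    ∃ Γ : Fin N → Fin N → Prop, (∀ u w, Γ u w → supp (mat N s 2) u w) ∧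
      (∀ F : Finset (Fin N × Fin N), F.card ≤ f → ∀ w,
        (Reach (del (supp (mat N s 2)) F) r w → Reach (del Γ F) r w) ∧
        (Reach (del (supp (mat N s 2)) F) w r → Reach (del Γ F) w r)) ∧
      (∃ S : Finset (Fin N × Fin N), S.card ≤ 2 * N * 2 ^ f ∧ ∀ u w, Γ u w → (u, w) ∈ S) ∧
      ∀ u w, supp (mat N (sem ω rootEdges s) 3) u w ↔ supp (mat N s 3) u w ∨ Γ u w := by
  classical
  rw [rootEdges]
  simp only [sem_seq]
  have hE : ∀ u w, mat N (sem ω (fill 8 29 30 (rd 2 (v 29) (v 30))) s) 8 u w = mat N s 2 u w := by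
    intro i j
    have := sem_fill (ω := ω) (a := 8) (x := 29) (y := 30) (e := rd 2 (v 29) (v 30)) (by decide)
      (by decide) (by decide) (by decide) (by decide) h3 h2 (fun i j => s.arr 2 i j) (by
        intro s₁ i j hi hj _ ha
        simp only [Expr.eval, hi, hj, ha 2 (by decide)]) i j
    rw [mat, this, if_pos ⟨i.2, j.2⟩, mat]
  have hfr := frame_sem ω (fill 8 29 30 (rd 2 (v 29) (v 30))) s
  generalize sem ω (fill 8 29 30 (rd 2 (v 29) (v 30))) s = s₁ at hE hfr ⊢
  have w3 := (hfr.var 3 (by decide)).trans h3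
  have w2 : N ≤ s₁.var 2 := by rw [hfr.var 2 (by decide)]; exact h2
  obtain ⟨t1, t2, t3⟩ := ftrs_spec (ω := ω) w3 w2 ((hfr.var 9 (by decide)).trans h9) hr₀
    ((hfr.var 32 (by decide)).trans h32) ((hfr.var 4 (by decide)).trans h4) hf
    (fun u w => (hE u w).trans_le (h1 u w)) (fun w => (hE _ _).trans (h0 w))
    (fun w => (hE _ _).trans (h0' w))
  have hfr₂ := frame_sem ω ftrs s₁
  generalize sem ω ftrs s₁ = s₂ at t1 t2 t3 hfr₂ ⊢
  have x3 := (hfr₂.var 3 (by decide)).trans w3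
  have x2 : N ≤ s₂.var 2 := by rw [hfr₂.var 2 (by decide)]; exact w2
  have hm := merge_spec (ω := ω) (e := rd 8 (v 29) (v 30)) x3 x2 (fun i j => s₂.arr 8 i j) (by
    intro s' i j hi hj h'
    simp only [Expr.eval, hi, hj, h' 8 (by decide)])
  have hfr₃ := frame_sem ω (merge (rd 8 (v 29) (v 30))) s₂
  generalize sem ω (merge (rd 8 (v 29) (v 30))) s₂ = s₃ at hm hfr₃ ⊢
  have y3 := (hfr₃.var 3 (by decide)).trans x3
  have y2 : N ≤ s₃.var 2 := by rw [hfr₃.var 2 (by decide)]; exact x2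
  have y9 : s₃.var 9 = r₀ := by
    rw [hfr₃.var 9 (by decide), hfr₂.var 9 (by decide), hfr.var 9 (by decide), h9]
  have y4 : s₃.var 4 = f := by
    rw [hfr₃.var 4 (by decide), hfr₂.var 4 (by decide), hfr.var 4 (by decide), h4]
  have y32 : s₃.var 32 = r := by
    rw [hfr₃.var 32 (by decide), hfr₂.var 32 (by decide), hfr.var 32 (by decide), h32]
  have b2 : s₃.arr 2 = s.arr 2 := by
    rw [hfr₃.arr 2 (by decide), hfr₂.arr 2 (by decide), hfr.arr 2 (by decide)]
  have b3 : s₂.arr 3 = s.arr 3 := by rw [hfr₂.arr 3 (by decide), hfr.arr 3 (by decide)]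
  have hE' : ∀ u w, mat N (sem ω (fill 8 29 30 (rd 2 (v 30) (v 29))) s₃) 8 u w = mat N s 2 w u := by
    intro i j
    have := sem_fill (ω := ω) (a := 8) (x := 29) (y := 30) (e := rd 2 (v 30) (v 29)) (by decide)
      (by decide) (by decide) (by decide) (by decide) y3 y2 (fun i j => s.arr 2 j i) (by
        intro s₁ i j hi hj _ ha
        simp only [Expr.eval, hi, hj, ha 2 (by decide), b2]) i j
    rw [mat, this, if_pos ⟨i.2, j.2⟩, mat]
  have hfr₄ := frame_sem ω (fill 8 29 30 (rd 2 (v 30) (v 29))) s₃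
  generalize sem ω (fill 8 29 30 (rd 2 (v 30) (v 29))) s₃ = s₄ at hE' hfr₄ ⊢
  have z3 := (hfr₄.var 3 (by decide)).trans y3
  have z2 : N ≤ s₄.var 2 := by rw [hfr₄.var 2 (by decide)]; exact y2
  obtain ⟨q1, q2, q3⟩ := ftrs_spec (ω := ω) z3 z2 ((hfr₄.var 9 (by decide)).trans y9) hr₀
    ((hfr₄.var 32 (by decide)).trans y32) ((hfr₄.var 4 (by decide)).trans y4) hf
    (fun u w => (hE' u w).trans_le (h1 w u)) (fun w => (hE' _ _).trans (h0' w))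
    (fun w => (hE' _ _).trans (h0 w))
  have hfr₅ := frame_sem ω ftrs s₄
  generalize sem ω ftrs s₄ = s₅ at q1 q2 q3 hfr₅ ⊢
  have hm' := merge_spec (ω := ω) (e := rd 8 (v 30) (v 29)) ((hfr₅.var 3 (by decide)).trans z3)
    (by rw [hfr₅.var 2 (by decide)]; exact z2) (fun i j => s₅.arr 8 j i) (by
    intro s' i j hi hj h'
    simp only [Expr.eval, hi, hj, h' 8 (by decide)])
  have b5 : s₅.arr 3 = s₃.arr 3 := by rw [hfr₅.arr 3 (by decide), hfr₄.arr 3 (by decide)]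
  have hs₁ : supp (mat N s₁ 8) = supp (mat N s 2) := by funext u w; simp only [supp, hE]
  have hs₄ : supp (mat N s₄ 8) = _root_.flip (supp (mat N s 2)) := by
    funext u w; simp only [supp, hE', _root_.flip]
  rw [hs₁] at t2
  rw [hs₄] at q2
  -- Reachability to the root is reachability from the root in the reversed graph, with the fault
  -- set reversed as well.
  have sw : ∀ (R : Fin N → Fin N → Prop) (F : Finset (Fin N × Fin N)) (x y : Fin N),
      Reach (del (_root_.flip R) (F.image Prod.swap)) x y ↔ Reach (del R F) y x := by
    intro R F x y
    rw [← reach_flip]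
    have : _root_.flip (del (_root_.flip R) (F.image Prod.swap)) = del R F := by
      funext u w
      simp only [_root_.flip, del, Finset.mem_image, Prod.exists, Prod.swap_prod_mk, Prod.mk.injEq]
      refine propext (and_congr_right fun _ => not_congr ⟨?_, fun h => ⟨u, w, h, rfl, rfl⟩⟩)
      rintro ⟨a, b, hab, rfl, rfl⟩
      exact hab
    rw [this]
  refine ⟨fun u w => supp (mat N s₂ 8) u w ∨ supp (mat N s₅ 8) w u, ?_, ?_, ?_, ?_⟩
  · rintro u w (h | h)
    · rw [← hs₁]
      exact fun h' => h (Nat.le_zero.1 ((t1 u w).trans h'.le))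
    · have : supp (mat N s₄ 8) w u := fun h' => h (Nat.le_zero.1 ((q1 w u).trans h'.le))
      rwa [hs₄] at this
  · intro F hF w
    constructor
    · intro h
      exact (t2 F hF w h).mono (del_mono (fun u w h => Or.inl h) F)
    · intro h
      have h4 := q2 (F.image Prod.swap) (Finset.card_image_le.trans hF) w ((sw _ _ _ _).2 h)
      have h5 := (sw (_root_.flip (supp (mat N s₅ 8))) F r w).1 h4
      exact h5.mono (del_mono (fun u w h => Or.inr h) F)
  · refine ⟨(Finset.univ.filter fun e => supp (mat N s₂ 8) e.1 e.2) ∪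
      (Finset.univ.filter fun e => supp (mat N s₅ 8) e.1 e.2).image Prod.swap, ?_, ?_⟩
    · have k1 := t3 (Finset.univ.filter fun e => supp (mat N s₂ 8) e.1 e.2) (by simp)
      have k2 := q3 (Finset.univ.filter fun e => supp (mat N s₅ 8) e.1 e.2) (by simp)
      have k3 := Finset.card_union_le (Finset.univ.filter fun e => supp (mat N s₂ 8) e.1 e.2)
        ((Finset.univ.filter fun e => supp (mat N s₅ 8) e.1 e.2).image Prod.swap)
      have k4 := Finset.card_image_le (f := Prod.swap)
        (s := Finset.univ.filter fun e => supp (mat N s₅ 8) e.1 e.2)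
      rw [mul_assoc]
      omega
    · rintro u w (h | h)
      · exact Finset.mem_union_left _ (by simpa using h)
      · exact Finset.mem_union_right _ (Finset.mem_image.2 ⟨(w, u), by simpa using h, rfl⟩)
  · intro u w
    rw [hm']
    have e3 : supp (mat N s₅ 3) u w ↔ supp (mat N s₃ 3) u w := by simp only [supp, mat, b5]
    have e4 : supp (mat N s₂ 3) u w ↔ supp (mat N s 3) u w := by simp only [supp, mat, b3]
    rw [e3, hm, e4, or_assoc]
    rfl

/-- A random value that is not below `var 9` is the auxiliary vertex or no vertex at all. Nothing is
added then, but the coins are spent in any case, which keeps the coin positions of later rounds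
fixed. -/
theorem rootRound_spec {ω : ℕ → Bool} {N : ℕ} {s : State} (h3 : s.var 3 = N) (h2 : N ≤ s.var 2)
    {r₀ : Fin N} (h9 : s.var 9 = r₀) (hr₀ : (r₀ : ℕ) + 1 = N) {f b : ℕ} (h5 : s.var 5 = b)
    (hb : b ≤ s.var 2)
    (h4 : s.var 4 = f) (hf : 2 ^ f < N) (h1 : ∀ u w, mat N s 2 u w ≤ 1)
    (h0 : ∀ w, mat N s 2 r₀ w = 0) (h0' : ∀ w, mat N s 2 w r₀ = 0) :
    (sem ω rootRound s).used = s.used + b ∧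
    ∃ Γ : Fin N → Fin N → Prop, (∀ u w, Γ u w → supp (mat N s 2) u w) ∧
      (∀ r : Fin N, r ≠ r₀ → rootVal ω s.used b = r →
        ∀ F : Finset (Fin N × Fin N), F.card ≤ f → ∀ w,
        (Reach (del (supp (mat N s 2)) F) r w → Reach (del Γ F) r w) ∧
        (Reach (del (supp (mat N s 2)) F) w r → Reach (del Γ F) w r)) ∧
      (∃ S : Finset (Fin N × Fin N), S.card ≤ 2 * N * 2 ^ f ∧ ∀ u w, Γ u w → (u, w) ∈ S) ∧
      ∀ u w, supp (mat N (sem ω rootRound s) 3) u w ↔ supp (mat N s 3) u w ∨ Γ u w := by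
  rw [rootRound, sem_seq]
  obtain ⟨hu, hv⟩ := randomRoot_spec (ω := ω) h5 hb
  have hfr := frame_sem ω randomRoot s
  generalize sem ω randomRoot s = s₁ at hu hv hfr ⊢
  have w9 := (hfr.var 9 (by decide)).trans h9
  have m2 : mat N s₁ 2 = mat N s 2 := by funext u w; simp only [mat, hfr.arr 2 (by decide)]
  have m3 : mat N s₁ 3 = mat N s 3 := by funext u w; simp only [mat, hfr.arr 3 (by decide)]
  by_cases hlt : rootVal ω s.used b < r₀
  · obtain ⟨r, hr⟩ : ∃ r : Fin N, rootVal ω s.used b = r := ⟨⟨rootVal ω s.used b, by omega⟩, rfl⟩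
    rw [when, sem, if_pos (by simp only [Expr.eval, w9, hv]; omega), sem_used rfl]
    refine ⟨hu, ?_⟩
    rw [← m2, ← m3]
    obtain ⟨Γ, g1, g2, g3, g4⟩ := rootEdges_spec (ω := ω) ((hfr.var 3 (by decide)).trans h3)
      (by rw [hfr.var 2 (by decide)]; exact h2) w9 hr₀ (hv.trans hr)
      ((hfr.var 4 (by decide)).trans h4) hf (by rw [m2]; exact h1) (by rw [m2]; exact h0)
      (by rw [m2]; exact h0')
    refine ⟨Γ, g1, fun r' _ hr' => ?_, g3, g4⟩
    rw [Fin.ext (hr'.symm.trans hr)]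
    exact g2
  · rw [when, sem, if_neg (by simp only [Expr.eval, w9, hv]; omega), sem]
    refine ⟨hu, fun _ _ => False, fun _ _ h => h.elim, fun r hr hr' => ?_,
      ⟨∅, by simp, fun _ _ h => h.elim⟩, fun u w => by rw [m3, or_false]⟩
    exfalso
    apply hr
    apply Fin.ext
    have := r.2
    omega

end FP
end ConnCert

namespace ConnCert
namespace FP

/-! ### The main loops -/

/-- Sample fault sets and roots, collecting edges in array 3. -/
def core : FP := loop 46 7 sampleRound ;; loop 47 8 rootRound

/-- For every sequence of coins, round t reads its faults and round i its root at positions that do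
not depend on the outcomes. The probabilistic estimates can therefore be made about `faults` and
`rootVal` alone. -/
theorem core_spec {ω : ℕ → Bool} {N : ℕ} {s : State} (h3 : s.var 3 = N) (h2 : N ≤ s.var 2)
    {r₀ : Fin N} (h9 : s.var 9 = r₀) (hr₀ : (r₀ : ℕ) + 1 = N) {f b a M Q : ℕ} (h5 : s.var 5 = b)
    (hb : b ≤ s.var 2) (h6 : s.var 6 = a) (ha : a ≤ s.var 2) (h7 : s.var 7 = M) (hM : M ≤ s.var 2)
    (h8 : s.var 8 = Q) (hQ : Q ≤ s.var 2)
    (h4 : s.var 4 = f) (hf : 2 ^ f < N) (h1 : ∀ u w, mat N s 2 u w ≤ 1)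
    (h0 : ∀ w, mat N s 2 r₀ w = 0) (h0' : ∀ w, mat N s 2 w r₀ = 0) (hu : s.used = 0)
    (hH : ∀ u w, ¬ supp (mat N s 3) u w) :
    (∀ u w, supp (mat N (sem ω core s) 3) u w → supp (mat N s 2) u w) ∧
    (∀ t < M, ∃ Γ : Fin N → Fin N → Prop,
      FT1 (del (supp (mat N s 2)) (faults N ω (t * (N * N * a)) a)) Γ ∧
      (∀ u w, Γ u w → del (supp (mat N s 2)) (faults N ω (t * (N * N * a)) a) u w) ∧
      ∀ u w, Γ u w → supp (mat N (sem ω core s) 3) u w) ∧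
    (∀ i < Q, ∀ r : Fin N, r ≠ r₀ → rootVal ω (M * (N * N * a) + i * b) b = r →
      ∀ F : Finset (Fin N × Fin N), F.card ≤ f → ∀ w,
        (Reach (del (supp (mat N s 2)) F) r w →
          Reach (del (supp (mat N (sem ω core s) 3)) F) r w) ∧
        (Reach (del (supp (mat N s 2)) F) w r →
          Reach (del (supp (mat N (sem ω core s) 3)) F) w r)) ∧
    ∃ S : Finset (Fin N × Fin N),
      S.card ≤ M * (32 * N * (Nat.log 2 N + 1)) + Q * (2 * N * 2 ^ f) ∧
      ∀ u w, supp (mat N (sem ω core s) 3) u w → (u, w) ∈ S := by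
  classical
  rw [core, sem_seq]
  set E := supp (mat N s 2) with hE
  have hmin : min (s.var 7) (s.var 2) = M := by omega
  have first := loop_inv (ω := ω) (x := 46) (y := 7) (c := sampleRound) (by decide)
    (fun i s' => s'.used = i * (N * N * a) ∧ (∀ u w, supp (mat N s' 3) u w → E u w) ∧
      (∀ t < i, ∃ Γ : Fin N → Fin N → Prop,
        FT1 (del E (faults N ω (t * (N * N * a)) a)) Γ ∧
        (∀ u w, Γ u w → del E (faults N ω (t * (N * N * a)) a) u w) ∧
        ∀ u w, Γ u w → supp (mat N s' 3) u w) ∧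
      ∃ S : Finset (Fin N × Fin N), S.card ≤ i * (32 * N * (Nat.log 2 N + 1)) ∧
        ∀ u w, supp (mat N s' 3) u w → (u, w) ∈ S) s
    ⟨by simp [State.setVar_used, hu], fun u w h => (hH u w h).elim,
      fun t ht => absurd ht (by omega), ∅, by simp, fun u w h => (hH u w h).elim⟩ (by
    rintro i - s₁ ⟨hu₁, hle, hΓ, S, hS, hS'⟩ hfr -
    simp only [State.setVar_used, mat_setVar]
    have m2 : mat N s₁ 2 = mat N s 2 := by funext u w; simp only [mat, hfr.arr 2 (by decide)]
    obtain ⟨g1, Γ, g2, g3, ⟨S₂, g4, g5⟩, g6⟩ := sampleRound_spec (ω := ω) (r₀ := r₀)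
      ((hfr.var 3 (by decide)).trans h3) (by rw [hfr.var 2 (by decide)]; exact h2)
      ((hfr.var 6 (by decide)).trans h6) (by rw [hfr.var 2 (by decide)]; exact ha)
      (by rw [m2]; exact h0) (by rw [m2]; exact h0')
    rw [m2, hu₁] at g2 g3
    refine ⟨by rw [g1, hu₁]; ring, ?_, ?_, S ∪ S₂, ?_, ?_⟩
    · intro u w h
      rcases (g6 u w).1 h with h | h
      · exact hle u w h
      · exact (g3 u w h).1
    · intro t ht
      rcases Nat.lt_succ_iff_lt_or_eq.1 ht with ht | rfl
      · obtain ⟨Γ', k1, k2, k3⟩ := hΓ t ht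
        exact ⟨Γ', k1, k2, fun u w h => (g6 u w).2 (Or.inl (k3 u w h))⟩
      · exact ⟨Γ, g2, g3, fun u w h => (g6 u w).2 (Or.inr h)⟩
    · refine (Finset.card_union_le _ _).trans ?_
      rw [Nat.succ_mul]; omega
    · intro u w h
      rcases (g6 u w).1 h with h | h
      · exact Finset.mem_union_left _ (hS' u w h)
      · exact Finset.mem_union_right _ (g5 u w h))
  rw [hmin] at first
  have hfr := frame_sem ω (loop 46 7 sampleRound) s
  generalize sem ω (loop 46 7 sampleRound) s = s₁ at first hfr ⊢
  obtain ⟨hu₁, hle, hΓ, S, hS, hS'⟩ := first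
  have w2 := hfr.var 2 (by decide)
  have m2 : mat N s₁ 2 = mat N s 2 := by funext u w; simp only [mat, hfr.arr 2 (by decide)]
  have hmin₁ : min (s₁.var 8) (s₁.var 2) = Q := by
    rw [hfr.var 8 (by decide), w2]; omega
  have second := loop_inv (ω := ω) (x := 47) (y := 8) (c := rootRound) (by decide)
    (fun i s' => s'.used = M * (N * N * a) + i * b ∧ (∀ u w, supp (mat N s' 3) u w → E u w) ∧
      (∀ u w, supp (mat N s₁ 3) u w → supp (mat N s' 3) u w) ∧
      (∀ i' < i, ∀ r : Fin N, r ≠ r₀ → rootVal ω (M * (N * N * a) + i' * b) b = r →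
        ∀ F : Finset (Fin N × Fin N), F.card ≤ f → ∀ w,
        (Reach (del E F) r w → Reach (del (supp (mat N s' 3)) F) r w) ∧
        (Reach (del E F) w r → Reach (del (supp (mat N s' 3)) F) w r)) ∧
      ∃ S : Finset (Fin N × Fin N),
        S.card ≤ M * (32 * N * (Nat.log 2 N + 1)) + i * (2 * N * 2 ^ f) ∧
        ∀ u w, supp (mat N s' 3) u w → (u, w) ∈ S) s₁
    ⟨by simp [State.setVar_used, hu₁], hle, fun _ _ h => h,
      fun t ht => absurd ht (by omega), S, by simpa using hS, hS'⟩ (by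
    rintro i - s' ⟨hu', hle', hmono, hroot, S, hS, hS'⟩ hfr' -
    simp only [State.setVar_used, mat_setVar]
    have m2' : mat N s' 2 = mat N s 2 := by
      rw [← m2]; funext u w; simp only [mat, hfr'.arr 2 (by decide)]
    have x2 : s'.var 2 = s.var 2 := (hfr'.var 2 (by decide)).trans w2
    obtain ⟨g1, Γ, g2, g3, ⟨S₂, g4, g5⟩, g6⟩ := rootRound_spec (ω := ω) (s := s') (r₀ := r₀)
      (by rw [hfr'.var 3 (by decide), hfr.var 3 (by decide), h3]) (by rw [x2]; exact h2)
      (by rw [hfr'.var 9 (by decide), hfr.var 9 (by decide), h9]) hr₀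
      (by rw [hfr'.var 5 (by decide), hfr.var 5 (by decide), h5]) (by rw [x2]; exact hb)
      (by rw [hfr'.var 4 (by decide), hfr.var 4 (by decide), h4]) hf
      (by rw [m2']; exact h1) (by rw [m2']; exact h0) (by rw [m2']; exact h0')
    rw [m2'] at g2 g3
    rw [hu'] at g3
    have up : ∀ u w, supp (mat N s' 3) u w → supp (mat N (sem ω rootRound s') 3) u w :=
      fun u w h => (g6 u w).2 (Or.inl h)
    refine ⟨by rw [g1, hu']; ring, ?_, fun u w h => up u w (hmono u w h), ?_, S ∪ S₂, ?_, ?_⟩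
    · intro u w h
      rcases (g6 u w).1 h with h | h
      · exact hle' u w h
      · exact g2 u w h
    · intro t ht r hr hr' F hF w
      rcases Nat.lt_succ_iff_lt_or_eq.1 ht with ht | rfl
      · obtain ⟨k1, k2⟩ := hroot t ht r hr hr' F hF w
        exact ⟨fun h => (k1 h).mono (del_mono up F), fun h => (k2 h).mono (del_mono up F)⟩
      · obtain ⟨k1, k2⟩ := g3 r hr hr' F hF w
        have up' : ∀ u w, Γ u w → supp (mat N (sem ω rootRound s') 3) u w :=
          fun u w h => (g6 u w).2 (Or.inr h)
        exact ⟨fun h => (k1 h).mono (del_mono up' F), fun h => (k2 h).mono (del_mono up' F)⟩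
    · refine (Finset.card_union_le _ _).trans ?_
      rw [Nat.succ_mul i]; omega
    · intro u w h
      rcases (g6 u w).1 h with h | h
      · exact Finset.mem_union_left _ (hS' u w h)
      · exact Finset.mem_union_right _ (g5 u w h))
  rw [hmin₁] at second
  obtain ⟨-, k1, k2, k3, k4⟩ := second
  exact ⟨k1, fun t ht => (hΓ t ht).imp fun Γ h => ⟨h.1, h.2.1, fun u w hh => k2 u w (h.2.2 u w hh)⟩,
    k3, k4⟩

/-! ### Parameters -/

/-- A loop that iterates a function on a variable. -/
theorem sem_iterVar {ω : ℕ → Bool} {x y z B : ℕ} {c : FP} {s : State} (hx : x ∉ c.mv) (hz : z ≠ x)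
    (g : ℕ → ℕ) (hB : min (s.var y) (s.var 2) = B)
    (h : ∀ s₁, Frame (loop x y c) s s₁ → (sem ω c s₁).var z = g (s₁.var z)) :
    (sem ω (loop x y c) s).var z = g^[B] (s.var z) := by
  have := loop_inv (ω := ω) (x := x) (y := y) (c := c) hx
    (fun i s' => s'.var z = g^[i] (s.var z)) s (by rw [State.setVar_var, if_neg hz]; rfl) (by
    intro i _ s₁ hI hfr _
    rw [State.setVar_var, if_neg hz, h s₁ hfr, hI, Function.iterate_succ_apply'])
  rwa [hB] at this

theorem iterate_double (j x : ℕ) : (fun x : ℕ => x + x)^[j] x = x * 2 ^ j := by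
  induction j with
  | zero => simp
  | succ j ih => rw [Function.iterate_succ_apply', ih, pow_succ]; ring

theorem iterate_add (j x d : ℕ) : (fun x : ℕ => x + d)^[j] x = x + j * d := by
  induction j with
  | zero => simp
  | succ j ih => rw [Function.iterate_succ_apply', ih]; ring

/-- Sizes of the split graph, and the number of faults. -/
def setSizes : FP :=
  assign 9 (.add (v 0) (v 0)) ;; assign 3 (.add (v 9) (num 1)) ;; assign 4 (.sub (v 1) (num 1))

/-- Variable 5 becomes the number of bits needed for `var 3` different values. -/
def setLog : FP :=
  assign 50 (num 1) ;; assign 5 (num 0) ;;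
  loop 51 3 (when (.sub (v 3) (v 50))
    (assign 50 (.add (v 50) (v 50)) ;; assign 5 (.add (v 5) (num 1))))

/-- Variable 6 becomes the rounded-up quotient of variables 5 and 4. -/
def setExp : FP :=
  assign 6 (num 0) ;; assign 52 (num 0) ;;
  loop 51 5 (when (.sub (v 5) (v 52))
    (assign 52 (.add (v 52) (v 4)) ;; assign 6 (.add (v 6) (num 1))))

/-- Variable 53 becomes `64 * var 5 ^ 2`. -/
def setReps : FP :=
  assign 53 (num 0) ;; loop 51 5 (loop 54 5 (assign 53 (.add (v 53) (num 64))))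

/-- The number of sampled roots. -/
def setRoots : FP :=
  assign 8 (v 53) ;; assign 55 (.sub (v 5) (v 6)) ;; loop 51 55 (assign 8 (.add (v 8) (v 8)))

/-- The number of sampled fault sets. -/
def setSamples : FP :=
  assign 7 (v 53) ;; assign 56 (.sub (v 4) (num 1)) ;;
  loop 51 6 (loop 54 56 (assign 7 (.add (v 7) (v 7))))

theorem setSizes_spec {ω : ℕ → Bool} {s : State} {n k : ℕ} (h0 : s.var 0 = n) (h1 : s.var 1 = k) :
    (sem ω setSizes s).var 9 = 2 * n ∧ (sem ω setSizes s).var 3 = 2 * n + 1 ∧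
      (sem ω setSizes s).var 4 = k - 1 := by
  simp [setSizes, sem, Expr.eval, State.setVar_var, h0, h1, two_mul]

theorem setLog_spec {ω : ℕ → Bool} {s : State} {N : ℕ} (h3 : s.var 3 = N) (h2 : N ≤ s.var 2) :
    (sem ω setLog s).var 5 = Nat.clog 2 N := by
  rw [setLog, sem_seq, sem_seq]
  have e : sem ω (assign 5 (num 0)) (sem ω (assign 50 (num 1)) s) =
    (s.setVar 50 1).setVar 5 0 := rfl
  rw [e]
  have hmin : min (((s.setVar 50 1).setVar 5 0).var 3) (((s.setVar 50 1).setVar 5 0).var 2) = N := by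
    simp only [State.setVar_var]; norm_num; omega
  have g3 : ((s.setVar 50 1).setVar 5 0).var 3 = N := by simp [State.setVar_var, h3]
  have main := loop_inv (ω := ω) (x := 51) (y := 3)
    (c := when (.sub (v 3) (v 50))
      (assign 50 (.add (v 50) (v 50)) ;; assign 5 (.add (v 5) (num 1)))) (by decide)
    (fun i s' => s'.var 50 = 2 ^ (s'.var 5) ∧ s'.var 5 ≤ Nat.clog 2 N ∧
      (N ≤ s'.var 50 ∨ s'.var 5 = i)) ((s.setVar 50 1).setVar 5 0)
    (by simp [State.setVar_var]) (by
    rintro i - s' ⟨hI1, hI2, hI3⟩ hfr -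
    have k3 : s'.var 3 = N := (hfr.var 3 (by decide)).trans g3
    by_cases h : N ≤ s'.var 50
    · rw [when, sem, if_neg (by simp only [Expr.eval, k3]; omega), sem]
      simp only [State.setVar_var]
      norm_num
      exact ⟨hI1, hI2, Or.inl h⟩
    · rw [when, sem, if_pos (by simp only [Expr.eval, k3]; omega)]
      simp only [sem, Expr.eval, State.setVar_var]
      norm_num
      refine ⟨by rw [hI1, pow_succ]; ring, ?_, Or.inr (hI3.resolve_left h)⟩
      have : 2 ^ s'.var 5 < N := by omega
      by_contra hcon
      have := (Nat.le_pow_clog (b := 2) (by omega) N).trans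
        (Nat.pow_le_pow_right (by omega) (not_lt.1 hcon))
      omega)
  rw [hmin] at main
  obtain ⟨k1, k2, k3⟩ := main
  refine le_antisymm k2 ?_
  rcases k3 with h | h
  · rw [k1] at h
    exact Nat.clog_le_of_le_pow h
  · rw [h]
    exact Nat.clog_le_of_le_pow N.lt_two_pow_self.le

/-- The two inequalities pin down `a + 1` as b / f rounded up. The `b` rounds are enough because
every round adds at least 1. -/
theorem setExp_spec {ω : ℕ → Bool} {s : State} {b f : ℕ} (h5 : s.var 5 = b) (h2 : b ≤ s.var 2)
    (h4 : s.var 4 = f) (hf : 1 ≤ f) (hb : 1 ≤ b) :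
    ∃ a, (sem ω setExp s).var 6 = a + 1 ∧ a * f < b ∧ b ≤ (a + 1) * f := by
  rw [setExp, sem_seq, sem_seq]
  have e : sem ω (assign 52 (num 0)) (sem ω (assign 6 (num 0)) s) =
    (s.setVar 6 0).setVar 52 0 := rfl
  rw [e]
  have hmin : min (((s.setVar 6 0).setVar 52 0).var 5) (((s.setVar 6 0).setVar 52 0).var 2) = b := by
    simp only [State.setVar_var]; norm_num; omega
  have g5 : ((s.setVar 6 0).setVar 52 0).var 5 = b := by simp [State.setVar_var, h5]
  have g4 : ((s.setVar 6 0).setVar 52 0).var 4 = f := by simp [State.setVar_var, h4]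
  have main := loop_inv (ω := ω) (x := 51) (y := 5)
    (c := when (.sub (v 5) (v 52))
      (assign 52 (.add (v 52) (v 4)) ;; assign 6 (.add (v 6) (num 1)))) (by decide)
    (fun i s' => s'.var 52 = s'.var 6 * f ∧ (∀ a, s'.var 6 = a + 1 → a * f < b) ∧
      (b ≤ s'.var 52 ∨ s'.var 6 = i)) ((s.setVar 6 0).setVar 52 0)
    (by simp [State.setVar_var]) (by
    rintro i - s' ⟨hI1, hI2, hI3⟩ hfr -
    have k5 : s'.var 5 = b := (hfr.var 5 (by decide)).trans g5
    have k4 : s'.var 4 = f := (hfr.var 4 (by decide)).trans g4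
    by_cases h : b ≤ s'.var 52
    · rw [when, sem, if_neg (by simp only [Expr.eval, k5]; omega), sem]
      simp only [State.setVar_var]
      norm_num
      exact ⟨hI1, hI2, Or.inl h⟩
    · rw [when, sem, if_pos (by simp only [Expr.eval, k5]; omega)]
      simp only [sem, Expr.eval, State.setVar_var]
      norm_num
      exact ⟨by rw [hI1, k4]; ring, by rw [← hI1]; omega, Or.inr (hI3.resolve_left h)⟩)
  rw [hmin] at main
  obtain ⟨k1, k2, k3⟩ := main
  have hb' : b ≤ (sem ω (loop 51 5 (when (.sub (v 5) (v 52))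
      (assign 52 (.add (v 52) (v 4)) ;; assign 6 (.add (v 6) (num 1)))))
      ((s.setVar 6 0).setVar 52 0)).var 6 * f := by
    rcases k3 with h | h
    · rwa [k1] at h
    · rw [h]; exact Nat.le_mul_of_pos_right b hf
  generalize (sem ω (loop 51 5 (when (.sub (v 5) (v 52))
      (assign 52 (.add (v 52) (v 4)) ;; assign 6 (.add (v 6) (num 1)))))
      ((s.setVar 6 0).setVar 52 0)).var 6 = a at k2 hb' ⊢
  obtain _ | a := a
  · omega
  · exact ⟨a, rfl, k2 a rfl, hb'⟩

theorem setReps_spec {ω : ℕ → Bool} {s : State} {b : ℕ} (h5 : s.var 5 = b) (h2 : b ≤ s.var 2) :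
    (sem ω setReps s).var 53 = b * (b * 64) := by
  rw [setReps, sem_seq]
  have e : sem ω (assign 53 (num 0)) s = s.setVar 53 0 := rfl
  rw [e]
  have g5 : (s.setVar 53 0).var 5 = b := by simp [State.setVar_var, h5]
  have g2 : (s.setVar 53 0).var 2 = s.var 2 := by simp [State.setVar_var]
  rw [sem_iterVar (B := b) (by decide) (by decide) (fun x => x + b * 64) (by omega), iterate_add]
  · simp [State.setVar_var]
  · intro s₁ hfr
    have k5 := (hfr.var 5 (by decide)).trans g5
    have k2 := (hfr.var 2 (by decide)).trans g2
    rw [sem_iterVar (B := b) (by decide) (by decide) (fun x => x + 64) (by omega), iterate_add]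
    intro s₂ _
    simp [sem, Expr.eval, State.setVar_var]

theorem setRoots_spec {ω : ℕ → Bool} {s : State} {b a T : ℕ} (h5 : s.var 5 = b) (h2 : b ≤ s.var 2)
    (h6 : s.var 6 = a) (h53 : s.var 53 = T) :
    (sem ω setRoots s).var 8 = T * 2 ^ (b - a) := by
  rw [setRoots, sem_seq, sem_seq]
  have e : sem ω (assign 55 (.sub (v 5) (v 6))) (sem ω (assign 8 (v 53)) s) =
      (s.setVar 8 T).setVar 55 (b - a) := by
    simp [sem, Expr.eval, State.setVar_var, h5, h6, h53]
  rw [e, sem_iterVar (B := b - a) (by decide) (by decide) (fun x => x + x) (by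
    simp only [State.setVar_var]; norm_num; omega), iterate_double]
  · simp [State.setVar_var]
  · intro s₂ _
    simp [sem, Expr.eval, State.setVar_var]

theorem setSamples_spec {ω : ℕ → Bool} {s : State} {f a T : ℕ} (h4 : s.var 4 = f)
    (hf : f ≤ s.var 2) (h6 : s.var 6 = a) (ha : a ≤ s.var 2) (h53 : s.var 53 = T) :
    (sem ω setSamples s).var 7 = T * 2 ^ (a * (f - 1)) := by
  rw [setSamples, sem_seq, sem_seq]
  have e : sem ω (assign 56 (.sub (v 4) (num 1))) (sem ω (assign 7 (v 53)) s) =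
      (s.setVar 7 T).setVar 56 (f - 1) := by
    simp [sem, Expr.eval, State.setVar_var, h4, h53]
  rw [e]
  have g56 : ((s.setVar 7 T).setVar 56 (f - 1)).var 56 = f - 1 := by simp [State.setVar_var]
  have g2 : ((s.setVar 7 T).setVar 56 (f - 1)).var 2 = s.var 2 := by simp [State.setVar_var]
  have g6 : ((s.setVar 7 T).setVar 56 (f - 1)).var 6 = a := by simp [State.setVar_var, h6]
  rw [sem_iterVar (B := a) (by decide) (by decide) ((fun x => x + x)^[f - 1]) (by omega),
    ← Function.iterate_mul, iterate_double, mul_comm (f - 1)]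
  · simp [State.setVar_var]
  · intro s₁ hfr
    have k56 := (hfr.var 56 (by decide)).trans g56
    have k2 := (hfr.var 2 (by decide)).trans g2
    rw [sem_iterVar (B := f - 1) (by decide) (by decide) (fun x => x + x) (by omega)]
    intro s₂ _
    simp [sem, Expr.eval, State.setVar_var]

end FP
end ConnCert

/-! ### The complete program on the split graph -/

namespace ConnCert
theorem splitRel_isolated {n : ℕ} {G : Digraph (Fin n)} {r : Fin (2 * n + 1)}
    (hr : (r : ℕ) = 2 * n) (w : Fin (2 * n + 1)) : ¬ splitRel G r w ∧ ¬ splitRel G w r := by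
  constructor
  · rintro (⟨i, h, -⟩ | ⟨i, j, -, h, -⟩) <;>
    · have h5 := congrArg Fin.val h
      have := i.2
      simp only [inn, out, hr] at h5
      omega
  · rintro (⟨i, -, h⟩ | ⟨i, j, -, -, h⟩)
    · have h5 := congrArg Fin.val h
      have := i.2
      simp only [out, hr] at h5
      omega
    · have h5 := congrArg Fin.val h
      have := j.2
      simp only [inn, hr] at h5
      omega

namespace FP

/-- Array 2 becomes the adjacency matrix of the split graph of array 0. -/
def splitGraph : FP :=
  fill 2 29 30 (.add
    (.sub (.sub (num 1) (neq (v 30) (.add (v 0) (v 29)))) (.sub (.add (v 29) (num 1)) (v 0)))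
    (.sub (rd 0 (.sub (v 29) (v 0)) (v 30)) (.sub (v 0) (v 29))))

/-- Array 1 becomes the digraph on the original vertices encoded in array 3. -/
def unsplitGraph : FP := fill 1 29 30 (rd 3 (.add (v 0) (v 29)) (v 30))

/-- The certificate computation when there are fewer faults than bits in the size. -/
def certify : FP :=
  setExp ;; setReps ;; setRoots ;; setSamples ;; splitGraph ;; core ;; unsplitGraph

/-- The whole computation, given a loop cap in variable 2. -/
def main : FP :=
  setSizes ;; setLog ;;
  ite (.sub (v 5) (v 4)) certify (fill 1 29 30 (rd 0 (v 29) (v 30)))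

/-- In truncated arithmetic the first summand is 1 exactly if u < n and w = n + u, a split edge. The
second is the input entry at (u - n, w) if u ≥ n and 0 otherwise, since entries are at most 1. -/
theorem splitGraph_spec {ω : ℕ → Bool} {n : ℕ} {s : State} (h3 : s.var 3 = 2 * n + 1)
    (h2 : 2 * n + 1 ≤ s.var 2) (h0 : s.var 0 = n) (G : Digraph (Fin n))
    (hG1 : ∀ i j, s.arr 0 i j ≤ 1)
    (hG : ∀ i j, s.arr 0 i j ≠ 0 ↔ ∃ u w : Fin n, u.val = i ∧ w.val = j ∧ G.Adj u w) :
    (∀ u w, mat (2 * n + 1) (sem ω splitGraph s) 2 u w ≤ 1) ∧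
      supp (mat (2 * n + 1) (sem ω splitGraph s) 2) = splitRel G := by
  have hval : ∀ u w, mat (2 * n + 1) (sem ω splitGraph s) 2 u w =
      1 - (w - (n + u) + (n + u - w)) - (u + 1 - n) + (s.arr 0 (u - n) w - (n - u)) := by
    intro i j
    have := sem_fill (ω := ω) (a := 2) (x := 29) (y := 30) (e := .add
      (.sub (.sub (num 1) (neq (v 30) (.add (v 0) (v 29)))) (.sub (.add (v 29) (num 1)) (v 0)))
      (.sub (rd 0 (.sub (v 29) (v 0)) (v 30)) (.sub (v 0) (v 29)))) (by decide)
      (by decide) (by decide) (by decide) (by decide) h3 h2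
      (fun u w => 1 - (w - (n + u) + (n + u - w)) - (u + 1 - n) +
        (s.arr 0 (u - n) w - (n - u))) (by
        intro s₁ i j hi hj hv ha
        simp only [Expr.eval, hi, hj, ha 0 (by decide), hv 0 (by decide) (by decide), h0]) i j
    rw [mat, splitGraph, this, if_pos ⟨i.2, j.2⟩]
  constructor
  · intro u w
    rw [hval]
    have := hG1 (u - n) w
    omega
  · funext u w
    rw [supp, hval]
    have h1 := hG1 (u - n) w
    have h4 := hG (u - n) w
    have hu := u.2
    have hw := w.2
    apply propext
    constructor
    · intro h
      by_cases hun : (u : ℕ) < n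
      · exact Or.inl ⟨⟨u, hun⟩, Fin.ext rfl, Fin.ext (by show (w : ℕ) = n + u; omega)⟩
      · obtain ⟨i, j, hi, hj, hij⟩ := h4.1 (by omega)
        exact Or.inr ⟨i, j, hij, Fin.ext (by show (u : ℕ) = n + i; omega), Fin.ext hj.symm⟩
    · rintro (⟨i, rfl, rfl⟩ | ⟨i, j, hij, rfl, rfl⟩)
      · have := i.2
        simp only [inn, out]
        omega
      · have := i.2
        have h5 : s.arr 0 (↑(out i) - n) ↑(inn j) ≠ 0 := h4.2 ⟨i, j, by simp [out], rfl, hij⟩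
        have h6 : (out i : ℕ) = n + i := rfl
        omega

/-- Every loop bound is at most 64 N^4, and N ≤ 3n, so 64 · 81 n^4 is below the cap. The number of
samples is the largest: its exponent is at most 2(b - 1), and 2^(b-1) < N. -/
theorem cap_bounds {n b f a : ℕ} (hn : 1 ≤ n) (hb : b = Nat.clog 2 (2 * n + 1)) (hf : 1 ≤ f)
    (hfb : f < b) (ha : a * f < b) :
    2 * n + 1 ≤ 30000 * n ^ 4 ∧ b ≤ 30000 * n ^ 4 ∧ a + 1 ≤ 30000 * n ^ 4 ∧
      b * (b * 64) * 2 ^ (b - (a + 1)) ≤ 30000 * n ^ 4 ∧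
      b * (b * 64) * 2 ^ ((a + 1) * (f - 1)) ≤ 30000 * n ^ 4 := by
  set N := 2 * n + 1 with hN
  have hlt : 2 ^ (b - 1) < N := hb ▸ Nat.pow_pred_clog_lt_self (by omega) (by omega)
  have hbN : b ≤ N := by
    have := (b - 1).lt_two_pow_self
    omega
  have hab : a < b := lt_of_le_of_lt (Nat.le_mul_of_pos_right a hf) ha
  have hN3 : N ≤ 3 * n := by omega
  have hN4 : N ^ 4 ≤ 81 * n ^ 4 := by
    calc N ^ 4 ≤ (3 * n) ^ 4 := Nat.pow_le_pow_left hN3 4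
      _ = 81 * n ^ 4 := by ring
  have hN1 : N ≤ N ^ 4 := Nat.le_self_pow (by omega) N
  have hTN : b * (b * 64) ≤ 64 * N ^ 2 := by nlinarith
  refine ⟨by omega, by omega, by omega, ?_, ?_⟩
  · have h1 : 2 ^ (b - (a + 1)) ≤ N := (Nat.pow_le_pow_right (by omega) (by omega)).trans hlt.le
    calc b * (b * 64) * 2 ^ (b - (a + 1)) ≤ 64 * N ^ 2 * N := Nat.mul_le_mul hTN h1
      _ = 64 * N ^ 3 := by ring
      _ ≤ 64 * N ^ 4 := Nat.mul_le_mul_left _ (Nat.pow_le_pow_right (by omega) (by omega))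
      _ ≤ 30000 * n ^ 4 := by omega
  · have h1 : (a + 1) * (f - 1) ≤ (b - 1) * 2 := by
      obtain ⟨g, rfl⟩ : ∃ g, f = g + 1 := ⟨f - 1, by omega⟩
      have h2 : (a + 1) * g ≤ a * (g + 1) + g := by ring_nf; omega
      simp only [Nat.add_sub_cancel]
      omega
    have h2 : 2 ^ ((a + 1) * (f - 1)) ≤ N ^ 2 := by
      refine (Nat.pow_le_pow_right (by omega) h1).trans ?_
      rw [pow_mul]
      exact Nat.pow_le_pow_left hlt.le 2
    calc b * (b * 64) * 2 ^ ((a + 1) * (f - 1)) ≤ 64 * N ^ 2 * N ^ 2 := Nat.mul_le_mul hTN h2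
      _ = 64 * N ^ 4 := by ring
      _ ≤ 30000 * n ^ 4 := by omega

/-- What the certificate computation guarantees for the coin outcomes `ω`. -/
structure Outcome {n : ℕ} (ω : ℕ → Bool) (G : Digraph (Fin n)) (f b a M Q : ℕ)
    (H : Fin (2 * n + 1) → Fin (2 * n + 1) → Prop) : Prop where
  sub : ∀ u w, H u w → splitRel G u w
  sample : ∀ t < M, ∃ Γ : Fin (2 * n + 1) → Fin (2 * n + 1) → Prop,
    FT1 (del (splitRel G) (faults (2 * n + 1) ω (t * ((2 * n + 1) * (2 * n + 1) * a)) a)) Γ ∧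
    (∀ u w, Γ u w →
      del (splitRel G) (faults (2 * n + 1) ω (t * ((2 * n + 1) * (2 * n + 1) * a)) a) u w) ∧
    ∀ u w, Γ u w → H u w
  root : ∀ i < Q, ∀ r : Fin (2 * n + 1), (r : ℕ) ≠ 2 * n →
    rootVal ω (M * ((2 * n + 1) * (2 * n + 1) * a) + i * b) b = r →
    ∀ F : Finset (Fin (2 * n + 1) × Fin (2 * n + 1)), F.card ≤ f → ∀ w,
      (Reach (del (splitRel G) F) r w → Reach (del H F) r w) ∧
      (Reach (del (splitRel G) F) w r → Reach (del H F) w r)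
  size : ∃ S : Finset (Fin (2 * n + 1) × Fin (2 * n + 1)),
    S.card ≤ M * (32 * (2 * n + 1) * (Nat.log 2 (2 * n + 1) + 1)) +
      Q * (2 * (2 * n + 1) * 2 ^ f) ∧ ∀ u w, H u w → (u, w) ∈ S

theorem certify_spec {ω : ℕ → Bool} {n f b : ℕ} {s : State} (hn : 1 ≤ n)
    (h3 : s.var 3 = 2 * n + 1) (h9 : s.var 9 = 2 * n) (h4 : s.var 4 = f) (h5 : s.var 5 = b)
    (h2 : 30000 * n ^ 4 ≤ s.var 2) (h0 : s.var 0 = n) (hf : 1 ≤ f) (hfb : f < b)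
    (hb : b = Nat.clog 2 (2 * n + 1)) (hu : s.used = 0) (hs3 : ∀ i j, s.arr 3 i j = 0)
    (G : Digraph (Fin n)) (hG1 : ∀ i j, s.arr 0 i j ≤ 1)
    (hG : ∀ i j, s.arr 0 i j ≠ 0 ↔ ∃ u w : Fin n, u.val = i ∧ w.val = j ∧ G.Adj u w) :
    ∃ a, a * f < b ∧ b ≤ (a + 1) * f ∧ ∃ H : Fin (2 * n + 1) → Fin (2 * n + 1) → Prop,
      Outcome ω G f b (a + 1) (b * (b * 64) * 2 ^ ((a + 1) * (f - 1)))
        (b * (b * 64) * 2 ^ (b - (a + 1))) H ∧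
      outputGraph n (sem ω certify s) = unsplit H := by
  rw [certify]
  simp only [sem_seq]
  have hbN : b ≤ s.var 2 := ((cap_bounds (a := 0) hn hb hf hfb (by omega)).2.1).trans h2
  obtain ⟨a, e6, ha, ha'⟩ := setExp_spec (ω := ω) h5 hbN h4 hf (by omega)
  obtain ⟨c1, c2, c3, c4, c5⟩ := cap_bounds hn hb hf hfb ha
  refine ⟨a, ha, ha', ?_⟩
  have fr := frame_sem ω setExp s
  generalize sem ω setExp s = s₁ at e6 fr ⊢
  have k2 := fr.var 2 (by decide)
  have k5 := (fr.var 5 (by decide)).trans h5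
  have k4 := (fr.var 4 (by decide)).trans h4
  have e53 := setReps_spec (ω := ω) k5 (by rw [k2]; exact hbN)
  have fr₂ := frame_sem ω setReps s₁
  generalize sem ω setReps s₁ = s₂ at e53 fr₂ ⊢
  have l2 : s₂.var 2 = s.var 2 := (fr₂.var 2 (by decide)).trans k2
  have l6 := (fr₂.var 6 (by decide)).trans e6
  have e8 := setRoots_spec (ω := ω) ((fr₂.var 5 (by decide)).trans k5) (by rw [l2]; exact hbN)
    l6 e53
  have fr₃ := frame_sem ω setRoots s₂
  generalize sem ω setRoots s₂ = s₃ at e8 fr₃ ⊢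
  have m2 : s₃.var 2 = s.var 2 := (fr₃.var 2 (by decide)).trans l2
  have e7 := setSamples_spec (ω := ω) (s := s₃)
    ((fr₃.var 4 (by decide)).trans ((fr₂.var 4 (by decide)).trans k4)) (by omega)
    ((fr₃.var 6 (by decide)).trans l6) (by omega) ((fr₃.var 53 (by decide)).trans e53)
  have fr₄ := frame_sem ω setSamples s₃
  generalize sem ω setSamples s₃ = s₄ at e7 fr₄ ⊢
  have g : ∀ z, z ∉ setExp.mv → z ∉ setReps.mv → z ∉ setRoots.mv → z ∉ setSamples.mv →
      s₄.var z = s.var z := fun z z1 z2 z3 z4 => by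
    rw [fr₄.var z z4, fr₃.var z z3, fr₂.var z z2, fr.var z z1]
  have garr : s₄.arr = s.arr := by
    funext z
    rw [fr₄.arr z (by simp [ma, setSamples]), fr₃.arr z (by simp [ma, setRoots]),
      fr₂.arr z (by simp [ma, setReps]), fr.arr z (by simp [ma, setExp])]
  have gu : s₄.used = 0 := by rw [fr₄.used rfl, fr₃.used rfl, fr₂.used rfl, fr.used rfl, hu]
  have g3 : s₄.var 3 = 2 * n + 1 := by
    rw [g 3 (by decide) (by decide) (by decide) (by decide), h3]
  have g2 := g 2 (by decide) (by decide) (by decide) (by decide)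
  have g0 : s₄.var 0 = n := by rw [g 0 (by decide) (by decide) (by decide) (by decide), h0]
  have g9 : s₄.var 9 = 2 * n := by rw [g 9 (by decide) (by decide) (by decide) (by decide), h9]
  have g5 : s₄.var 5 = b := by rw [g 5 (by decide) (by decide) (by decide) (by decide), h5]
  have g4 : s₄.var 4 = f := by rw [g 4 (by decide) (by decide) (by decide) (by decide), h4]
  have g6 : s₄.var 6 = a + 1 := by rw [fr₄.var 6 (by decide), fr₃.var 6 (by decide), l6]
  have g8 := (fr₄.var 8 (by decide)).trans e8
  obtain ⟨p1, p2⟩ := splitGraph_spec (ω := ω) g3 (by omega) g0 G (by rw [garr]; exact hG1)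
    (by rw [garr]; exact hG)
  have fr₅ := frame_sem ω splitGraph s₄
  generalize sem ω splitGraph s₄ = s₅ at p1 p2 fr₅ ⊢
  have hr₀ : ((⟨2 * n, by omega⟩ : Fin (2 * n + 1)) : ℕ) + 1 = 2 * n + 1 := rfl
  have q9 : s₅.var 9 = (⟨2 * n, by omega⟩ : Fin (2 * n + 1)) := (fr₅.var 9 (by decide)).trans g9
  have hr₀' : ((⟨2 * n, by omega⟩ : Fin (2 * n + 1)) : ℕ) = 2 * n := rfl
  generalize (⟨2 * n, by omega⟩ : Fin (2 * n + 1)) = r₀ at hr₀ q9 hr₀'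
  have q2 := (fr₅.var 2 (by decide)).trans g2
  have q3 := (fr₅.var 3 (by decide)).trans g3
  have hN : 2 ^ f < 2 * n + 1 := by
    refine lt_of_le_of_lt (Nat.pow_le_pow_right (by omega) (by omega : f ≤ b - 1)) ?_
    exact hb ▸ Nat.pow_pred_clog_lt_self (by omega) (by omega)
  have iso := splitRel_isolated (G := G) hr₀'
  obtain ⟨o1, o2, o3, o4⟩ := core_spec (ω := ω) (s := s₅) (N := 2 * n + 1) (r₀ := r₀) q3
    (by omega) q9 hr₀
    ((fr₅.var 5 (by decide)).trans g5) (by omega) ((fr₅.var 6 (by decide)).trans g6) (by omega)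
    ((fr₅.var 7 (by decide)).trans e7) (by omega) ((fr₅.var 8 (by decide)).trans g8) (by omega)
    ((fr₅.var 4 (by decide)).trans g4) hN p1
    (fun w => by
      by_contra h
      have : supp (mat (2 * n + 1) s₅ 2) r₀ w := h
      rw [p2] at this
      exact (iso w).1 this)
    (fun w => by
      by_contra h
      have : supp (mat (2 * n + 1) s₅ 2) w r₀ := h
      rw [p2] at this
      exact (iso w).2 this)
    ((fr₅.used rfl).trans gu)
    (fun u w h => h (by rw [mat, fr₅.arr 3 (by decide), garr]; exact hs3 u w))
  have fr₆ := frame_sem ω core s₅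
  generalize sem ω core s₅ = s₆ at o1 o2 o3 o4 fr₆ ⊢
  rw [p2] at o1 o2 o3
  refine ⟨supp (mat (2 * n + 1) s₆ 3), ⟨o1, o2, ?_, o4⟩, ?_⟩
  · intro i hi r hr
    exact o3 i hi r (fun h => hr (by rw [h, hr₀']))
  · have r0 : s₆.var 0 = n := by rw [fr₆.var 0 (by decide), fr₅.var 0 (by decide), g0]
    have := sem_fill (ω := ω) (a := 1) (x := 29) (y := 30) (e := rd 3 (.add (v 0) (v 29)) (v 30))
      (by decide) (by decide) (by decide) (by decide) (by decide)
      ((fr₆.var 3 (by decide)).trans q3) (by rw [fr₆.var 2 (by decide)]; omega)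
      (fun i j => s₆.arr 3 (n + i) j) (by
        intro s' i j hi hj hv ha
        simp only [Expr.eval, hi, hj, hv 0 (by decide) (by decide), r0, ha 3 (by decide)])
    ext i j
    simp only [outputGraph, unsplitGraph, this, unsplit, supp, mat, out, inn]
    rw [if_pos ⟨by omega, by omega⟩]

theorem main_spec {ω : ℕ → Bool} {n k : ℕ} {s : State} (hn : 1 ≤ n) (hk : 2 ≤ k)
    (h0 : s.var 0 = n) (h1 : s.var 1 = k)
    (h2 : 30000 * n ^ 4 ≤ s.var 2) (hu : s.used = 0) (hs3 : ∀ i j, s.arr 3 i j = 0)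
    (G : Digraph (Fin n)) (hG1 : ∀ i j, s.arr 0 i j ≤ 1)
    (hG : ∀ i j, s.arr 0 i j ≠ 0 ↔ ∃ u w : Fin n, u.val = i ∧ w.val = j ∧ G.Adj u w) :
    (Nat.clog 2 (2 * n + 1) ≤ k - 1 → outputGraph n (sem ω main s) = G) ∧
    (k - 1 < Nat.clog 2 (2 * n + 1) → ∃ a, a * (k - 1) < Nat.clog 2 (2 * n + 1) ∧
      Nat.clog 2 (2 * n + 1) ≤ (a + 1) * (k - 1) ∧
      ∃ H : Fin (2 * n + 1) → Fin (2 * n + 1) → Prop,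
        Outcome ω G (k - 1) (Nat.clog 2 (2 * n + 1)) (a + 1)
          (Nat.clog 2 (2 * n + 1) * (Nat.clog 2 (2 * n + 1) * 64) *
            2 ^ ((a + 1) * (k - 1 - 1)))
          (Nat.clog 2 (2 * n + 1) * (Nat.clog 2 (2 * n + 1) * 64) *
            2 ^ (Nat.clog 2 (2 * n + 1) - (a + 1))) H ∧
        outputGraph n (sem ω main s) = unsplit H) := by
  have hcap : 2 * n + 1 ≤ 30000 * n ^ 4 := by
    have := Nat.le_self_pow (n := 4) (by omega) n
    omega
  rw [main, sem_seq, sem_seq]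
  obtain ⟨e9, e3, e4⟩ := setSizes_spec (ω := ω) h0 h1
  have fr := frame_sem ω setSizes s
  generalize sem ω setSizes s = s₁ at e9 e3 e4 fr ⊢
  have k2 := fr.var 2 (by decide)
  have e5 := setLog_spec (ω := ω) e3 (by omega)
  have fr₂ := frame_sem ω setLog s₁
  generalize sem ω setLog s₁ = s₂ at e5 fr₂ ⊢
  have l2 := (fr₂.var 2 (by decide)).trans k2
  have l4 := (fr₂.var 4 (by decide)).trans e4
  have l3 := (fr₂.var 3 (by decide)).trans e3
  have larr : s₂.arr = s.arr := by
    funext z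
    rw [fr₂.arr z (by simp [ma, setLog]), fr.arr z (by simp [ma, setSizes])]
  constructor
  · intro hle
    rw [sem, if_neg (by simp only [Expr.eval, e5, l4]; omega)]
    have := sem_fill (ω := ω) (a := 1) (x := 29) (y := 30) (e := rd 0 (v 29) (v 30))
      (by decide) (by decide) (by decide) (by decide) (by decide) l3 (by omega)
      (fun i j => s.arr 0 i j) (by
        intro s' i j hi hj hv ha
        simp only [Expr.eval, hi, hj, ha 0 (by decide), larr])
    ext i j
    simp only [outputGraph, this]
    rw [if_pos ⟨by omega, by omega⟩, hG]
    constructor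
    · rintro ⟨u, w, hu, hw, h⟩
      rwa [Fin.ext hu, Fin.ext hw] at h
    · exact fun h => ⟨i, j, rfl, rfl, h⟩
  · intro hlt
    rw [sem, if_pos (by simp only [Expr.eval, e5, l4]; omega)]
    exact certify_spec hn l3 ((fr₂.var 9 (by decide)).trans e9) l4 e5 (by omega)
      (by rw [fr₂.var 0 (by decide), fr.var 0 (by decide), h0]) (by omega) hlt rfl
      (by rw [fr₂.used rfl, fr.used rfl, hu]) (by rw [larr]; exact hs3) G
      (by rw [larr]; exact hG1) (by rw [larr]; exact hG)

end FP
end ConnCert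

namespace ConnCert

/-! ### The failure probability -/

/-- A set with at most f elements is listed by f entries, each an element or blank. -/
theorem card_filter_card_le {α : Type*} [Fintype α] [DecidableEq α] (f : ℕ) :
    (Finset.univ.filter fun F : Finset α => F.card ≤ f).card ≤ (Fintype.card α + 1) ^ f := by
  have h1 : (Finset.univ.filter fun F : Finset α => F.card ≤ f) ⊆
      Finset.univ.image fun φ : Fin f → Option α => (Finset.univ.image φ).eraseNone := by
    intro F hF
    simp only [Finset.mem_filter, Finset.mem_univ, true_and] at hF
    refine Finset.mem_image.2 ⟨fun i => F.toList[(i : ℕ)]?, Finset.mem_univ _, ?_⟩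
    ext e
    simp only [Finset.mem_eraseNone, Finset.mem_image, Finset.mem_univ, true_and]
    rw [← Finset.mem_toList, List.mem_iff_getElem?]
    constructor
    · rintro ⟨i, hi⟩; exact ⟨i, hi⟩
    · rintro ⟨i, hi⟩
      obtain ⟨hlt, -⟩ := List.getElem?_eq_some_iff.1 hi
      exact ⟨⟨i, by rw [Finset.length_toList] at hlt; omega⟩, hi⟩
  refine (Finset.card_le_card h1).trans (Finset.card_image_le.trans ?_)
  simp

/-- Bounded failure probabilities over a finite family. -/
theorem coins_biUnion_le {ι : Type*} (I : Finset ι) (B : ι → Set (ℕ → Bool)) (δ : ℝ)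
    (h : ∀ i ∈ I, coins.real (B i) ≤ δ) : coins.real (⋃ i ∈ I, B i) ≤ I.card * δ := by
  refine (measureReal_biUnion_finset_le I B).trans ?_
  exact (Finset.sum_le_card_nsmul _ _ _ h).trans (by simp)

/-- Bernoulli's inequality with half the exponent gives 1/2, and squaring gives 1/4. -/
theorem quarter_le {A : ℕ} (hA : 1 ≤ A) : (1 / 4 : ℝ) ≤ (1 - 1 / 2 ^ A) ^ (2 ^ A) := by
  obtain ⟨c, rfl⟩ : ∃ c, A = c + 1 := ⟨A - 1, by omega⟩
  have h1 : (0 : ℝ) < 2 ^ c := by positivity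
  have h2 : (1 : ℝ) / 2 ^ (c + 1) ≤ 1 := by
    rw [div_le_one (by positivity)]
    exact one_le_pow₀ (by norm_num)
  have h3 := one_add_mul_le_pow (a := -(1 / 2 ^ (c + 1) : ℝ)) (by linarith) (2 ^ c)
  have h4 : (1 : ℝ) + ((2 ^ c : ℕ) : ℝ) * -(1 / 2 ^ (c + 1)) = 1 / 2 := by
    push_cast; field_simp; ring
  rw [h4] at h3
  have h5 : (1 - 1 / 2 ^ (c + 1) : ℝ) = 1 + -(1 / 2 ^ (c + 1)) := by ring
  have h6 : (2 : ℕ) ^ (c + 1) = 2 ^ c * 2 := pow_succ 2 c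
  rw [h5, h6, pow_mul]
  calc (1 / 4 : ℝ) = (1 / 2) ^ 2 := by norm_num
    _ ≤ _ := pow_le_pow_left₀ (by norm_num) h3 2

theorem one_sub_pow_le_exp {ρ c : ℝ} {M : ℕ} (hρ : ρ ≤ 1) (hc : c ≤ M * ρ) :
    (1 - ρ) ^ M ≤ Real.exp (-c) := by
  calc (1 - ρ) ^ M ≤ (Real.exp (-ρ)) ^ M :=
        pow_le_pow_left₀ (by linarith) (Real.one_sub_le_exp_neg ρ) M
    _ = Real.exp (M * -ρ) := (Real.exp_nat_mul _ _).symm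
    _ ≤ Real.exp (-c) := Real.exp_le_exp.2 (by linarith)

theorem root_miss_le {p b A T : ℕ} (C : Finset ℕ) (hC : ∀ c ∈ C, c < 2 ^ b) (hA : A ≤ b)
    (hlarge : 2 ^ A < 2 * C.card) :
    coins.real {ω | ∀ i < T * 2 ^ (b - A), rootVal ω (p + i * b) b ∉ C} ≤
      Real.exp (-(T / 4 : ℝ)) := by
  rw [coins_root_miss p b _ C hC]
  have hcard : C.card ≤ 2 ^ b := by
    have : C ⊆ Finset.range (2 ^ b) := fun c hc => Finset.mem_range.2 (hC c hc)
    simpa using Finset.card_le_card this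
  have hcard' : (C.card : ℝ) ≤ 2 ^ b := by exact_mod_cast hcard
  have hl : (2 : ℝ) ^ A ≤ 2 * C.card := by exact_mod_cast hlarge.le
  refine one_sub_pow_le_exp ((div_le_one (by positivity)).2 hcard') ?_
  have hb : (2 : ℝ) ^ b = 2 ^ A * 2 ^ (b - A) := by rw [← pow_add]; congr 1; omega
  have h1 : (0 : ℝ) < 2 ^ A := by positivity
  have h2 : (0 : ℝ) < 2 ^ (b - A) := by positivity
  push_cast
  rw [hb]
  have : (T : ℝ) * 2 ^ (b - A) * (C.card / (2 ^ A * 2 ^ (b - A))) = T * (C.card / 2 ^ A) := by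
    field_simp
  rw [this]
  have h3 : (1 : ℝ) / 4 ≤ C.card / 2 ^ A := by
    rw [div_le_div_iff₀ (by norm_num) h1]; linarith
  have h4 : (0 : ℝ) ≤ T := Nat.cast_nonneg T
  nlinarith

theorem sample_miss_le {N p A T f : ℕ} (F S : Finset (Fin N × Fin N)) (hFS : Disjoint F S)
    (hA : 1 ≤ A) (hF : F.card ≤ f - 1) (hS : S.card ≤ 2 ^ A) :
    coins.real {ω | ∀ t < T * 2 ^ (A * (f - 1)), ¬ (F ⊆ FP.faults N ω (p + t * (N * N * A)) A ∧
      Disjoint (FP.faults N ω (p + t * (N * N * A)) A) S)} ≤ Real.exp (-(T / 4 : ℝ)) := by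
  have hset : {ω | ∀ t < T * 2 ^ (A * (f - 1)), ¬ (F ⊆ FP.faults N ω (p + t * (N * N * A)) A ∧
      Disjoint (FP.faults N ω (p + t * (N * N * A)) A) S)} =
      {ω | ∀ t < T * 2 ^ (A * (f - 1)),
        ¬ ((∀ e ∈ F, AllHeads ω (p + t * (N * N * A) + pairPos A e) A) ∧
          ∀ e ∈ S, ¬ AllHeads ω (p + t * (N * N * A) + pairPos A e) A)} := by
    ext ω
    simp only [Set.mem_ofPred_eq]
    refine forall₂_congr fun t _ => not_congr (and_congr ?_ ?_)
    · exact forall₂_congr fun e _ => FP.mem_faults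
    · rw [Finset.disjoint_right]
      exact forall₂_congr fun e _ => not_congr FP.mem_faults
  rw [hset, coins_sample_miss p A _ F S hFS]
  have hq : (0 : ℝ) < 2 ^ A := by positivity
  have hq1 : (1 : ℝ) / 2 ^ A ≤ 1 := by
    rw [div_le_one hq]; exact one_le_pow₀ (by norm_num)
  have hq0 : (0 : ℝ) ≤ 1 / 2 ^ A := by positivity
  have h1 : (1 / 2 ^ A : ℝ) ^ (f - 1) ≤ (1 / 2 ^ A) ^ F.card := pow_le_pow_of_le_one hq0 hq1 hF
  have h2 : (1 / 4 : ℝ) ≤ (1 - 1 / 2 ^ A) ^ S.card :=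
    (quarter_le hA).trans (pow_le_pow_of_le_one (by linarith) (by linarith) hS)
  refine one_sub_pow_le_exp ?_ ?_
  · exact mul_le_one₀ (pow_le_one₀ hq0 hq1) (pow_nonneg (by linarith) _)
      (pow_le_one₀ (by linarith) (by linarith))
  · have h3 : (1 / 2 ^ A : ℝ) ^ (f - 1) * (1 / 4) ≤
        (1 / 2 ^ A) ^ F.card * (1 - 1 / 2 ^ A) ^ S.card :=
      mul_le_mul h1 h2 (by norm_num) (pow_nonneg hq0 _)
    have h4 : (T / 4 : ℝ) = ((T * 2 ^ (A * (f - 1)) : ℕ) : ℝ) * ((1 / 2 ^ A) ^ (f - 1) * (1 / 4)) := by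
      push_cast
      rw [one_div, inv_pow, ← pow_mul]
      field_simp
    rw [h4]
    exact mul_le_mul_of_nonneg_left h3 (Nat.cast_nonneg _)

/-- The coin outcomes serve the fault set `F` and the component of `x`. -/
def Served {N : ℕ} (E : Fin N → Fin N → Prop) (A M Q b : ℕ) (ω : ℕ → Bool)
    (F : Finset (Fin N × Fin N)) (x : Fin N) : Prop :=
  (∃ i < Q, ∃ r, SC (del E F) x r ∧ rootVal ω (M * (N * N * A) + i * b) b = (r : ℕ)) ∨
  ∃ t < M, ∃ (S : Finset (Fin N × Fin N)) (g : Fin N × Fin N), (∀ e ∈ S, del E F e.1 e.2) ∧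
    (∀ y, SC (del E F) x y → SC (rel S) x y) ∧ (g ∈ F ∨ ¬ E g.1 g.2) ∧
    F.erase g ⊆ FP.faults N ω (t * (N * N * A)) A ∧ Disjoint (FP.faults N ω (t * (N * N * A)) A) S

/-- A large component is met by a random root. A small one has a spanning subgraph with at most 2^A
edges, so a sampled fault set avoids it with probability at least 1/4 and contains the other at most
f - 1 faults with probability at least 2^(-A(f-1)). -/
theorem not_served_le {N A T f b : ℕ} (E : Fin N → Fin N → Prop) (r₀ : Fin N)
    (h0 : ¬ E r₀ r₀) (hN : N ≤ 2 ^ b) (hA : 1 ≤ A) (hAb : A ≤ b) (F : Finset (Fin N × Fin N))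
    (hF : F.card ≤ f) (x : Fin N) :
    coins.real {ω | ¬ Served E A (T * 2 ^ (A * (f - 1))) (T * 2 ^ (b - A)) b ω F x} ≤
      Real.exp (-(T / 4 : ℝ)) := by
  by_cases hlarge : 2 ^ A < 2 * (comp (del E F) x).card
  · set C := (comp (del E F) x).image Fin.val with hC
    have hcard : C.card = (comp (del E F) x).card :=
      Finset.card_image_of_injective _ Fin.val_injective
    refine le_trans (measureReal_mono ?_ (measure_ne_top _ _)) (root_miss_le (T := T)
      (p := T * 2 ^ (A * (f - 1)) * (N * N * A)) C ?_ hAb (by rw [hcard]; exact hlarge))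
    · intro ω hω i hi hmem
      obtain ⟨r, hr, hr'⟩ := Finset.mem_image.1 hmem
      exact hω (Or.inl ⟨i, hi, r, mem_comp.1 hr, hr'.symm⟩)
    · intro c hc
      obtain ⟨r, -, rfl⟩ := Finset.mem_image.1 hc
      exact r.2.trans_le hN
  · obtain ⟨S, hS, hcard, hSC⟩ := exists_sparse (del E F) x
    -- If there are no faults, the loop at the isolated vertex serves as the non-edge `g`.
    obtain ⟨g, hg, hgF⟩ : ∃ g : Fin N × Fin N, (g ∈ F ∨ ¬ E g.1 g.2) ∧
        (F.erase g).card ≤ f - 1 := by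
      rcases F.eq_empty_or_nonempty with rfl | ⟨g, hg⟩
      · exact ⟨(r₀, r₀), Or.inr h0, by simp⟩
      · exact ⟨g, Or.inl hg, by rw [Finset.card_erase_of_mem hg]; omega⟩
    refine le_trans (measureReal_mono ?_ (measure_ne_top _ _)) (sample_miss_le (T := T)
      (p := 0) (F.erase g) S ?_ hA hgF (by omega))
    · rintro ω hω t ht ⟨h1, h2⟩
      rw [zero_add] at h1 h2
      exact hω (Or.inr ⟨t, ht, S, g, hS, hSC, hg, h1, h2⟩)
    · rw [Finset.disjoint_left]
      intro e he heS
      exact (hS e heS).2 (Finset.mem_of_mem_erase he)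

theorem not_all_served_le {n N A f b : ℕ} (E : Fin N → Fin N → Prop) (r₀ : Fin N)
    (h0 : ¬ E r₀ r₀) (hn : 1 ≤ n) (hnN : n ≤ N) (hN : N ≤ 2 ^ b) (hA : 1 ≤ A) (hAb : A ≤ b)
    (hfb : f < b) :
    coins.real {ω | ¬ ∀ F : Finset (Fin N × Fin N), F.card ≤ f → ∀ x,
      Served E A (b * (b * 64) * 2 ^ (A * (f - 1))) (b * (b * 64) * 2 ^ (b - A)) b ω F x} ≤
      1 / (n : ℝ) ^ 4 := by
  classical
  set I : Finset (Finset (Fin N × Fin N) × Fin N) :=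
    (Finset.univ.filter fun F : Finset (Fin N × Fin N) => F.card ≤ f) ×ˢ Finset.univ with hI
  have hIcard : I.card ≤ 2 ^ (3 * b * f + b) := by
    rw [hI, Finset.card_product, Finset.card_univ, Fintype.card_fin, pow_add, pow_mul]
    refine Nat.mul_le_mul ((card_filter_card_le f).trans (Nat.pow_le_pow_left ?_ f)) hN
    rw [Fintype.card_prod, Fintype.card_fin]
    have h1 : N * N ≤ 2 ^ b * 2 ^ b := Nat.mul_le_mul hN hN
    have h2 : 2 ≤ 2 ^ b := by
      calc 2 = 2 ^ 1 := rfl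
        _ ≤ 2 ^ b := Nat.pow_le_pow_right (by omega) (by omega)
    have h3 : 2 ^ (3 * b) = 2 ^ b * 2 ^ b * 2 ^ b := by rw [← pow_add, ← pow_add]; congr 1; ring
    rw [h3]
    have h4 : 1 ≤ 2 ^ b * 2 ^ b := Nat.one_le_two_pow.trans (Nat.le_mul_of_pos_left _ (by omega))
    nlinarith
  have hsub : {ω | ¬ ∀ F : Finset (Fin N × Fin N), F.card ≤ f → ∀ x,
      Served E A (b * (b * 64) * 2 ^ (A * (f - 1))) (b * (b * 64) * 2 ^ (b - A)) b ω F x} ⊆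
      ⋃ p ∈ I, {ω | ¬ Served E A (b * (b * 64) * 2 ^ (A * (f - 1)))
        (b * (b * 64) * 2 ^ (b - A)) b ω p.1 p.2} := by
    intro ω hω
    simp only [Set.mem_ofPred_eq] at hω
    push Not at hω
    obtain ⟨F, hF, x, hx⟩ := hω
    exact Set.mem_biUnion (x := (F, x)) (by simp [hI, hF]) hx
  refine (measureReal_mono hsub (measure_ne_top _ _)).trans ((coins_biUnion_le I _
    (Real.exp (-(((b * (b * 64) : ℕ) : ℝ) / 4))) fun p hp => ?_).trans ?_)
  · exact not_served_le E r₀ h0 hN hA hAb p.1 (by simpa [hI] using hp) p.2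
  -- The 64 in the number of repetitions becomes 16 after division by 4, and e ≥ 2.
  have hexp : Real.exp (-(((b * (b * 64) : ℕ) : ℝ) / 4)) ≤ 1 / 2 ^ (16 * b * b) := by
    have h1 : -(((b * (b * 64) : ℕ) : ℝ) / 4) = ((16 * b * b : ℕ) : ℝ) * (-1) := by
      push_cast; ring
    rw [h1, Real.exp_nat_mul, one_div, ← inv_pow]
    refine pow_le_pow_left₀ (Real.exp_pos _).le ?_ _
    rw [Real.exp_neg]
    exact inv_anti₀ (by norm_num) (by have := Real.add_one_le_exp (1 : ℝ); linarith)
  have hIr : (I.card : ℝ) ≤ 2 ^ (3 * b * f + b) := by exact_mod_cast hIcard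
  -- The terms stand for the fault sets, the vertices x, and the target n^4 ≤ 2^(4b).
  have hle : 3 * b * f + b + 4 * b ≤ 16 * b * b := by
    have h1 : 3 * b * f ≤ 3 * b * b := Nat.mul_le_mul_left _ hfb.le
    nlinarith
  have hn4 : (n : ℝ) ^ 4 ≤ 2 ^ (4 * b) := by
    rw [mul_comm 4 b, pow_mul]
    refine pow_le_pow_left₀ (by positivity) ?_ 4
    exact_mod_cast hnN.trans hN
  have hn0 : (0 : ℝ) < (n : ℝ) ^ 4 := by positivity
  calc (I.card : ℝ) * Real.exp (-(((b * (b * 64) : ℕ) : ℝ) / 4))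
      ≤ 2 ^ (3 * b * f + b) * (1 / 2 ^ (16 * b * b)) :=
        mul_le_mul hIr hexp (Real.exp_pos _).le (by positivity)
    _ ≤ 1 / 2 ^ (4 * b) := by
        rw [mul_one_div, div_le_div_iff₀ (by positivity) (by positivity), one_mul, ← pow_add]
        exact pow_le_pow_right₀ (by norm_num) hle
    _ ≤ 1 / (n : ℝ) ^ 4 := one_div_le_one_div_of_le hn0 hn4

theorem FP.Outcome.ftss {n : ℕ} {ω : ℕ → Bool} {G : Digraph (Fin n)} {f b A M Q : ℕ}
    {H : Fin (2 * n + 1) → Fin (2 * n + 1) → Prop} (h : FP.Outcome ω G f b A M Q H)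
    (hs : ∀ F : Finset (Fin (2 * n + 1) × Fin (2 * n + 1)), F.card ≤ f → ∀ x,
      Served (splitRel G) A M Q b ω F x) : FTSS f (splitRel G) H := by
  refine FTSS.of_cases fun F hF x => ?_
  rcases hs F hF x with ⟨i, hi, r, hr, hr'⟩ | ⟨t, ht, S, g, hS, hSC, hg, hX, hd⟩
  · left
    -- The sampled root may be the isolated vertex, for which nothing was added; only trivial walks
    -- start or end there.
    by_cases hr2 : (r : ℕ) = 2 * n
    · have iso := splitRel_isolated (G := G) hr2
      refine ⟨r, hr, fun w hw => ?_, fun w hw => ?_⟩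
      · rcases Relation.ReflTransGen.cases_head hw with rfl | ⟨c, hc, -⟩
        · exact Relation.ReflTransGen.refl
        · exact absurd hc.1 (iso c).1
      · rcases Relation.ReflTransGen.cases_tail hw with rfl | ⟨c, -, hc⟩
        · exact Relation.ReflTransGen.refl
        · exact absurd hc.1 (iso c).2
    · exact ⟨r, hr, fun w => (h.root i hi r hr2 hr' F hF w).1,
        fun w => (h.root i hi r hr2 hr' F hF w).2⟩
  · right
    obtain ⟨Γ, h1, h2, h3⟩ := h.sample t ht
    exact ⟨S, _, g, Γ, hS, hSC, hg, hX, hd, h1, h2, h3⟩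

end ConnCert

namespace ConnCert

/-! ### The number of edges -/

theorem numEdges_unsplit_le {n : ℕ} {H : Fin (2 * n + 1) → Fin (2 * n + 1) → Prop}
    {S : Finset (Fin (2 * n + 1) × Fin (2 * n + 1))} (h : ∀ u w, H u w → (u, w) ∈ S) :
    numEdges (unsplit H) ≤ S.card := by
  rw [numEdges, ← Set.ncard_coe_finset S]
  refine Set.ncard_le_ncard_of_injOn (fun e => (out e.1, inn e.2)) (fun e he => h _ _ he) ?_
    (Finset.finite_toSet S)
  rintro ⟨a, b⟩ - ⟨c, d⟩ - h
  simp only [Prod.mk.injEq, out_inj, inn_inj] at h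
  rw [h.1, h.2]

theorem numEdges_le {n : ℕ} (G : Digraph (Fin n)) : numEdges G ≤ n * n := by
  rw [numEdges]
  refine (Set.ncard_le_ncard (Set.subset_univ _)).trans ?_
  simp [Set.ncard_univ]

theorem clog_le_log {n : ℕ} (hn : 1 ≤ n) :
    (Nat.clog 2 (2 * n + 1) : ℝ) ≤ 4 * (1 + Real.log n) := by
  have h1 : 2 ^ (Nat.clog 2 (2 * n + 1) - 1) < 2 * n + 1 :=
    Nat.pow_pred_clog_lt_self (by omega) (by omega)
  have h2 : 2 ^ (Nat.clog 2 (2 * n + 1) - 1) ≤ 4 * n := by omega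
  have hb : 0 < Nat.clog 2 (2 * n + 1) := Nat.clog_pos (by omega) (by omega)
  generalize Nat.clog 2 (2 * n + 1) = b at h2 hb
  obtain ⟨c, rfl⟩ : ∃ c, b = c + 1 := ⟨b - 1, by omega⟩
  rw [Nat.add_sub_cancel] at h2
  have hn' : (0 : ℝ) < n := by exact_mod_cast hn
  have h3 : ((2 : ℝ) ^ c) ≤ 2 ^ 2 * n := by norm_num; exact_mod_cast h2
  have h4 := Real.log_le_log (by positivity) h3
  rw [Real.log_mul (by norm_num) hn'.ne', Real.log_pow, Real.log_pow] at h4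
  have h5 := Real.log_two_gt_d9
  have h6 : 0 ≤ Real.log n := Real.log_natCast_nonneg n
  push_cast at h4 ⊢
  have h7 : (c : ℝ) ≤ 2 + 2 * Real.log n := by
    by_contra h
    push Not at h
    nlinarith
  linarith

theorem rpow_three_le {n N f : ℕ} (hn : 1 ≤ n) (hN : N = 2 * n + 1) (hf : 1 ≤ f) :
    (N : ℝ) ^ (2 - 1 / (f : ℝ)) ≤ 9 * (n : ℝ) ^ (2 - 1 / (f : ℝ)) := by
  have hf' : (1 : ℝ) ≤ f := by exact_mod_cast hf
  have h1 : 0 ≤ 1 / (f : ℝ) := by positivity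
  have h2 : 1 / (f : ℝ) ≤ 1 := by rw [div_le_one (by linarith)]; exact hf'
  have h3 : (N : ℝ) ≤ 3 * n := by exact_mod_cast (by omega : N ≤ 3 * n)
  calc (N : ℝ) ^ (2 - 1 / (f : ℝ)) ≤ (3 * n) ^ (2 - 1 / (f : ℝ)) :=
        Real.rpow_le_rpow (by positivity) h3 (by linarith)
    _ = 3 ^ (2 - 1 / (f : ℝ)) * (n : ℝ) ^ (2 - 1 / (f : ℝ)) :=
        Real.mul_rpow (by norm_num) (by positivity)
    _ ≤ 3 ^ (2 : ℝ) * (n : ℝ) ^ (2 - 1 / (f : ℝ)) := by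
        refine mul_le_mul_of_nonneg_right ?_ (by positivity)
        exact Real.rpow_le_rpow_of_exponent_le (by norm_num) (by linarith)
    _ = 9 * (n : ℝ) ^ (2 - 1 / (f : ℝ)) := by norm_num

/-- Numbers of samples and of roots in terms of the size. -/
theorem two_pow_le_rpow {N f b a : ℕ} (hb : b = Nat.clog 2 N) (hN : 1 < N) (hf : 1 ≤ f)
    (ha : a * f < b) (ha' : b ≤ (a + 1) * f) :
    (2 : ℝ) ^ ((a + 1) * (f - 1)) ≤ 2 ^ f * (N : ℝ) ^ (1 - 1 / (f : ℝ)) ∧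
      ((a + 1 ≤ b) → (2 : ℝ) ^ (b - (a + 1)) ≤ 2 * (N : ℝ) ^ (1 - 1 / (f : ℝ))) := by
  have hlt : 2 ^ (b - 1) < N := hb ▸ Nat.pow_pred_clog_lt_self (by omega) hN
  have hle : N ≤ 2 ^ b := hb ▸ Nat.le_pow_clog (by omega) N
  have hf' : (1 : ℝ) ≤ f := by exact_mod_cast hf
  have hf0 : (f : ℝ) ≠ 0 := by positivity
  have hinv : 1 / (f : ℝ) ≤ 1 := by rw [div_le_one (by linarith)]; exact hf'
  have hN0 : (0 : ℝ) < N := by exact_mod_cast (by omega : 0 < N)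
  constructor
  · have h1 : (a + 1) * (f - 1) ≤ a * (f - 1) + f := by
      obtain ⟨g, rfl⟩ : ∃ g, f = g + 1 := ⟨f - 1, by omega⟩
      simp only [Nat.add_sub_cancel]; ring_nf; omega
    have h2 : (2 : ℝ) ^ (a * (f - 1)) = ((2 : ℝ) ^ (a * f)) ^ (1 - 1 / (f : ℝ)) := by
      rw [← Real.rpow_natCast, ← Real.rpow_natCast, ← Real.rpow_mul (by norm_num)]
      congr 1
      push_cast [Nat.cast_sub hf]
      field_simp
    have h3 : (2 : ℝ) ^ (a * f) ≤ N := by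
      exact_mod_cast (Nat.pow_le_pow_right (by omega) (by omega : a * f ≤ b - 1)).trans hlt.le
    calc (2 : ℝ) ^ ((a + 1) * (f - 1)) ≤ 2 ^ (a * (f - 1) + f) :=
          pow_le_pow_right₀ (by norm_num) h1
      _ = 2 ^ f * (2 : ℝ) ^ (a * (f - 1)) := by rw [pow_add, mul_comm]
      _ ≤ 2 ^ f * (N : ℝ) ^ (1 - 1 / (f : ℝ)) := by
          rw [h2]
          exact mul_le_mul_of_nonneg_left
            (Real.rpow_le_rpow (by positivity) h3 (by linarith)) (by positivity)
  · intro hab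
    have h1 : (N : ℝ) ^ (1 / (f : ℝ)) ≤ 2 ^ (a + 1) := by
      have h2 : (N : ℝ) ≤ ((2 : ℝ) ^ (a + 1)) ^ (f : ℝ) := by
        rw [Real.rpow_natCast, ← pow_mul]
        exact_mod_cast hle.trans (Nat.pow_le_pow_right (by omega) ha')
      calc (N : ℝ) ^ (1 / (f : ℝ)) ≤ (((2 : ℝ) ^ (a + 1)) ^ (f : ℝ)) ^ (1 / (f : ℝ)) :=
            Real.rpow_le_rpow hN0.le h2 (by positivity)
        _ = 2 ^ (a + 1) := by
            rw [← Real.rpow_mul (by positivity), mul_one_div_cancel hf0, Real.rpow_one]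
    have h2 : (2 : ℝ) ^ b ≤ 2 * N := by
      obtain ⟨c, rfl⟩ : ∃ c, b = c + 1 := ⟨b - 1, by omega⟩
      rw [pow_succ, mul_comm]
      have : (2 : ℝ) ^ c ≤ N := by exact_mod_cast hlt.le
      linarith
    have h3 : (2 : ℝ) ^ b = 2 ^ (b - (a + 1)) * 2 ^ (a + 1) := by
      rw [← pow_add]; congr 1; omega
    have h4 : (N : ℝ) ^ (1 - 1 / (f : ℝ)) * (N : ℝ) ^ (1 / (f : ℝ)) = N := by
      rw [← Real.rpow_add hN0, sub_add_cancel, Real.rpow_one]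
    have h5 : (0 : ℝ) < (N : ℝ) ^ (1 / (f : ℝ)) := by positivity
    refine le_of_mul_le_mul_right ?_ h5
    calc (2 : ℝ) ^ (b - (a + 1)) * (N : ℝ) ^ (1 / (f : ℝ))
        ≤ 2 ^ (b - (a + 1)) * 2 ^ (a + 1) := mul_le_mul_of_nonneg_left h1 (by positivity)
      _ = 2 ^ b := h3.symm
      _ ≤ 2 * N := h2
      _ = 2 * (N : ℝ) ^ (1 - 1 / (f : ℝ)) * (N : ℝ) ^ (1 / (f : ℝ)) := by rw [mul_assoc, h4]

/-- Samples cost 64b² · 2^f N^(1-1/f) times O(N b) edges each, and roots cost 64b² · 2N^(1-1/f)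
times 2N · 2^f edges each. With b = O(1 + log n) both are absorbed; the factor k in the bound is not
needed. -/
theorem edge_bound {n k a : ℕ} (hn : 1 ≤ n) (hk : 2 ≤ k)
    (ha : a * (k - 1) < Nat.clog 2 (2 * n + 1)) (ha' : Nat.clog 2 (2 * n + 1) ≤ (a + 1) * (k - 1)) :
    ((Nat.clog 2 (2 * n + 1) * (Nat.clog 2 (2 * n + 1) * 64) * 2 ^ ((a + 1) * (k - 1 - 1)) *
        (32 * (2 * n + 1) * (Nat.log 2 (2 * n + 1) + 1)) +
      Nat.clog 2 (2 * n + 1) * (Nat.clog 2 (2 * n + 1) * 64) *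
        2 ^ (Nat.clog 2 (2 * n + 1) - (a + 1)) * (2 * (2 * n + 1) * 2 ^ (k - 1)) : ℕ) : ℝ) ≤
      5000000 * (1 + Real.log n) ^ 3 *
        ((k : ℝ) * 2 ^ k * (n : ℝ) ^ (2 - 1 / ((k : ℝ) - 1))) := by
  obtain ⟨f, rfl⟩ : ∃ f, k = f + 1 := ⟨k - 1, by omega⟩
  have hf : 1 ≤ f := by omega
  rw [Nat.add_sub_cancel] at ha ha'
  rw [Nat.add_sub_cancel]
  have hb1 := clog_le_log hn
  have hlog := Nat.log_le_clog 2 (2 * n + 1)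
  have h9 := rpow_three_le (N := 2 * n + 1) hn rfl hf
  have hb0 : 1 ≤ Nat.clog 2 (2 * n + 1) := Nat.clog_pos (by omega) (by omega)
  have hab : a + 1 ≤ Nat.clog 2 (2 * n + 1) :=
    lt_of_le_of_lt (Nat.le_mul_of_pos_right a hf) ha
  obtain ⟨h1, h2⟩ := two_pow_le_rpow rfl (by omega) hf ha ha'
  have h2 := h2 hab
  generalize Nat.clog 2 (2 * n + 1) = b at *
  generalize hlg : Nat.log 2 (2 * n + 1) = l at *
  generalize hNN : 2 * n + 1 = N at *
  have hNr : (0 : ℝ) < N := by exact_mod_cast (by omega : 0 < N)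
  set e : ℝ := 1 - 1 / (f : ℝ) with he
  have hP : (N : ℝ) ^ (2 - 1 / (f : ℝ)) = N * (N : ℝ) ^ e := by
    rw [← Real.rpow_one_add' hNr.le]
    · congr 1; rw [he]; ring
    · have : 0 ≤ e := by
        rw [he, sub_nonneg, div_le_one (by positivity)]; exact_mod_cast hf
      linarith
  have hP0 : (0 : ℝ) ≤ (N : ℝ) ^ e := by positivity
  rw [hP] at h9
  push_cast
  set P : ℝ := (N : ℝ) ^ e with hPdef
  set L : ℝ := 1 + Real.log n with hL
  have hL0 : 0 ≤ L := by have := Real.log_natCast_nonneg n; rw [hL]; linarith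
  have hb0' : (1 : ℝ) ≤ b := by exact_mod_cast hb0
  have hl : (l : ℝ) + 1 ≤ 2 * b := by
    have : (l : ℝ) ≤ b := by exact_mod_cast hlog
    linarith
  have hkk : (f : ℝ) + 1 - 1 = f := by ring
  rw [hkk]
  set R : ℝ := (n : ℝ) ^ (2 - 1 / (f : ℝ)) with hR
  have hR0 : 0 ≤ R := by positivity
  have h2f : (0 : ℝ) < 2 ^ f := by positivity
  have t1 : (b : ℝ) * (b * 64) * 2 ^ ((a + 1) * (f - 1)) * (32 * N * (l + 1)) ≤
      b * (b * 64) * (2 ^ f * P) * (32 * N * (2 * b)) := by gcongr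
  have t2 : (b : ℝ) * (b * 64) * 2 ^ (b - (a + 1)) * (2 * N * 2 ^ f) ≤
      b * (b * 64) * (2 * P) * (2 * N * 2 ^ f) := by gcongr
  -- 4352 is 64 · 32 · 2 from the samples plus 64 · 2 · 2 from the roots.
  have t3 : b * (b * 64) * (2 ^ f * P) * (32 * N * (2 * b)) +
      b * (b * 64) * (2 * P) * (2 * N * 2 ^ f) ≤ (4352 : ℝ) * b ^ 3 * (2 ^ f * (N * P)) := by
    have : b * (b * 64) * (2 * P) * (2 * N * 2 ^ f) ≤ (256 : ℝ) * b ^ 3 * (2 ^ f * (N * P)) := by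
      have hbb : (b : ℝ) ^ 2 ≤ b ^ 3 := pow_le_pow_right₀ hb0' (by norm_num)
      calc (b : ℝ) * (b * 64) * (2 * P) * (2 * N * 2 ^ f) = 256 * b ^ 2 * (2 ^ f * (N * P)) := by ring
        _ ≤ _ := by gcongr
    calc _ ≤ b * (b * 64) * (2 ^ f * P) * (32 * N * (2 * b)) +
          (256 : ℝ) * b ^ 3 * (2 ^ f * (N * P)) := by linarith
      _ = _ := by ring
  have t4 : (4352 : ℝ) * b ^ 3 * (2 ^ f * (N * P)) ≤
      4352 * (4 * L) ^ 3 * (2 ^ f * (9 * R)) := by gcongr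
  have t5 : (4352 : ℝ) * (4 * L) ^ 3 * (2 ^ f * (9 * R)) ≤
      5000000 * L ^ 3 * (((f : ℝ) + 1) * 2 ^ (f + 1) * R) := by
    have h3 : (0 : ℝ) ≤ L ^ 3 * 2 ^ f * R := by positivity
    have hf1 : (1 : ℝ) ≤ f := by exact_mod_cast hf
    calc (4352 : ℝ) * (4 * L) ^ 3 * (2 ^ f * (9 * R)) = 2506752 * (L ^ 3 * 2 ^ f * R) := by ring
      _ ≤ (5000000 * ((f + 1) * 2)) * (L ^ 3 * 2 ^ f * R) :=
          mul_le_mul_of_nonneg_right (by linarith) h3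
      _ = _ := by ring
  linarith

/-- With so many faults n ≤ 2^f, hence n^(1/f) ≤ 2 and n² is at most 2n^(2-1/f). -/
theorem trivial_bound {n k : ℕ} (hn : 1 ≤ n) (hk : 2 ≤ k)
    (hle : Nat.clog 2 (2 * n + 1) ≤ k - 1) :
    ((n * n : ℕ) : ℝ) ≤ 5000000 * (1 + Real.log n) ^ 3 *
        ((k : ℝ) * 2 ^ k * (n : ℝ) ^ (2 - 1 / ((k : ℝ) - 1))) := by
  obtain ⟨f, rfl⟩ : ∃ f, k = f + 1 := ⟨k - 1, by omega⟩
  have hf : 1 ≤ f := by omega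
  rw [Nat.add_sub_cancel] at hle
  push_cast
  rw [add_sub_cancel_right]
  have hn0 : (0 : ℝ) < n := by exact_mod_cast hn
  have hf0 : (f : ℝ) ≠ 0 := by positivity
  have h1 : (n : ℝ) ≤ (2 : ℝ) ^ (f : ℝ) := by
    rw [Real.rpow_natCast]
    have h2 : 2 * n + 1 ≤ 2 ^ f :=
      (Nat.le_pow_clog (by omega) _).trans (Nat.pow_le_pow_right (by omega) hle)
    exact_mod_cast (by omega : n ≤ 2 ^ f)
  have h2 : (n : ℝ) ^ (1 / (f : ℝ)) ≤ 2 := by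
    calc (n : ℝ) ^ (1 / (f : ℝ)) ≤ ((2 : ℝ) ^ (f : ℝ)) ^ (1 / (f : ℝ)) :=
          Real.rpow_le_rpow hn0.le h1 (by positivity)
      _ = 2 := by rw [← Real.rpow_mul (by norm_num), mul_one_div_cancel hf0, Real.rpow_one]
  have h3 : (n : ℝ) * n = (n : ℝ) ^ (2 - 1 / (f : ℝ)) * (n : ℝ) ^ (1 / (f : ℝ)) := by
    rw [← Real.rpow_add hn0, sub_add_cancel, Real.rpow_two, sq]
  set R : ℝ := (n : ℝ) ^ (2 - 1 / (f : ℝ)) with hR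
  have hR0 : 0 ≤ R := by positivity
  have hL : 1 ≤ (1 + Real.log n) ^ 3 :=
    one_le_pow₀ (by have := Real.log_natCast_nonneg n; linarith)
  have h4 : (1 : ℝ) ≤ ((f : ℝ) + 1) * 2 ^ (f + 1) := by
    have h5 : (1 : ℝ) ≤ 2 ^ (f + 1) := one_le_pow₀ (by norm_num)
    have h6 : (1 : ℝ) ≤ (f : ℝ) + 1 := by have : (0 : ℝ) ≤ f := by positivity
                                          linarith
    nlinarith
  calc (n : ℝ) * n ≤ R * 2 := by rw [h3]; exact mul_le_mul_of_nonneg_left h2 hR0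
    _ ≤ 5000000 * 1 * (1 * R) := by linarith
    _ ≤ 5000000 * (1 + Real.log n) ^ 3 * (((f : ℝ) + 1) * 2 ^ (f + 1) * R) := by gcongr

end ConnCert

namespace ConnCert
namespace FP

/-! ### The algorithm -/

/-- Computes a cap for the numbers of iterations of all loops. -/
def capLoops : FP :=
  loop 61 0 (loop 62 0 (loop 63 0 (loop 64 0 (assign 60 (.add (v 60) (num 30000))))))

/-- The certificate algorithm. -/
def algorithm : Prog :=
  .seq (.assign 2 (.var 0)) (.seq capLoops.compile (.seq (.assign 2 (.var 60)) main.compile))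

theorem capLoops_spec {ω : ℕ → Bool} {s : State} {n : ℕ} (h0 : s.var 0 = n) (h2 : s.var 2 = n) :
    (sem ω capLoops s).var 60 = s.var 60 + n * (n * (n * (n * 30000))) := by
  rw [capLoops, sem_iterVar (B := n) (by decide) (by decide)
    (fun x => x + n * (n * (n * 30000))) (by omega), iterate_add]
  intro s₁ hfr
  have g0 := (hfr.var 0 (by decide)).trans h0
  have g2 := (hfr.var 2 (by decide)).trans h2
  rw [sem_iterVar (B := n) (by decide) (by decide)
    (fun x => x + n * (n * 30000)) (by omega), iterate_add]
  intro s₂ hfr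
  have g0 := (hfr.var 0 (by decide)).trans g0
  have g2 := (hfr.var 2 (by decide)).trans g2
  rw [sem_iterVar (B := n) (by decide) (by decide)
    (fun x => x + n * 30000) (by omega), iterate_add]
  intro s₃ hfr
  have g0 := (hfr.var 0 (by decide)).trans g0
  have g2 := (hfr.var 2 (by decide)).trans g2
  rw [sem_iterVar (B := n) (by decide) (by decide) (fun x => x + 30000) (by omega), iterate_add]
  intro s₄ _
  simp [sem, Expr.eval, State.setVar_var]

theorem capLoops_wf : capLoops.wf = true := by decide

theorem main_wf : main.wf = true := by decide

theorem algorithm_exec : ∃ p : Polynomial ℕ, ∀ (ω : ℕ → Bool) (n k : ℕ) (G : Digraph (Fin n)),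
    ∃ t s, Exec ω algorithm (inputState G k) t (sem ω main s) ∧ t ≤ p.eval n ∧
      s.var 0 = n ∧ s.var 1 = k ∧ s.var 2 = 30000 * n ^ 4 ∧ s.used = 0 ∧
      s.arr = (inputState G k).arr := by
  obtain ⟨q₁, h₁⟩ := exec_compile capLoops capLoops_wf
  obtain ⟨q₂, h₂⟩ := exec_compile main main_wf
  -- The cap computation runs under the cap n and the main program under the cap 30000n^4; the two
  -- assignments of the cap cost 2 each.
  refine ⟨Polynomial.C 4 + q₁ + q₂.comp (Polynomial.C 30000 * Polynomial.X ^ 4),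
    fun ω n k G => ?_⟩
  set s₀ := inputState G k with hs₀
  have v0 : (s₀.setVar 2 n).var 0 = n := by simp [State.setVar_var, hs₀, inputState]
  have v2 : (s₀.setVar 2 n).var 2 = n := by simp [State.setVar_var]
  have v1 : (s₀.setVar 2 n).var 1 = k := by simp [State.setVar_var, hs₀, inputState]
  have v60 : (s₀.setVar 2 n).var 60 = 0 := by simp [State.setVar_var, hs₀, inputState]
  have e1 : Exec ω (.assign 2 (.var 0)) s₀ 2 (s₀.setVar 2 n) := by
    have := Exec.assign (ω := ω) s₀ 2 (.var 0)
    exact this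
  have ha : (s₀.setVar 2 n).arr = s₀.arr := rfl
  have hu : (s₀.setVar 2 n).used = 0 := rfl
  generalize s₀.setVar 2 n = s₁ at v0 v1 v2 v60 e1 ha hu
  obtain ⟨t₁, e2, l2⟩ := h₁ ω n s₁ v2.le fun s' hs' => ((hs'.var 2 (by decide)).trans v2).le
  have hcap := capLoops_spec (ω := ω) v0 v2
  have hfr := frame_sem ω capLoops s₁
  generalize sem ω capLoops s₁ = s₂ at e2 hcap hfr
  have hcap : s₂.var 60 = 30000 * n ^ 4 := by rw [hcap, v60]; ring
  have e3 := Exec.assign (ω := ω) s₂ 2 (.var 60)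
  simp only [Expr.eval, Expr.cost, hcap] at e3
  have w0 : (s₂.setVar 2 (30000 * n ^ 4)).var 0 = n := by
    rw [State.setVar_var, if_neg (by decide), hfr.var 0 (by decide), v0]
  have w1 : (s₂.setVar 2 (30000 * n ^ 4)).var 1 = k := by
    rw [State.setVar_var, if_neg (by decide), hfr.var 1 (by decide), v1]
  have w2 : (s₂.setVar 2 (30000 * n ^ 4)).var 2 = 30000 * n ^ 4 := by
    rw [State.setVar_var, if_pos rfl]
  have wu : (s₂.setVar 2 (30000 * n ^ 4)).used = 0 := (hfr.used rfl).trans hu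
  have wa : (s₂.setVar 2 (30000 * n ^ 4)).arr = s₀.arr := by
    rw [State.setVar_arr, ← ha]
    funext z
    exact hfr.arr z (by simp [ma, capLoops])
  generalize s₂.setVar 2 (30000 * n ^ 4) = s₃ at e3 w0 w1 w2 wu wa
  obtain ⟨t₂, e4, l4⟩ := h₂ ω (30000 * n ^ 4) s₃ w2.le
    fun s' hs' => ((hs'.var 2 (by decide)).trans w2).le
  refine ⟨_, s₃, e1.seq (e2.seq (e3.seq e4)), ?_, w0, w1, w2, wu, wa⟩
  simp only [Polynomial.eval_add, Polynomial.eval_C, Polynomial.eval_comp, Polynomial.eval_mul,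
    Polynomial.eval_pow, Polynomial.eval_X]
  omega

theorem algorithm_correct (n k : ℕ) (hn : 1 ≤ n) (hk : 2 ≤ k) (G : Digraph (Fin n))
    (ω : ℕ → Bool) (s : State) (h0 : s.var 0 = n) (h1 : s.var 1 = k)
    (h2 : s.var 2 = 30000 * n ^ 4) (hu : s.used = 0) (ha : s.arr = (inputState G k).arr) :
    (Nat.clog 2 (2 * n + 1) ≤ k - 1 → outputGraph n (sem ω main s) = G) ∧
    (k - 1 < Nat.clog 2 (2 * n + 1) → ∃ a, a * (k - 1) < Nat.clog 2 (2 * n + 1) ∧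
      Nat.clog 2 (2 * n + 1) ≤ (a + 1) * (k - 1) ∧
      ∃ H : Fin (2 * n + 1) → Fin (2 * n + 1) → Prop,
        Outcome ω G (k - 1) (Nat.clog 2 (2 * n + 1)) (a + 1)
          (Nat.clog 2 (2 * n + 1) * (Nat.clog 2 (2 * n + 1) * 64) *
            2 ^ ((a + 1) * (k - 1 - 1)))
          (Nat.clog 2 (2 * n + 1) * (Nat.clog 2 (2 * n + 1) * 64) *
            2 ^ (Nat.clog 2 (2 * n + 1) - (a + 1))) H ∧
        outputGraph n (sem ω main s) = unsplit H) := by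
  refine main_spec hn hk h0 h1 h2.ge hu ?_ G ?_ ?_
  · intro i j; simp [ha, inputState]
  · intro i j; simp only [ha, inputState]; split_ifs <;> omega
  · intro i j; simp [ha, inputState]

end FP

/-- Quotients are determined by their defining inequalities. -/
theorem quotient_unique {a a' f b : ℕ} (h1 : a * f < b) (h2 : b ≤ (a + 1) * f) (h1' : a' * f < b)
    (h2' : b ≤ (a' + 1) * f) : a = a' := by
  have h3 : a < a' + 1 := lt_of_mul_lt_mul_right (h1.trans_le h2') (Nat.zero_le f)
  have h4 : a' < a + 1 := lt_of_mul_lt_mul_right (h1'.trans_le h2) (Nat.zero_le f)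
  omega

end ConnCert

/-! ### Running time, certificates and success probability -/

theorem mainTheorem8 :
    ∃ (A : ConnCert.Prog) (p : Polynomial ℕ) (C : ℝ) (c : ℕ),
      ∀ (n k : ℕ) (G : Digraph (Fin n)), 1 ≤ n → 2 ≤ k →
        ConnCert.HaltsWithin A G k (p.eval n) ∧
        ENNReal.ofReal (1 - 1 / (n : ℝ) ^ 4) ≤
          ConnCert.successProb A G k (fun H =>
            ConnCert.IsEdgeCertificate k G H ∧ ConnCert.IsVertexCertificate k G H ∧
            (ConnCert.numEdges H : ℝ) ≤
              C * (1 + Real.log n) ^ c *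
                ((k : ℝ) * 2 ^ k * (n : ℝ) ^ (2 - 1 / ((k : ℝ) - 1)))) := by
  obtain ⟨p, hp⟩ := ConnCert.FP.algorithm_exec
  refine ⟨ConnCert.FP.algorithm, p, 5000000, 3, fun n k G hn hk => ⟨fun ω => ?_, ?_⟩⟩
  · obtain ⟨t, s, h, ht, -⟩ := hp ω n k G
    exact ⟨t, _, h, ht⟩
  · rw [ConnCert.successProb]
    by_cases hle : Nat.clog 2 (2 * n + 1) ≤ k - 1
    · refine le_of_le_of_eq (b := 1) ?_ ?_
      · rw [← ENNReal.ofReal_one]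
        exact ENNReal.ofReal_le_ofReal (by
          have : (0 : ℝ) ≤ 1 / (n : ℝ) ^ 4 := by positivity
          linarith)
      · rw [← measure_univ (μ := ConnCert.coins)]
        congr 1
        refine (Set.eq_univ_of_forall fun ω => ?_).symm
        obtain ⟨t, s, h, -, h0, h1, h2, hu, ha⟩ := hp ω n k G
        refine ⟨t, _, h, ?_⟩
        rw [(ConnCert.FP.algorithm_correct n k hn hk G ω s h0 h1 h2 hu ha).1 hle]
        refine ⟨⟨le_rfl, fun _ _ h => h⟩, ⟨le_rfl, fun _ _ h => h⟩, ?_⟩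
        refine le_trans ?_ (ConnCert.trivial_bound hn hk hle)
        exact_mod_cast ConnCert.numEdges_le G
    · push Not at hle
      -- An arbitrary coin sequence is run only to obtain the number `a`, which has to be fixed
      -- before the bad event can be described.
      obtain ⟨t₀, s₀, -, -, h0, h1, h2, hu, ha⟩ := hp (fun _ => true) n k G
      obtain ⟨a, ha1, ha2, -⟩ :=
        (ConnCert.FP.algorithm_correct n k hn hk G (fun _ => true) s₀ h0 h1 h2 hu ha).2 hle
      have hbad := ConnCert.not_all_served_le (n := n) (A := a + 1)
        (ConnCert.splitRel G) ⟨2 * n, by omega⟩ (ConnCert.splitRel_isolated rfl _).1 hn (by omega)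
        (Nat.le_pow_clog (by omega) (2 * n + 1)) (by omega)
        (lt_of_le_of_lt (Nat.le_mul_of_pos_right a (by omega)) ha1) hle
      set good : Set (ℕ → Bool) := {ω | ∃ t s,
        ConnCert.Exec ω ConnCert.FP.algorithm (ConnCert.inputState G k) t s ∧
          (ConnCert.IsEdgeCertificate k G (ConnCert.outputGraph n s) ∧
            ConnCert.IsVertexCertificate k G (ConnCert.outputGraph n s) ∧
            (ConnCert.numEdges (ConnCert.outputGraph n s) : ℝ) ≤
              5000000 * (1 + Real.log n) ^ 3 *
                ((k : ℝ) * 2 ^ k * (n : ℝ) ^ (2 - 1 / ((k : ℝ) - 1))))} with hgood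
      have hcompl : ConnCert.coins.real goodᶜ ≤ 1 / (n : ℝ) ^ 4 := by
        refine (measureReal_mono ?_ (measure_ne_top _ _)).trans hbad
        intro ω hω hs
        refine hω ?_
        obtain ⟨t, s, h, -, h0, h1, h2, hu, ha⟩ := hp ω n k G
        obtain ⟨a', ha1', ha2', H, hout, hH⟩ :=
          (ConnCert.FP.algorithm_correct n k hn hk G ω s h0 h1 h2 hu ha).2 hle
        -- The parameter found for the present coins is the one fixed above, so the bad event is the
        -- same.
        obtain rfl := ConnCert.quotient_unique ha1 ha2 ha1' ha2'
        have hft := hout.ftss hs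
        refine ⟨t, _, h, ?_⟩
        rw [hH]
        refine ⟨hft.isEdgeCertificate (by omega) hout.sub, hft.isVertexCertificate hk hout.sub, ?_⟩
        obtain ⟨S, hS, hS'⟩ := hout.size
        refine le_trans ?_ (ConnCert.edge_bound hn hk ha1 ha2)
        exact_mod_cast (ConnCert.numEdges_unsplit_le hS').trans hS
      -- Subadditivity is enough, so the measurability of the success event is never needed.
      have htot : 1 ≤ ConnCert.coins.real good + ConnCert.coins.real goodᶜ := by
        have := measureReal_union_le (μ := ConnCert.coins) good goodᶜ
        rwa [Set.union_compl_self, probReal_univ] at this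
      refine ENNReal.ofReal_le_of_le_toReal ?_
      have : 1 - 1 / (n : ℝ) ^ 4 ≤ ConnCert.coins.real good := by linarith
      exact this
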